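/- Theorem (TDS learning of general halfspaces). Let $\mathcal C_d$ be the class of general halfspaces over $\mathbb R^d$, i.e. of the functions $x\mapsto \mathrm{sign}(v\cdot x-\tau)\in\{\pm1\}$ with $v\in\mathbb R^d$, $\tau\in\mathbb R$ (where $\mathrm{sign}(0)=1$). For $d\ge 1$ and $\epsilon\in(0,1)$ write $\bar d=\max(d,2)$ and $L_\epsilon=\log\max(1/\epsilon,2)$ (so $\bar d^{\,L_\epsilon}=d^{\log(1/\epsilon)}$ when $d\ge2$ and $\epsilon\le 1/2$). There are a single deterministic algorithm $M$ (a real-RAM program with rational constants and unit-cost exact arithmetic and comparisons) and a constant $C_0>0$ such that for every $C\ge C_0$ there is a constant $K$ for which the following holds for all $d\ge1$ and $\epsilon\in(0,1)$. Let $m=\lceil C\,\bar d^{\,C L_\epsilon}\rceil$. Given $d$, $m$, $\epsilon$, any $m$ labelled training points in $\mathbb R^d\times\{\pm1\}$ and any $m$ unlabelled test points in $\mathbb R^d$, $M$ halts within $\bar d^{\,K L_\epsilon}$ steps and either rejects, or accepts and outputs the parameters $(v,\tau)$ of a halfspace $\hat f$. Moreover, let $\mathcal D^{\mathrm{train}},\mathcal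 D^{\mathrm{test}}$ be any probability distributions on $\mathbb R^d\times\{\pm1\}$ such that the $\mathbb R^d$-marginal of $\mathcal D^{\mathrm{train}}$ is $\mathcal N(0,I_d)$ and some $f\in\mathcal C_d$ satisfies $\Pr_{(x,y)\sim\mathcal D^{\mathrm{train}}}[y\ne f(x)]=\Pr_{(x,y)\sim\mathcal D^{\mathrm{test}}}[y\neq f(x)]=0$ (the realizable setting). If the training points are drawn i.i.d. from $\mathcal D^{\mathrm{train}}$ and the test points, independently, i.i.d. from the $\mathbb R^d$-marginal of $\mathcal D^{\mathrm{test}}$, then: (Soundness) with probability at least $0.99$ it holds that, if $M$ accepts, then $\Pr_{(x,y)\sim\mathcal D^{\mathrm{test}}}[y\neq\hat f(x)]\le\epsilon$; (Completeness) if the $\mathbb R^d$-marginal of $\mathcal D^{\mathrm{test}}$ is $\mathcal N(0,I_d)$, then $M$ accepts with probability at least $0.99$. -/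

import Mathlib

open MeasureTheory ProbabilityTheory

noncomputable section

/-! ## Learning: halfspaces, errors, TDS learners

Labels live in `ℤˣ = {1, -1}`. -/

namespace TDS

/-- The sign of a real number as a label, with the convention `sign 0 = +1`. -/
def signLabel (t : ℝ) : ℤˣ := if 0 ≤ t then 1 else -1

/-- The general halfspace `x ↦ sign (v · x - τ)` over `ℝ^d`. -/
def halfspace {d : ℕ} (v : EuclideanSpace ℝ (Fin d)) (τ : ℝ) :
    EuclideanSpace ℝ (Fin d) → ℤˣ :=
  fun x => signLabel (inner ℝ v x - τ)

/-- The class of general halfspaces over `ℝ^d`. -/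
def generalHalfspaces (d : ℕ) : Set (EuclideanSpace ℝ (Fin d) → ℤˣ) :=
  {f | ∃ v τ, f = halfspace v τ}

section Model

variable {X : Type*} [MeasurableSpace X]

/-- `err(h; D) = Pr_{(x,y) ∼ D}[y ≠ h(x)]`. -/
def err (h : X → ℤˣ) (D : Measure (X × ℤˣ)) : ENNReal :=
  D {p | p.2 ≠ h p.1}

/-- The realizable setting, `λ = min_{f ∈ 𝓒} (err(f; train) + err(f; test)) = 0`. -/
def Realizable (𝓒 : Set (X → ℤˣ)) (train test : Measure (X × ℤˣ)) : Prop :=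
  ∃ f ∈ 𝓒, err f train + err f test = 0

/-- `A`, which receives `m` labelled training examples and `m` unlabelled test examples and
returns `none` (reject) or `some h` (accept with hypothesis `h`), is a TDS learner for `𝓒` with
respect to `𝓓` in the realizable setting, with accuracy `ε` and failure probability `δ`.
Bad events are bounded in outer measure, so no measurability of `A` is presupposed. -/
def IsTDSLearner (𝓒 : Set (X → ℤˣ)) (𝓓 : Measure X) (ε δ : ℝ) {m : ℕ}
    (A : (Fin m → X × ℤˣ) → (Fin m → X) → Option (X → ℤˣ)) : Prop :=
  ∀ train test : Measure (X × ℤˣ), IsProbabilityMeasure train → IsProbabilityMeasure test →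
    train.fst = 𝓓 → Realizable 𝓒 train test →
    -- soundness
    ((Measure.pi fun _ : Fin m => train).prod (Measure.pi fun _ : Fin m => test.fst))
        {S | ¬ ∀ h, A S.1 S.2 = some h → err h test ≤ ENNReal.ofReal ε} ≤ ENNReal.ofReal δ ∧
    -- completeness
    (test.fst = train.fst →
      ((Measure.pi fun _ : Fin m => train).prod (Measure.pi fun _ : Fin m => test.fst))
        {S | ¬ ∃ h, A S.1 S.2 = some h} ≤ ENNReal.ofReal δ)

end Model

end TDS

/-! ## The machine model: a real RAM with a step count

Memory consists of arrays of natural numbers and arrays of real numbers (a program names finitely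
many of them). Integer operations are addition and truncated subtraction; real
operations are exact field operations (with `x / 0 = 0`); tests are `≤` on either sort. There is
no rounding of reals to integers. Every operation, memory access and test costs one step.
Programs are structured and their constants are natural or rational numbers. -/

namespace RealRAM

/-- Contents of the memory: `s.nat a i` and `s.real a i` are the entries number `i` of the
natural-number array and of the real array with name `a`. -/
structure State where
  nat : ℕ → ℕ → ℕ
  real : ℕ → ℕ → ℝ

/-- Natural-number expressions. -/
inductive NatExpr where
  | const (n : ℕ)
  | get (a : ℕ) (i : NatExpr)
  | add (e₁ e₂ : NatExpr)
  | sub (e₁ e₂ : NatExpr)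

/-- Real expressions; array indices are natural-number expressions. -/
inductive RealExpr where
  | const (q : ℚ)
  | ofNat (e : NatExpr)
  | get (a : ℕ) (i : NatExpr)
  | add (e₁ e₂ : RealExpr)
  | sub (e₁ e₂ : RealExpr)
  | mul (e₁ e₂ : RealExpr)
  | div (e₁ e₂ : RealExpr)

/-- Tests. -/
inductive Test where
  | natLe (e₁ e₂ : NatExpr)
  | realLe (e₁ e₂ : RealExpr)

/-- Programs. -/
inductive Prog where
  | skip
  | setNat (a : ℕ) (i e : NatExpr)
  | setReal (a : ℕ) (i : NatExpr) (e : RealExpr)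
  | seq (p q : Prog)
  | ite (b : Test) (p q : Prog)
  | while (b : Test) (p : Prog)

namespace NatExpr

def eval (s : State) : NatExpr → ℕ
  | const n => n
  | get a i => s.nat a (i.eval s)
  | add e₁ e₂ => e₁.eval s + e₂.eval s
  | sub e₁ e₂ => e₁.eval s - e₂.eval s

def cost : NatExpr → ℕ
  | const _ => 1
  | get _ i => i.cost + 1
  | add e₁ e₂ => e₁.cost + e₂.cost + 1
  | sub e₁ e₂ => e₁.cost + e₂.cost + 1

end NatExpr

namespace RealExpr

def eval (s : State) : RealExpr → ℝ
  | const q => (q : ℝ)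
  | ofNat e => (e.eval s : ℝ)
  | get a i => s.real a (i.eval s)
  | add e₁ e₂ => e₁.eval s + e₂.eval s
  | sub e₁ e₂ => e₁.eval s - e₂.eval s
  | mul e₁ e₂ => e₁.eval s * e₂.eval s
  | div e₁ e₂ => e₁.eval s / e₂.eval s

def cost : RealExpr → ℕ
  | const _ => 1
  | ofNat e => e.cost + 1
  | get _ i => i.cost + 1
  | add e₁ e₂ => e₁.cost + e₂.cost + 1
  | sub e₁ e₂ => e₁.cost + e₂.cost + 1
  | mul e₁ e₂ => e₁.cost + e₂.cost + 1
  | div e₁ e₂ => e₁.cost + e₂.cost + 1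

end RealExpr

namespace Test

def holds (s : State) : Test → Prop
  | natLe e₁ e₂ => e₁.eval s ≤ e₂.eval s
  | realLe e₁ e₂ => e₁.eval s ≤ e₂.eval s

def cost : Test → ℕ
  | natLe e₁ e₂ => e₁.cost + e₂.cost + 1
  | realLe e₁ e₂ => e₁.cost + e₂.cost + 1

end Test

namespace State

/-- Overwrite one entry of a natural-number array. -/
def setNat (s : State) (a i n : ℕ) : State :=
  { s with nat := Function.update s.nat a (Function.update (s.nat a) i n) }

/-- Overwrite one entry of a real array. -/
def setReal (s : State) (a i : ℕ) (r : ℝ) : State :=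
  { s with real := Function.update s.real a (Function.update (s.real a) i r) }

end State

/-- `Exec p s s' t`: started in state `s`, the program `p` halts in state `s'` after exactly `t`
steps. -/
inductive Exec : Prog → State → State → ℕ → Prop where
  | skip (s : State) : Exec .skip s s 1
  | setNat (s : State) (a : ℕ) (i e : NatExpr) :
      Exec (.setNat a i e) s (s.setNat a (i.eval s) (e.eval s)) (i.cost + e.cost + 1)
  | setReal (s : State) (a : ℕ) (i : NatExpr) (e : RealExpr) :
      Exec (.setReal a i e) s (s.setReal a (i.eval s) (e.eval s)) (i.cost + e.cost + 1)
  | seq {p q : Prog} {s s₁ s₂ : State} {t₁ t₂ : ℕ}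
      (h₁ : Exec p s s₁ t₁) (h₂ : Exec q s₁ s₂ t₂) : Exec (.seq p q) s s₂ (t₁ + t₂)
  | iteTrue {b : Test} {p q : Prog} {s s₁ : State} {t : ℕ}
      (hb : b.holds s) (h : Exec p s s₁ t) : Exec (.ite b p q) s s₁ (b.cost + t)
  | iteFalse {b : Test} {p q : Prog} {s s₁ : State} {t : ℕ}
      (hb : ¬ b.holds s) (h : Exec q s s₁ t) : Exec (.ite b p q) s s₁ (b.cost + t)
  | whileTrue {b : Test} {p : Prog} {s s₁ s₂ : State} {t₁ t₂ : ℕ}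
      (hb : b.holds s) (h₁ : Exec p s s₁ t₁) (h₂ : Exec (.while b p) s₁ s₂ t₂) :
      Exec (.while b p) s s₂ (b.cost + t₁ + t₂)
  | whileFalse {b : Test} {p : Prog} {s : State}
      (hb : ¬ b.holds s) : Exec (.while b p) s s b.cost

/-- The machine is deterministic: final state and step count are determined by the start. -/
theorem Exec.deterministic {p : Prog} {s s₁ s₂ : State} {t₁ t₂ : ℕ}
    (h₁ : Exec p s s₁ t₁) (h₂ : Exec p s s₂ t₂) : s₁ = s₂ ∧ t₁ = t₂ := by
  induction h₁ generalizing s₂ t₂ with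
  | skip s => cases h₂; exact ⟨rfl, rfl⟩
  | setNat s a i e => cases h₂; exact ⟨rfl, rfl⟩
  | setReal s a i e => cases h₂; exact ⟨rfl, rfl⟩
  | seq _ _ ih₁ ih₂ =>
    cases h₂ with
    | seq k₁ k₂ =>
      obtain ⟨rfl, rfl⟩ := ih₁ k₁
      obtain ⟨rfl, rfl⟩ := ih₂ k₂
      exact ⟨rfl, rfl⟩
  | iteTrue hb _ ih =>
    cases h₂ with
    | iteTrue _ k => obtain ⟨rfl, rfl⟩ := ih k; exact ⟨rfl, rfl⟩
    | iteFalse hb' _ => exact absurd hb hb'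
  | iteFalse hb _ ih =>
    cases h₂ with
    | iteTrue hb' _ => exact absurd hb' hb
    | iteFalse _ k => obtain ⟨rfl, rfl⟩ := ih k; exact ⟨rfl, rfl⟩
  | whileTrue hb _ _ ih₁ ih₂ =>
    cases h₂ with
    | whileTrue _ k₁ k₂ =>
      obtain ⟨rfl, rfl⟩ := ih₁ k₁
      obtain ⟨rfl, rfl⟩ := ih₂ k₂
      exact ⟨rfl, rfl⟩
    | whileFalse hb' => exact absurd hb hb'
  | whileFalse hb =>
    cases h₂ with
    | whileTrue hb' _ _ => exact absurd hb' hb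
    | whileFalse _ => exact ⟨rfl, rfl⟩

end RealRAM

/-! ## Learning algorithms on the real RAM -/

namespace TDS

open RealRAM

/-- A finite list of real numbers as a memory array, padded with zeros. -/
def padded {n : ℕ} (u : Fin n → ℝ) : ℕ → ℝ :=
  fun j => if h : j < n then u ⟨j, h⟩ else 0

/-- The points of a sample, concatenated: coordinate `j` of point `i` is at index `i * d + j`. -/
def concatPoints {d m : ℕ} (T : Fin m → EuclideanSpace ℝ (Fin d)) : ℕ → ℝ :=
  padded fun k : Fin (m * d) => T k.divNat k.modNat

/-- The initial memory of a learner: the natural-number array `0` starts with `d` and `m`; the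
real array `0` starts with `ε`; the real arrays `1`, `2`, `3` hold the training points, the
training labels and the test points; everything else is zero. -/
def inputState {d m : ℕ} (ε : ℝ) (S : Fin m → EuclideanSpace ℝ (Fin d) × ℤˣ)
    (T : Fin m → EuclideanSpace ℝ (Fin d)) : State where
  nat a i := if a = 0 ∧ i = 0 then d else if a = 0 ∧ i = 1 then m else 0
  real a :=
    match a with
    | 0 => padded fun _ : Fin 1 => ε
    | 1 => concatPoints fun i => (S i).1
    | 2 => padded fun i => (((S i).2 : ℤ) : ℝ)
    | 3 => concatPoints T
    | _ => fun _ => 0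

/-- The result read off the final memory: reject if entry `0` of the natural-number array `1` is
zero; otherwise accept with the halfspace `x ↦ sign (v · x - τ)`, where `v` and `τ` are the first
`d` entries and the entry number `d` of the real array `4`. -/
def output (d : ℕ) (s : State) : Option (EuclideanSpace ℝ (Fin d) → ℤˣ) :=
  if s.nat 1 0 = 0 then none
  else some (halfspace (WithLp.toLp 2 fun j : Fin d => s.real 4 j) (s.real 4 d))

/-- On every input consisting of `ε`, `m` labelled and `m` unlabelled examples in `ℝ^d`, the
program `M` halts within `t` steps with output `A S T`. -/
def ComputesWithin {d m : ℕ} (M : Prog) (ε t : ℝ)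
    (A : (Fin m → EuclideanSpace ℝ (Fin d) × ℤˣ) → (Fin m → EuclideanSpace ℝ (Fin d)) →
      Option (EuclideanSpace ℝ (Fin d) → ℤˣ)) : Prop :=
  ∀ S T, ∃ s n, Exec M (inputState ε S T) s n ∧ (n : ℝ) ≤ t ∧ output d s = A S T

/-- `d ^ (c log (1/ε))` for `d ≥ 2` and `ε ≤ 1/2`. For smaller `d` or larger `ε`, where this
expression degenerates to a constant, `d` and `1/ε` are replaced by `2`. -/
def quasiPoly (c : ℝ) (d : ℕ) (ε : ℝ) : ℝ :=
  (max (d : ℝ) 2) ^ (c * Real.log (max (1 / ε) 2))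

/-- The sample size `C d ^ (C log (1/ε))`, rounded up. -/
def sampleSize (C : ℝ) (d : ℕ) (ε : ℝ) : ℕ :=
  ⌈C * quasiPoly C d ε⌉₊

end TDS

end

/-! Under the standard Gaussian, a halfspace `sign(v·x - τ)` with `‖v‖ = 1` satisfies `E[y x] =
2φ(τ) v` and `E[y (‖x‖² - d)] = 2φ(τ) τ`, where `φ` is the Gaussian density. A halfspace does not
change when its parameters are scaled by a positive factor, so these two averages determine it
(`chowMean_eq`, `biasMean_eq`). The learner forms the empirical sums `W` and `Θ` and branches on the
size of `W`. Write `k` for `order ε`, so that `64 < 2^k ε ≤ 128`.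

If `‖W‖ ≥ 2^(-64k) m`, the hypothesis is the halfspace `(W, Θ)`. With high probability it disagrees
with the true one only inside an explicit strip around its own boundary (`mem_strip_of_ne`). The
strip is known to the learner, which accepts if at most an `ε/2` fraction of the test points lie in
it. Under a Gaussian test marginal the strip has mass at most `ε/2000` (`stdGaussian_strip_le`), so
this test then passes.

If `‖W‖` is smaller, then `φ(τ) ≤ 2^(-64k)`, hence `τ² ≥ 64k` (`order_le_sq_bias`), or the target is
constant. The target is then constant on `{|v·x| < |τ|}`, and the first training label gives its
value there. The direction `v` is not known accurately, so the learner compares all degree-`2k`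
moments of the two samples at once: Cauchy-Schwarz in the space of tensors bounds the moment
difference in every direction (`sq_sum_sub_sum_inner_pow_le`). Markov's inequality for the `2k`-th
moment along `v` then bounds the fraction of test points in the tail by `ε/2` (`hits_tail_le`). Two
Gaussian samples pass because the off-diagonal terms of the expected squared distance cancel
(`integral_discrepancy_le`).

In both branches the test sample is independent of the training sample, so Chebyshev's inequality
for one fixed set passes from test frequencies to test probabilities; uniform convergence is not
needed. The tensors are never written down: the kernel `(⟨x, y⟩/k)^(2k)` gives a running time of
order `m² (d + k)`, which a program logic with step bounds certifies (`runs_learnerProg`). Since `k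
= O(log(1/ε))`, both this and the sample size are quasipolynomial. -/

noncomputable section

namespace RealRAM

/-! ### A program logic with step bounds -/

/-- Started in `s`, the program `p` halts within `t` steps in a state satisfying `Q`. -/
def Runs (p : Prog) (s : State) (t : ℕ) (Q : State → Prop) : Prop :=
  ∃ s' n, Exec p s s' n ∧ n ≤ t ∧ Q s'

namespace Runs

variable {p q : Prog} {s : State} {t t' t₁ t₂ : ℕ} {Q R : State → Prop}

theorem mono (h : Runs p s t Q) (ht : t ≤ t') (hQ : ∀ s', Q s' → R s') : Runs p s t' R := by
  obtain ⟨s', n, he, hn, hq⟩ := h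
  exact ⟨s', n, he, hn.trans ht, hQ _ hq⟩

theorem seq (h : Runs p s t₁ Q) (h' : ∀ s', Q s' → Runs q s' t₂ R) :
    Runs (.seq p q) s (t₁ + t₂) R := by
  obtain ⟨s', n, he, hn, hq⟩ := h
  obtain ⟨s'', n', he', hn', hr⟩ := h' s' hq
  exact ⟨s'', _, .seq he he', by omega, hr⟩

theorem skip (h : Q s) : Runs .skip s 1 Q := ⟨s, 1, .skip s, le_rfl, h⟩

theorem setNat {a : ℕ} {i e : NatExpr} (h : Q (s.setNat a (i.eval s) (e.eval s))) :
    Runs (.setNat a i e) s (i.cost + e.cost + 1) Q := ⟨_, _, .setNat s a i e, le_rfl, h⟩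

theorem setReal {a : ℕ} {i : NatExpr} {e : RealExpr}
    (h : Q (s.setReal a (i.eval s) (e.eval s))) :
    Runs (.setReal a i e) s (i.cost + e.cost + 1) Q := ⟨_, _, .setReal s a i e, le_rfl, h⟩

theorem ite {b : Test} (hp : b.holds s → Runs p s t Q) (hq : ¬ b.holds s → Runs q s t Q) :
    Runs (.ite b p q) s (b.cost + t) Q := by
  by_cases hb : b.holds s
  · obtain ⟨s', n, he, hn, hq⟩ := hp hb
    exact ⟨s', _, .iteTrue hb he, by omega, hq⟩
  · obtain ⟨s', n, he, hn, hq⟩ := hq hb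
    exact ⟨s', _, .iteFalse hb he, by omega, hq⟩

theorem whileTrue {b : Test} (hb : b.holds s) (h : Runs p s t₁ Q)
    (h' : ∀ s', Q s' → Runs (.while b p) s' t₂ R) :
    Runs (.while b p) s (b.cost + t₁ + t₂) R := by
  obtain ⟨s', n, he, hn, hq⟩ := h
  obtain ⟨s'', n', he', hn', hr⟩ := h' s' hq
  exact ⟨s'', _, .whileTrue hb he he', by omega, hr⟩

theorem whileFalse {b : Test} (hb : ¬ b.holds s) (h : Q s) :
    Runs (.while b p) s b.cost Q := ⟨s, _, .whileFalse hb, le_rfl, h⟩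

end Runs

namespace State

variable (s : State) (a b i j n : ℕ) (r : ℝ)

@[simp] theorem setNat_nat_same : (s.setNat a i n).nat a i = n := by simp [setNat]

theorem setNat_nat_of_ne {a b : ℕ} (h : b ≠ a) : (s.setNat a i n).nat b = s.nat b := by
  simp [setNat, h]

@[simp] theorem setNat_real : (s.setNat a i n).real = s.real := rfl

@[simp] theorem setReal_nat : (s.setReal a i r).nat = s.nat := rfl

@[simp] theorem setReal_real_same : (s.setReal a i r).real a i = r := by simp [setReal]

theorem setReal_real_of_ne {a b : ℕ} (h : b ≠ a) : (s.setReal a i r).real b = s.real b := by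
  simp [setReal, h]

theorem setReal_real_same_of_ne {i j : ℕ} (h : j ≠ i) :
    (s.setReal a i r).real a j = s.real a j := by
  simp [setReal, h]

end State

/-- `s'` differs from `s` at most in the natural-number arrays in `N` and the real arrays
in `R`. -/
def Frame (N R : Finset ℕ) (s s' : State) : Prop :=
  (∀ a, a ∉ N → s'.nat a = s.nat a) ∧ ∀ a, a ∉ R → s'.real a = s.real a

namespace Frame

variable {N R N' R' : Finset ℕ} {s s' s'' : State}

theorem refl (N R : Finset ℕ) (s : State) : Frame N R s s := ⟨fun _ _ => rfl, fun _ _ => rfl⟩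

theorem trans (h : Frame N R s s') (h' : Frame N' R' s' s'') (hN : N' ⊆ N) (hR : R' ⊆ R) :
    Frame N R s s'' :=
  ⟨fun a ha => (h'.1 a fun hh => ha (hN hh)).trans (h.1 a ha),
    fun a ha => (h'.2 a fun hh => ha (hR hh)).trans (h.2 a ha)⟩

theorem mono (h : Frame N' R' s s') (hN : N' ⊆ N) (hR : R' ⊆ R) : Frame N R s s' :=
  (refl N R s).trans h hN hR

theorem setNat (h : Frame N R s s') {a : ℕ} (ha : a ∈ N) (i n : ℕ) :
    Frame N R s (s'.setNat a i n) :=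
  ⟨fun b hb => by
    rw [State.setNat_nat_of_ne s' i n (by rintro rfl; exact hb ha), h.1 b hb], h.2⟩

theorem setReal (h : Frame N R s s') {a : ℕ} (ha : a ∈ R) (i : ℕ) (r : ℝ) :
    Frame N R s (s'.setReal a i r) :=
  ⟨h.1, fun b hb => by
    rw [State.setReal_real_of_ne s' i r (by rintro rfl; exact hb ha), h.2 b hb]⟩

end Frame

/-- The natural-number variable stored in entry `0` of array `a`. -/
abbrev nvar (a : ℕ) : NatExpr := .get a (.const 0)

/-- The real variable stored in entry `0` of array `a`. -/
abbrev rvar (a : ℕ) : RealExpr := .get a (.const 0)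

/-- Run `body` with the counter `c` going through `0, …, b - 1`. -/
def forLoop (c : ℕ) (b : NatExpr) (body : Prog) : Prog :=
  .seq (.setNat c (.const 0) (.const 0))
    (.while (.natLe (.add (nvar c) (.const 1)) b)
      (.seq body (.setNat c (.const 0) (.add (nvar c) (.const 1)))))

/-- The invariant `I i` refers to the state in which the counter already equals `i`; this is why the
body must establish `I (i + 1)` after the counter update. -/
theorem runs_forLoop {c : ℕ} {b : NatExpr} {body : Prog} {s : State} {n t : ℕ}
    (I : ℕ → State → Prop) (h0 : I 0 (s.setNat c 0 0))
    (hb : ∀ i s, I i s → b.eval s = n)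
    (hbody : ∀ i s, i < n → I i s → s.nat c 0 = i →
      Runs body s t fun s' => s'.nat c 0 = i ∧ I (i + 1) (s'.setNat c 0 (i + 1))) :
    Runs (forLoop c b body) s ((n + 1) * (t + b.cost + 12)) (I n) := by
  -- Induction on the number `k` of rounds left, since an execution of `while` unfolds at its first
  -- round.
  have key : ∀ k i, ∀ s, i + k = n → I i s → s.nat c 0 = i →
      Runs (.while (.natLe (.add (nvar c) (.const 1)) b)
        (.seq body (.setNat c (.const 0) (.add (nvar c) (.const 1))))) s
        (k * (t + b.cost + 12) + (b.cost + 6)) (I n) := by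
    intro k
    induction k with
    | zero =>
      intro i s hi hI hc
      refine (Runs.whileFalse (Q := I n) ?_ ?_).mono ?_ fun _ h => h
      · simp [Test.holds, NatExpr.eval, hb i s hI, hc]; omega
      · obtain rfl : i = n := by omega
        exact hI
      · simp [Test.cost, NatExpr.cost]; omega
    | succ k ih =>
      intro i s hi hI hc
      refine (Runs.whileTrue (t₁ := t + 6)
        (Q := fun s' => s'.nat c 0 = i + 1 ∧ I (i + 1) s') ?_ ?_
        fun s' h => ih (i + 1) s' (by omega) h.2 h.1).mono ?_ fun _ h => h
      · simp [Test.holds, NatExpr.eval, hb i s hI, hc]; omega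
      · refine (hbody i s (by omega) hI hc).seq fun s' h => Runs.setNat ?_
        simp only [NatExpr.eval, h.1, State.setNat_nat_same, true_and]
        exact h.2
      · simp only [Test.cost, NatExpr.cost]
        ring_nf; omega
  refine (Runs.seq (Q := fun s' => s'.nat c 0 = 0 ∧ I 0 s') (Runs.setNat ?_)
    fun s' h => key n 0 s' (by omega) h.2 h.1).mono ?_ fun _ h => h
  · simpa [NatExpr.eval] using h0
  · simp only [NatExpr.cost]
    ring_nf; omega

/-! ### Subroutines

Register conventions: the natural-number arrays `2`, …, `7` hold the scalars `k`, two loop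
counters, an inner counter and two pointers, and array `8` stays zero. -/

/-- Store in the real variable `7` the inner product of the segments of length `d` of the real
arrays `a` and `b` that start at the pointers `A` and `B`. -/
def dotProg (a A b B : ℕ) : Prog :=
  .seq (.setReal 7 (.const 0) (.const 0))
    (forLoop 5 (nvar 0) (.setReal 7 (.const 0) (.add (rvar 7)
      (.mul (.get a (.add (nvar A) (nvar 5))) (.get b (.add (nvar B) (nvar 5)))))))

theorem runs_dotProg {a A b B d : ℕ} {s : State} (hd : s.nat 0 0 = d) (ha : a ≠ 7) (hb : b ≠ 7)
    (hA : A ≠ 5) (hB : B ≠ 5) :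
    Runs (dotProg a A b B) s (40 * (d + 1)) fun s' => Frame {5} {7} s s' ∧
      s'.real 7 0 =
        ∑ j ∈ Finset.range d, s.real a (s.nat A 0 + j) * s.real b (s.nat B 0 + j) := by
  refine (Runs.seq (Q := fun s' => Frame {5} {7} s s' ∧ s'.real 7 0 = 0) (Runs.setReal ?_)
    fun s₁ h₁ => runs_forLoop (n := d) (t := 19)
      (fun i s' => Frame {5} {7} s s' ∧ s'.real 7 0 =
        ∑ j ∈ Finset.range i, s.real a (s.nat A 0 + j) * s.real b (s.nat B 0 + j)) ?_ ?_ ?_).mono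
      ?_ fun _ h => h
  · exact ⟨(Frame.refl _ _ _).setReal (by simp) _ _, by simp [NatExpr.eval, RealExpr.eval]⟩
  · exact ⟨h₁.1.setNat (by simp) _ _, by simpa using h₁.2⟩
  · intro i s' h
    simp [NatExpr.eval, h.1.1 0 (by simp), hd]
  · intro i s' hi h hc
    refine (Runs.setReal ⟨by simpa using hc, (h.1.setReal (by simp) _ _).setNat (by simp) _ _,
      ?_⟩).mono (by simp [NatExpr.cost, RealExpr.cost]) fun _ h => h
    simp only [NatExpr.eval, RealExpr.eval, State.setNat_real, State.setReal_real_same, h.2, hc,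
      h.1.2 a (by simpa using ha), h.1.2 b (by simpa using hb), h.1.1 A (by simpa using hA),
      h.1.1 B (by simpa using hB), Finset.sum_range_succ]
  · simp only [NatExpr.cost, RealExpr.cost]
    ring_nf; omega

/-- Store in the real variable `8` the power `(z / k) ^ (2 k)` of the real variable `7`. -/
def powProg : Prog :=
  .seq (.setReal 8 (.const 0) (.const 1))
    (forLoop 5 (nvar 2) (.setReal 8 (.const 0) (.mul (rvar 8)
      (.mul (.div (rvar 7) (.ofNat (nvar 2))) (.div (rvar 7) (.ofNat (nvar 2)))))))

theorem runs_powProg {s : State} {k : ℕ} (hk : s.nat 2 0 = k) :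
    Runs powProg s (40 * (k + 1)) fun s' => Frame {5} {8} s s' ∧
      s'.real 8 0 = (s.real 7 0 / k) ^ (2 * k) := by
  refine (Runs.seq (Q := fun s' => Frame {5} {8} s s' ∧ s'.real 8 0 = 1) (Runs.setReal ?_)
    fun s₁ h₁ => runs_forLoop (n := k) (t := 19)
      (fun i s' => Frame {5} {8} s s' ∧ s'.real 8 0 = (s.real 7 0 / k) ^ (2 * i)) ?_ ?_ ?_).mono
      ?_ fun _ h => h
  · exact ⟨(Frame.refl _ _ _).setReal (by simp) _ _, by simp [NatExpr.eval, RealExpr.eval]⟩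
  · exact ⟨h₁.1.setNat (by simp) _ _, by simpa using h₁.2⟩
  · intro i s' h
    simp [NatExpr.eval, h.1.1 2 (by simp), hk]
  · intro i s' hi h hc
    refine (Runs.setReal ⟨by simpa using hc, (h.1.setReal (by simp) _ _).setNat (by simp) _ _,
      ?_⟩).mono (by simp [NatExpr.cost, RealExpr.cost]) fun _ h => h
    simp only [NatExpr.eval, RealExpr.eval, State.setNat_real, State.setReal_real_same, h.2,
      h.1.2 7 (by simp), h.1.1 2 (by simp), hk]
    ring
  · simp only [NatExpr.cost, RealExpr.cost]
    ring_nf; omega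

end RealRAM

/-! ### The order of the tested moments -/

namespace TDS

/-- Half the degree of the moments that are tested: `6` plus the least `j` with `2 ^ j > 1 / ε`. -/
def order (ε : ℝ) : ℕ := 6 + sInf {j : ℕ | 1 < 2 ^ j * ε}

theorem one_lt_two_pow_sInf_mul {ε : ℝ} (hε : 0 < ε) :
    1 < (2 : ℝ) ^ sInf {j : ℕ | 1 < (2 : ℝ) ^ j * ε} * ε := by
  obtain ⟨j, hj⟩ := pow_unbounded_of_one_lt (1 / ε) (one_lt_two (α := ℝ))
  exact Nat.sInf_mem (s := {j : ℕ | 1 < (2 : ℝ) ^ j * ε}) ⟨j, by rwa [div_lt_iff₀ hε] at hj⟩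

end TDS

namespace RealRAM

open TDS

/-! ### The learner as a program -/

/-- Store the moment order in the variable `2` and the matching power of `1 / 2` in the real
variable `5`. -/
def orderProg : Prog :=
  .seq (.seq (.setReal 5 (.const 0) (.const ((1 / 2) ^ 768)))
    (.seq (.setReal 6 (.const 0) (.const 1)) (.setNat 2 (.const 0) (.const 6))))
    (.while (.realLe (.mul (rvar 6) (rvar 0)) (.const 1))
      (.seq (.setReal 6 (.const 0) (.mul (.const 2) (rvar 6)))
        (.seq (.setReal 5 (.const 0) (.mul (.const ((1 / 2) ^ 128)) (rvar 5)))
          (.setNat 2 (.const 0) (.add (nvar 2) (.const 1))))))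

/-- The machine has no logarithm or rounding, so the order is found by doubling until `2^j ε > 1`.
The threshold `2^(-128 k)` is updated along the way; it starts at exponent `768 = 128 * 6` because
the order starts at `6`. -/
theorem runs_orderProg {s : State} (hε : 0 < s.real 0 0) :
    Runs orderProg s (40 * order (s.real 0 0)) fun s' => Frame {2} {5, 6} s s' ∧
      s'.nat 2 0 = order (s.real 0 0) ∧
        s'.real 5 0 = (1 / 2) ^ (128 * order (s.real 0 0)) := by
  set ε := s.real 0 0 with hε'
  set J := sInf {j : ℕ | 1 < (2 : ℝ) ^ j * ε} with hJ
  have hord : order ε = 6 + J := rfl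
  let I : ℕ → State → Prop := fun j s' => Frame {2} {5, 6} s s' ∧ s'.nat 2 0 = 6 + j ∧
    s'.real 5 0 = (1 / 2) ^ (128 * (6 + j)) ∧ s'.real 6 0 = 2 ^ j
  have key : ∀ k j, ∀ s', j + k = J → I j s' →
      Runs (.while (.realLe (.mul (rvar 6) (rvar 0)) (.const 1))
      (.seq (.setReal 6 (.const 0) (.mul (.const 2) (rvar 6)))
        (.seq (.setReal 5 (.const 0) (.mul (.const ((1 / 2) ^ 128)) (rvar 5)))
          (.setNat 2 (.const 0) (.add (nvar 2) (.const 1)))))) s' (k * 30 + 10) (I J) := by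
    intro k
    induction k with
    | zero =>
      intro j s' hj hI
      obtain rfl : j = J := by omega
      refine (Runs.whileFalse (Q := I J) ?_ hI).mono (by simp [Test.cost, RealExpr.cost,
        NatExpr.cost]) fun _ h => h
      simp only [Test.holds, RealExpr.eval, NatExpr.eval, hI.2.2.2, hI.1.2 0 (by simp),
        Rat.cast_one, not_le]
      exact one_lt_two_pow_sInf_mul hε
    | succ k ih =>
      intro j s' hj hI
      refine (Runs.whileTrue (t₁ := 20) (Q := I (j + 1)) ?_ ?_
        fun s' h => ih (j + 1) s' (by omega) h).mono ?_ fun _ h => h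
      · have : j ∉ {j : ℕ | 1 < (2 : ℝ) ^ j * ε} := Nat.notMem_of_lt_sInf (by omega)
        simpa [Test.holds, RealExpr.eval, NatExpr.eval, hI.2.2.2, hI.1.2 0 (by simp)] using this
      · refine (Runs.seq (Runs.setReal (Q := fun s₁ => s₁ = _) rfl) fun s₁ h₁ =>
          Runs.seq (Runs.setReal (Q := fun s₂ => s₂ = _) rfl) fun s₂ h₂ =>
          Runs.setNat ?_).mono ?_ fun _ h => h
        · subst h₁ h₂
          refine ⟨((hI.1.setReal (by simp) _ _).setReal (by simp) _ _).setNat (by simp) _ _,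
            ?_, ?_, ?_⟩
          · simp [NatExpr.eval, hI.2.1]; ring
          · simp only [NatExpr.eval, RealExpr.eval, State.setNat_real, State.setReal_real_same,
              State.setReal_real_of_ne _ _ _ (show (5 : ℕ) ≠ 6 by simp), hI.2.2.1]
            rw [Rat.cast_pow, Rat.cast_div, Rat.cast_one, Rat.cast_ofNat, ← pow_add]
            congr 1
            ring
          · simp [NatExpr.eval, RealExpr.eval, State.setReal_real_of_ne, hI.2.2.2]; ring
        · simp [RealExpr.cost, NatExpr.cost]
      · simp [RealExpr.cost, NatExpr.cost, Test.cost]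
        ring_nf; omega
  refine (Runs.seq (Q := I 0) (t₁ := 10) ?_ fun s₁ h₁ => key J 0 s₁ (by omega) h₁).mono ?_
    fun s' h => ⟨h.1, h.2.1, h.2.2.1⟩
  · refine (Runs.seq (Runs.setReal (Q := fun s₁ => s₁ = _) rfl) fun s₁ h₁ =>
      Runs.seq (Runs.setReal (Q := fun s₂ => s₂ = _) rfl) fun s₂ h₂ =>
      Runs.setNat ?_).mono (by simp [RealExpr.cost, NatExpr.cost]) fun _ h => h
    subst h₁ h₂
    refine ⟨(((Frame.refl _ _ _).setReal (by simp) _ _).setReal (by simp) _ _).setNat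
      (by simp) _ _, ?_, ?_, ?_⟩
    · simp [NatExpr.eval]
    · simp only [NatExpr.eval, RealExpr.eval, State.setNat_real, State.setReal_real_same,
        State.setReal_real_of_ne _ _ _ (show (5 : ℕ) ≠ 6 by simp)]
      rw [Rat.cast_pow, Rat.cast_div, Rat.cast_one, Rat.cast_ofNat]
    · simp [NatExpr.eval, RealExpr.eval]
  · omega

/-- Advance the pointer `A` by the dimension. -/
def advance (A : ℕ) : Prog := .setNat A (.const 0) (.add (nvar A) (nvar 0))

/-- Store `∑ i, y i * x i` in the first `d` entries of the real array `4`. -/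
def chowProg : Prog :=
  forLoop 4 (nvar 0) (.seq (.seq (.setNat 6 (.const 0) (nvar 4))
    (.setReal 4 (nvar 4) (.const 0)))
    (forLoop 3 (.get 0 (.const 1)) (.seq
      (.setReal 4 (nvar 4) (.add (.get 4 (nvar 4)) (.mul (.get 2 (nvar 3)) (.get 1 (nvar 6)))))
      (advance 6))))

/-- Natural numbers cannot be multiplied on the machine, so the index `i * d + j` is kept as a
pointer that starts at `j` and advances by `d`. The inner invariant also records that the finished
coordinates `j' < j` survive. -/
theorem runs_chowProg {d m : ℕ} {s : State} (hd : s.nat 0 0 = d) (hm : s.nat 0 1 = m) :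
    Runs chowProg s (100 * ((d + 1) * (m + 1))) fun s' => Frame {3, 4, 6} {4} s s' ∧
      ∀ j < d, s'.real 4 j = ∑ i ∈ Finset.range m, s.real 2 i * s.real 1 (i * d + j) := by
  refine (runs_forLoop (n := d) (t := 60 * (m + 1)) (fun n s' => Frame {3, 4, 6} {4} s s' ∧
      ∀ j < n, s'.real 4 j = ∑ i ∈ Finset.range m, s.real 2 i * s.real 1 (i * d + j))
      ?_ ?_ ?_).mono ?_ fun _ h => h
  · exact ⟨(Frame.refl _ _ _).setNat (by simp) _ _, by simp⟩
  · intro i s' h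
    simp [NatExpr.eval, h.1.1 0 (by simp), hd]
  · intro j s' hj h hc
    refine (Runs.seq (t₁ := 10) (Q := fun s₁ => Frame {3, 4, 6} {4} s s₁ ∧ s₁.nat 4 0 = j ∧
      s₁.nat 6 0 = j ∧ s₁.real 4 j = 0 ∧ ∀ j' < j, s₁.real 4 j' = s'.real 4 j') ?_
      fun s₁ h₁ => (runs_forLoop (n := m) (t := 30) (fun n s₂ => Frame {3, 4, 6} {4} s s₂ ∧
        s₂.nat 4 0 = j ∧ s₂.nat 6 0 = n * d + j ∧
        s₂.real 4 j = ∑ i ∈ Finset.range n, s.real 2 i * s.real 1 (i * d + j) ∧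
        ∀ j' < j, s₂.real 4 j' = s'.real 4 j') ?_ ?_ ?_).mono le_rfl ?_).mono ?_ fun _ h => h
    · refine (Runs.seq (Runs.setNat (Q := fun s₁ => s₁ = _) rfl) fun s₁ h₁ =>
        Runs.setReal ?_).mono (by simp [RealExpr.cost, NatExpr.cost]) fun _ h => h
      subst h₁
      refine ⟨(h.1.setNat (by simp) _ _).setReal (by simp) _ _, ?_, ?_, ?_, ?_⟩
      · simp [State.setNat_nat_of_ne, hc]
      · simp [NatExpr.eval, hc]
      · simp [NatExpr.eval, RealExpr.eval, State.setNat_nat_of_ne, hc]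
      · intro j' hj'
        simp only [NatExpr.eval, State.setNat_nat_of_ne _ _ _ (show (4 : ℕ) ≠ 6 by simp), hc]
        rw [State.setReal_real_same_of_ne _ _ _ (by omega)]
        simp
    · refine ⟨h₁.1.setNat (by simp) _ _, ?_, ?_, ?_, ?_⟩
      · simp [State.setNat_nat_of_ne, h₁.2.1]
      · simp [State.setNat_nat_of_ne, h₁.2.2.1]
      · simp [h₁.2.2.2.1]
      · simpa using h₁.2.2.2.2
    · intro i s₂ h₂
      simp [NatExpr.eval, h₂.1.1 0 (by simp), hm]
    · intro i s₂ hi h₂ hc₂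
      refine (Runs.seq (Runs.setReal (Q := fun s₁ => s₁ = _) rfl) fun s₃ h₃ =>
        Runs.setNat ?_).mono (by simp [RealExpr.cost, NatExpr.cost]) fun _ h => h
      subst h₃
      refine ⟨by simp [State.setNat_nat_of_ne, hc₂],
        ((h₂.1.setReal (by simp) _ _).setNat (by simp) _ _).setNat (by simp) _ _, ?_, ?_, ?_, ?_⟩
      · simp [State.setNat_nat_of_ne, h₂.2.1]
      · simp [State.setNat_nat_of_ne, NatExpr.eval, h₂.2.2.1, h₂.1.1 0 (by simp), hd]
        ring
      · simp [NatExpr.eval, RealExpr.eval, h₂.2.1, h₂.2.2.1, h₂.2.2.2.1, hc₂,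
          h₂.1.2 1 (by simp), h₂.1.2 2 (by simp), Finset.sum_range_succ]
      · intro j' hj'
        simp only [NatExpr.eval, h₂.2.1, State.setNat_real]
        rw [State.setReal_real_same_of_ne _ _ _ (by omega), h₂.2.2.2.2 j' hj']
    · intro s₂ h₂
      refine ⟨h₂.2.1, h₂.1.setNat (by simp) _ _, fun j' hj' => ?_⟩
      rcases Nat.lt_succ_iff_lt_or_eq.1 hj' with hj' | rfl
      · simpa [h₂.2.2.2.2 j' hj'] using h.2 j' hj'
      · simpa using h₂.2.2.2.1
    · simp [NatExpr.cost]; omega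
  · simp [NatExpr.cost]; ring_nf; nlinarith

/-- Store `∑ i, y i * (‖x i‖ ^ 2 - d)` in entry number `d` of the real array `4`. -/
def biasProg : Prog :=
  .seq (.seq (.setNat 6 (.const 0) (.const 0)) (.setReal 4 (nvar 0) (.const 0)))
    (forLoop 3 (.get 0 (.const 1)) (.seq (dotProg 1 6 1 6) (.seq
      (.setReal 4 (nvar 0) (.add (.get 4 (nvar 0)) (.mul (.get 2 (nvar 3))
        (.sub (rvar 7) (.ofNat (nvar 0))))))
      (advance 6))))

theorem runs_biasProg {d m : ℕ} {s : State} (hd : s.nat 0 0 = d) (hm : s.nat 0 1 = m) :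
    Runs biasProg s (100 * ((d + 1) * (m + 1))) fun s' => Frame {3, 5, 6} {4, 7} s s' ∧
      (∀ j < d, s'.real 4 j = s.real 4 j) ∧
      s'.real 4 d = ∑ i ∈ Finset.range m, s.real 2 i *
        (∑ j ∈ Finset.range d, s.real 1 (i * d + j) * s.real 1 (i * d + j) - d) := by
  refine (Runs.seq (t₁ := 10) (Q := fun s₁ => Frame {3, 5, 6} {4, 7} s s₁ ∧ s₁.nat 6 0 = 0 ∧
      s₁.real 4 d = 0 ∧ ∀ j < d, s₁.real 4 j = s.real 4 j) ?_
      fun s₁ h₁ => (runs_forLoop (n := m) (t := 40 * (d + 1) + 30)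
        (fun n s₂ => Frame {3, 5, 6} {4, 7} s s₂ ∧
        s₂.nat 6 0 = n * d ∧
        s₂.real 4 d = ∑ i ∈ Finset.range n, s.real 2 i *
          (∑ j ∈ Finset.range d, s.real 1 (i * d + j) * s.real 1 (i * d + j) - d) ∧
        ∀ j < d, s₂.real 4 j = s.real 4 j) ?_ ?_ ?_).mono le_rfl
          fun s' h => ⟨h.1, h.2.2.2, h.2.2.1⟩).mono ?_ fun _ h => h
  · refine (Runs.seq (Runs.setNat (Q := fun s₁ => s₁ = _) rfl) fun s₁ h₁ =>
        Runs.setReal ?_).mono (by simp [RealExpr.cost, NatExpr.cost]) fun _ h => h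
    subst h₁
    refine ⟨((Frame.refl _ _ _).setNat (by simp) _ _).setReal (by simp) _ _, ?_, ?_, ?_⟩
    · simp [NatExpr.eval]
    · simp [NatExpr.eval, RealExpr.eval, State.setNat_nat_of_ne, hd]
    · intro j hj
      simp only [NatExpr.eval, State.setNat_nat_of_ne _ _ _ (show (0 : ℕ) ≠ 6 by simp), hd]
      rw [State.setReal_real_same_of_ne _ _ _ (by omega)]
      simp
  · refine ⟨h₁.1.setNat (by simp) _ _, ?_, ?_, ?_⟩
    · simp [State.setNat_nat_of_ne, h₁.2.1]
    · simp [h₁.2.2.1]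
    · simpa using h₁.2.2.2
  · intro i s₂ h₂
    simp [NatExpr.eval, h₂.1.1 0 (by simp), hm]
  · intro i s₂ hi h₂ hc₂
    refine (Runs.seq (runs_dotProg (d := d) (by rw [h₂.1.1 0 (by simp), hd]) (by simp) (by simp)
      (by simp) (by simp)) fun s₃ h₃ => Runs.seq (Runs.setReal (Q := fun s₁ => s₁ = _) rfl)
      fun s₄ h₄ => Runs.setNat ?_).mono (by simp [RealExpr.cost, NatExpr.cost]) fun _ h => h
    subst h₄
    have hf : Frame {3, 5, 6} {4, 7} s s₃ := h₂.1.trans h₃.1 (by simp) (by simp)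
    refine ⟨by simp [State.setNat_nat_of_ne, h₃.1.1 3 (by simp), hc₂],
        ((hf.setReal (by simp) _ _).setNat (by simp) _ _).setNat (by simp) _ _, ?_, ?_, ?_⟩
    · simp [State.setNat_nat_of_ne, NatExpr.eval, h₃.1.1 6 (by simp), h₂.2.1, hf.1 0 (by simp), hd]
      ring
    · simp [NatExpr.eval, RealExpr.eval, h₂.2.1, h₂.2.2.1, h₃.1.1 3 (by simp), hc₂,
        hf.2 2 (by simp), h₃.2, hf.1 0 (by simp), hd, h₂.1.2 1 (by simp), h₃.1.2 4 (by simp),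
        Finset.sum_range_succ]
    · intro j hj
      simp only [NatExpr.eval, hf.1 0 (by simp), hd, State.setNat_real]
      rw [State.setReal_real_same_of_ne _ _ _ (by omega), h₃.1.2 4 (by simp), h₂.2.2.2 j hj]
  · simp [NatExpr.cost]; ring_nf; nlinarith

end RealRAM

/-! ### Programs for the two tests and for the constant hypothesis -/

namespace RealRAM

open TDS

/-- Count in the real variable `9` the test points that lie in the strip around the hyperplane
stored in the real array `4`. -/
def countProg : Prog :=
  .seq (.seq (.setNat 6 (.const 0) (.const 0)) (.setReal 9 (.const 0) (.const 0)))
    (forLoop 3 (.get 0 (.const 1)) (.seq (dotProg 3 6 3 6) (.seq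
      (.setReal 10 (.const 0) (rvar 7)) (.seq (dotProg 4 8 3 6) (.seq
      (.ite (.realLe (.mul (.sub (rvar 7) (.get 4 (nvar 0))) (.sub (rvar 7) (.get 4 (nvar 0))))
        (.mul (.mul (.const 2000000) (.mul (.mul (.ofNat (nvar 0)) (.ofNat (nvar 0)))
          (.ofNat (.get 0 (.const 1))))) (.add (rvar 10) (.const 1))))
        (.setReal 9 (.const 0) (.add (rvar 9) (.const 1))) .skip)
      (advance 6))))))

open Classical in
theorem runs_countProg {d m : ℕ} {s : State} (hd : s.nat 0 0 = d) (hm : s.nat 0 1 = m)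
    (h8 : s.nat 8 0 = 0) :
    Runs countProg s (300 * ((d + 1) * (m + 1))) fun s' => Frame {3, 5, 6} {7, 9, 10} s s' ∧
      s'.real 9 0 = ∑ i ∈ Finset.range m,
        if (∑ j ∈ Finset.range d, s.real 4 j * s.real 3 (i * d + j) - s.real 4 d) ^ 2 ≤
          2000000 * (d * d * m) *
            (∑ j ∈ Finset.range d, s.real 3 (i * d + j) * s.real 3 (i * d + j) + 1)
        then 1 else 0 := by
  refine (Runs.seq (t₁ := 10) (Q := fun s₁ => Frame {3, 5, 6} {7, 9, 10} s s₁ ∧ s₁.nat 6 0 = 0 ∧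
      s₁.real 9 0 = 0) ?_
      fun s₁ h₁ => (runs_forLoop (n := m) (t := 80 * (d + 1) + 60)
        (fun n s₂ => Frame {3, 5, 6} {7, 9, 10} s s₂ ∧
        s₂.nat 6 0 = n * d ∧
        s₂.real 9 0 = ∑ i ∈ Finset.range n,
        if (∑ j ∈ Finset.range d, s.real 4 j * s.real 3 (i * d + j) - s.real 4 d) ^ 2 ≤
          2000000 * (d * d * m) *
            (∑ j ∈ Finset.range d, s.real 3 (i * d + j) * s.real 3 (i * d + j) + 1)
        then 1 else 0) ?_ ?_ ?_).mono le_rfl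
          fun s' h => ⟨h.1, h.2.2⟩).mono ?_ fun _ h => h
  · refine (Runs.seq (Runs.setNat (Q := fun s₁ => s₁ = _) rfl) fun s₁ h₁ =>
        Runs.setReal ?_).mono (by simp [RealExpr.cost, NatExpr.cost]) fun _ h => h
    subst h₁
    exact ⟨((Frame.refl _ _ _).setNat (by simp) _ _).setReal (by simp) _ _,
      by simp [NatExpr.eval], by simp [NatExpr.eval, RealExpr.eval]⟩
  · refine ⟨h₁.1.setNat (by simp) _ _, ?_, ?_⟩
    · simp [State.setNat_nat_of_ne, h₁.2.1]
    · simp [h₁.2.2]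
  · intro i s₂ h₂
    simp [NatExpr.eval, h₂.1.1 0 (by simp), hm]
  · intro i s₂ hi h₂ hc₂
    refine (Runs.seq (runs_dotProg (d := d) (by rw [h₂.1.1 0 (by simp), hd]) (by simp) (by simp)
      (by simp) (by simp)) fun s₃ h₃ => Runs.seq (Runs.setReal (Q := fun s₁ => s₁ = _) rfl)
      -- The squared norm has just been saved in real variable `10`, because this second inner
      -- product overwrites variable `7`. Pointer `8` is always zero, so the normal vector is read
      -- from its first entry.
      fun s₄ h₄ => Runs.seq (runs_dotProg (d := d)
        (by rw [h₄, State.setReal_nat, h₃.1.1 0 (by simp), h₂.1.1 0 (by simp), hd])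
        (by simp) (by simp) (by simp) (by simp)) fun s₅ h₅ => Runs.seq (t₁ := 40)
      (Q := fun s₆ => Frame {} {9} s₅ s₆ ∧ s₆.real 9 0 = s₂.real 9 0 +
        if (∑ j ∈ Finset.range d, s.real 4 j * s.real 3 (i * d + j) - s.real 4 d) ^ 2 ≤
          2000000 * (d * d * m) *
            (∑ j ∈ Finset.range d, s.real 3 (i * d + j) * s.real 3 (i * d + j) + 1)
        then 1 else 0) ?_
      fun s₆ h₆ => Runs.setNat ?_).mono ?_ fun _ h => h
    · have h4 : Frame {3, 5, 6} {7, 9, 10} s s₄ := by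
        subst h₄
        exact (h₂.1.trans h₃.1 (by simp) (by simp)).setReal (by simp) _ _
      have h5 : Frame {3, 5, 6} {7, 9, 10} s s₅ := h4.trans h₅.1 (by simp) (by simp)
      have e10 : s₅.real 10 0 =
          ∑ j ∈ Finset.range d, s.real 3 (i * d + j) * s.real 3 (i * d + j) := by
        rw [h₅.1.2 10 (by simp), h₄]
        simp [NatExpr.eval, RealExpr.eval, h₃.2, h₂.1.2 3 (by simp), h₂.2.1]
      have e7 : s₅.real 7 0 = ∑ j ∈ Finset.range d, s.real 4 j * s.real 3 (i * d + j) := by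
        rw [h₅.2, h4.1 8 (by simp), h8, h4.2 3 (by simp), h4.2 4 (by simp), h₄,
          State.setReal_nat, h₃.1.1 6 (by simp), h₂.2.1]
        simp
      have e9 : s₅.real 9 0 = s₂.real 9 0 := by
        rw [h₅.1.2 9 (by simp), h₄, State.setReal_real_of_ne _ _ _ (by simp),
          h₃.1.2 9 (by simp)]
      refine (Runs.ite (t := 7) (fun hb => ?_) fun hb => ?_).mono
        (by simp [Test.cost, RealExpr.cost, NatExpr.cost]) fun _ h => h
      · simp only [Test.holds, NatExpr.eval, RealExpr.eval, h5.1 0 (by simp), hd, hm,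
          h5.2 4 (by simp), e10, e7, Rat.cast_ofNat, Rat.cast_one, ← sq] at hb
        simp only [← sq]
        rw [if_pos hb]
        refine (Runs.setReal ⟨(Frame.refl _ _ _).setReal (by simp) _ _, ?_⟩).mono
          (by simp [RealExpr.cost, NatExpr.cost]) fun _ h => h
        simp [NatExpr.eval, RealExpr.eval, e9]
      · simp only [Test.holds, NatExpr.eval, RealExpr.eval, h5.1 0 (by simp), hd, hm,
          h5.2 4 (by simp), e10, e7, Rat.cast_ofNat, Rat.cast_one, ← sq] at hb
        simp only [← sq]
        rw [if_neg hb]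
        exact (Runs.skip ⟨Frame.refl _ _ _, by simp [e9]⟩).mono (by simp) fun _ h => h
    · have h4 : Frame {3, 5, 6} {7, 9, 10} s s₄ := by
        subst h₄
        exact (h₂.1.trans h₃.1 (by simp) (by simp)).setReal (by simp) _ _
      have h5 : Frame {3, 5, 6} {7, 9, 10} s s₅ := h4.trans h₅.1 (by simp) (by simp)
      have h6 : Frame {3, 5, 6} {7, 9, 10} s s₆ := h5.trans h₆.1 (by simp) (by simp)
      refine ⟨?_, (h6.setNat (by simp) _ _).setNat (by simp) _ _, ?_, ?_⟩
      · simp [State.setNat_nat_of_ne, h₆.1.1 3 (by simp), h₅.1.1 3 (by simp), h₄,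
          h₃.1.1 3 (by simp), hc₂]
      · simp [State.setNat_nat_of_ne, NatExpr.eval, h6.1 0 (by simp), hd, h₆.1.1 6 (by simp),
          h₅.1.1 6 (by simp), h₄, h₃.1.1 6 (by simp), h₂.2.1]
        ring
      · simp only [State.setNat_real, h₆.2, h₂.2.2, Finset.sum_range_succ]
    · simp [NatExpr.cost, RealExpr.cost]; omega
  · simp [NatExpr.cost]; ring_nf; nlinarith

/-- Add to the real variable `9` the multiple `c` of the kernel of two points. -/
def kernelProg (c : ℚ) (a A b B : ℕ) : Prog :=
  .seq (dotProg a A b B) (.seq powProg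
    (.setReal 9 (.const 0) (.add (rvar 9) (.mul (.const c) (rvar 8)))))

theorem runs_kernelProg {a A b B d k : ℕ} {c : ℚ} {s : State} (hd : s.nat 0 0 = d)
    (hk : s.nat 2 0 = k) (ha : a ≠ 7) (hb : b ≠ 7) (hA : A ≠ 5) (hB : B ≠ 5) :
    Runs (kernelProg c a A b B) s (100 * (d + k + 1)) fun s' => Frame {5} {7, 8, 9} s s' ∧
      s'.real 9 0 = s.real 9 0 + c *
        ((∑ j ∈ Finset.range d, s.real a (s.nat A 0 + j) * s.real b (s.nat B 0 + j)) / k) ^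
          (2 * k) := by
  refine (Runs.seq (runs_dotProg hd ha hb hA hB) fun s₁ h₁ => Runs.seq
    (runs_powProg (k := k) (by rw [h₁.1.1 2 (by simp), hk])) fun s₂ h₂ => Runs.setReal ?_).mono
    (by simp [NatExpr.cost, RealExpr.cost]; omega) fun _ h => h
  refine ⟨((h₁.1.mono (by simp) (by simp)).trans h₂.1 (by simp) (by simp)).setReal
    (by simp) _ _, ?_⟩
  simp [NatExpr.eval, RealExpr.eval, h₂.2, h₁.2, h₂.1.2 9 (by simp), h₁.1.2 9 (by simp)]

/-- Store in the real variable `9` the squared distance between the moment tensors of the two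
samples. -/
def mmdProg : Prog :=
  .seq (.seq (.setNat 6 (.const 0) (.const 0)) (.setReal 9 (.const 0) (.const 0)))
    (forLoop 3 (.get 0 (.const 1)) (.seq (.seq (.setNat 7 (.const 0) (.const 0))
      (forLoop 4 (.get 0 (.const 1)) (.seq (kernelProg 1 1 6 1 7)
        (.seq (kernelProg 1 3 6 3 7) (.seq (kernelProg (-2) 1 6 3 7) (advance 7))))))
      (advance 6)))

/-- The kernel trick: the tensors have `d^(2k)` entries, but their squared distance needs only inner
products of pairs of points, each raised to a power in `O(k)` steps. -/
theorem runs_mmdProg {d m k : ℕ} {s : State} (hd : s.nat 0 0 = d) (hm : s.nat 0 1 = m)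
    (hk : s.nat 2 0 = k) :
    Runs mmdProg s (1000 * ((m + 1) * ((m + 1) * (d + k + 1)))) fun s' =>
      Frame {3, 4, 5, 6, 7} {7, 8, 9} s s' ∧
      s'.real 9 0 = ∑ i ∈ Finset.range m, ∑ l ∈ Finset.range m,
        (((∑ j ∈ Finset.range d, s.real 1 (i * d + j) * s.real 1 (l * d + j)) / k) ^ (2 * k) +
        ((∑ j ∈ Finset.range d, s.real 3 (i * d + j) * s.real 3 (l * d + j)) / k) ^ (2 * k) -
        2 * ((∑ j ∈ Finset.range d, s.real 1 (i * d + j) * s.real 3 (l * d + j)) / k) ^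
          (2 * k)) := by
  set F : ℕ → ℕ → ℝ := fun i l =>
        (((∑ j ∈ Finset.range d, s.real 1 (i * d + j) * s.real 1 (l * d + j)) / k) ^ (2 * k) +
        ((∑ j ∈ Finset.range d, s.real 3 (i * d + j) * s.real 3 (l * d + j)) / k) ^ (2 * k) -
        2 * ((∑ j ∈ Finset.range d, s.real 1 (i * d + j) * s.real 3 (l * d + j)) / k) ^
          (2 * k)) with hF
  let N : Finset ℕ := {3, 4, 5, 6, 7}
  let R : Finset ℕ := {7, 8, 9}
  refine (Runs.seq (t₁ := 10) (Q := fun s₁ => Frame N R s s₁ ∧ s₁.nat 6 0 = 0 ∧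
      s₁.real 9 0 = 0) ?_
      fun s₁ h₁ => (runs_forLoop (n := m) (t := (m + 1) * (300 * (d + k + 1) + 30) + 10)
        (fun n s₂ => Frame N R s s₂ ∧ s₂.nat 6 0 = n * d ∧
        s₂.real 9 0 = ∑ i ∈ Finset.range n, ∑ l ∈ Finset.range m, F i l) ?_ ?_ ?_).mono le_rfl
          fun s' h => ⟨h.1, h.2.2⟩).mono ?_ fun _ h => h
  · refine (Runs.seq (Runs.setNat (Q := fun s₁ => s₁ = _) rfl) fun s₁ h₁ =>
        Runs.setReal ?_).mono (by simp [RealExpr.cost, NatExpr.cost]) fun _ h => h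
    subst h₁
    exact ⟨((Frame.refl _ _ _).setNat (by simp [N]) _ _).setReal (by simp [R]) _ _,
      by simp [NatExpr.eval], by simp [NatExpr.eval, RealExpr.eval]⟩
  · refine ⟨h₁.1.setNat (by simp [N]) _ _, ?_, ?_⟩
    · simp [State.setNat_nat_of_ne, h₁.2.1]
    · simp [h₁.2.2]
  · intro i s₂ h₂
    simp [NatExpr.eval, h₂.1.1 0 (by simp [N]), hm]
  · intro i s₂ hi h₂ hc₂
    refine (Runs.seq (t₁ := (m + 1) * (300 * (d + k + 1) + 30) + 3)
      (Q := fun s₃ => Frame N R s s₃ ∧ s₃.nat 3 0 = i ∧ s₃.nat 6 0 = i * d ∧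
        s₃.real 9 0 = s₂.real 9 0 + ∑ l ∈ Finset.range m, F i l) ?_
      fun s₃ h₃ => Runs.setNat ?_).mono (by simp [NatExpr.cost]) fun _ h => h
    · refine (Runs.seq (Runs.setNat (Q := fun s₁ => s₁ = _) rfl) fun s₃ h₃ =>
        (runs_forLoop (n := m) (t := 300 * (d + k + 1) + 10)
          (fun n s₄ => Frame N R s s₄ ∧ s₄.nat 3 0 = i ∧ s₄.nat 6 0 = i * d ∧
            s₄.nat 7 0 = n * d ∧
            s₄.real 9 0 = s₂.real 9 0 + ∑ l ∈ Finset.range n, F i l) ?_ ?_ ?_).mono le_rfl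
            fun s₄ h₄ => ⟨h₄.1, h₄.2.1, h₄.2.2.1, h₄.2.2.2.2⟩).mono
          (by simp [NatExpr.cost]; ring_nf; omega) fun _ h => h
      · subst h₃
        refine ⟨(h₂.1.setNat (by simp [N]) _ _).setNat (by simp [N]) _ _, ?_, ?_, ?_, ?_⟩
        · simp [State.setNat_nat_of_ne, hc₂]
        · simp [State.setNat_nat_of_ne, h₂.2.1]
        · simp [State.setNat_nat_of_ne, NatExpr.eval]
        · simp
      · intro i s₂ h₂
        simp [NatExpr.eval, h₂.1.1 0 (by simp [N]), hm]
      · intro l s₄ hl h₄ hc₄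
        refine (Runs.seq (runs_kernelProg (d := d) (k := k)
          (by rw [h₄.1.1 0 (by simp [N]), hd]) (by rw [h₄.1.1 2 (by simp [N]), hk])
          (by simp) (by simp) (by simp) (by simp)) fun s₅ h₅ =>
          Runs.seq (runs_kernelProg (d := d) (k := k)
          (by rw [h₅.1.1 0 (by simp), h₄.1.1 0 (by simp [N]), hd])
          (by rw [h₅.1.1 2 (by simp), h₄.1.1 2 (by simp [N]), hk])
          (by simp) (by simp) (by simp) (by simp)) fun s₆ h₆ =>
          Runs.seq (runs_kernelProg (d := d) (k := k)
          (by rw [h₆.1.1 0 (by simp), h₅.1.1 0 (by simp), h₄.1.1 0 (by simp [N]), hd])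
          (by rw [h₆.1.1 2 (by simp), h₅.1.1 2 (by simp), h₄.1.1 2 (by simp [N]), hk])
          (by simp) (by simp) (by simp) (by simp)) fun s₇ h₇ =>
          Runs.setNat ?_).mono (by simp [NatExpr.cost]; omega) fun _ h => h
        have h6 : Frame {5} {7, 8, 9} s₄ s₆ := h₅.1.trans h₆.1 (by simp) (by simp)
        have h7 : Frame {5} {7, 8, 9} s₄ s₇ := h6.trans h₇.1 (by simp) (by simp)
        refine ⟨by simp [State.setNat_nat_of_ne, h7.1 4 (by simp), hc₄],
          ((h₄.1.trans h7 (by simp [N]) (by simp [R])).setNat (by simp [N]) _ _).setNat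
            (by simp [N]) _ _, ?_, ?_, ?_, ?_⟩
        · simp [State.setNat_nat_of_ne, h7.1 3 (by simp), h₄.2.1]
        · simp [State.setNat_nat_of_ne, h7.1 6 (by simp), h₄.2.2.1]
        · simp [State.setNat_nat_of_ne, NatExpr.eval, h7.1 7 (by simp), h7.1 0 (by simp),
            h₄.1.1 0 (by simp [N]), hd, h₄.2.2.2.1]
          ring
        · simp only [State.setNat_real, h₇.2, h₆.2, h₅.2, h₄.2.2.2.2, h6.1 6 (by simp),
            h6.1 7 (by simp), h6.2 1 (by simp), h6.2 3 (by simp), h₅.1.1 6 (by simp),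
            h₅.1.1 7 (by simp), h₅.1.2 3 (by simp), h₄.2.2.1, h₄.2.2.2.1,
            h₄.1.2 1 (by simp [R]), h₄.1.2 3 (by simp [R]), Finset.sum_range_succ, hF]
          push_cast
          ring
    · refine ⟨by simp [State.setNat_nat_of_ne, h₃.2.1], (h₃.1.setNat (by simp [N]) _ _).setNat
        (by simp [N]) _ _, ?_, ?_⟩
      · simp [State.setNat_nat_of_ne, NatExpr.eval, h₃.1.1 0 (by simp [N]), hd, h₃.2.2.1]
        ring
      · simp only [State.setNat_real, h₃.2.2.2, h₂.2.2, Finset.sum_range_succ]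
  · simp [NatExpr.cost]; ring_nf; nlinarith

/-- Accept with the constant hypothesis given by the first label. -/
def constProg : Prog :=
  .seq (forLoop 4 (nvar 0) (.setReal 4 (nvar 4) (.const 0)))
    (.seq (.setReal 4 (nvar 0) (.sub (.const 0) (rvar 2)))
      (.setNat 1 (.const 0) (.const 1)))

/-- With `v = 0` the halfspace takes the constant value `sign(-τ)`, so `τ` is minus the first label.
-/
theorem runs_constProg {d : ℕ} {s : State} (hd : s.nat 0 0 = d) :
    Runs constProg s (40 * (d + 1)) fun s' => s'.nat 1 0 = 1 ∧
      (∀ j < d, s'.real 4 j = 0) ∧ s'.real 4 d = - s.real 2 0 := by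
  refine (Runs.seq (runs_forLoop (n := d) (t := 4) (fun n s' => Frame {4} {4} s s' ∧
      ∀ j < n, s'.real 4 j = 0) ?_ ?_ ?_) fun s₁ h₁ => Runs.seq
      (Runs.setReal (Q := fun s₁ => s₁ = _) rfl) fun s₂ h₂ => Runs.setNat ?_).mono
      ?_ fun _ h => h
  · exact ⟨(Frame.refl _ _ _).setNat (by simp) _ _, by simp⟩
  · intro i s' h
    simp [NatExpr.eval, h.1.1 0 (by simp), hd]
  · intro j s' hj h hc
    refine (Runs.setReal ⟨by simpa using hc, (h.1.setReal (by simp) _ _).setNat (by simp) _ _,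
      fun j' hj' => ?_⟩).mono (by simp [NatExpr.cost, RealExpr.cost]) fun _ h => h
    simp only [NatExpr.eval, hc, State.setNat_real, RealExpr.eval, Rat.cast_zero]
    rcases Nat.lt_succ_iff_lt_or_eq.1 hj' with hj' | rfl
    · rw [State.setReal_real_same_of_ne _ _ _ (by omega), h.2 j' hj']
    · simp
  · subst h₂
    refine ⟨by simp [NatExpr.eval], fun j hj => ?_, ?_⟩
    · simp only [NatExpr.eval, h₁.1.1 0 (by simp), hd, State.setNat_real]
      rw [State.setReal_real_same_of_ne _ _ _ (by omega), h₁.2 j hj]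
    · simp [NatExpr.eval, RealExpr.eval, h₁.1.1 0 (by simp), hd, h₁.1.2 2 (by simp)]
  · simp [NatExpr.cost, RealExpr.cost]; ring_nf; omega

end RealRAM

/-! ### The learner as a function of the samples -/

namespace TDS

variable {d m : ℕ}

/-- The kernel of degree-`2k` moments, scaled by the size `k ^ k` of Gaussian moments. -/
def momentKernel (k : ℕ) (x y : EuclideanSpace ℝ (Fin d)) : ℝ := (inner ℝ x y / k) ^ (2 * k)

/-- The sum of `y x` over a labelled sample. -/
def chowVector (S : Fin m → EuclideanSpace ℝ (Fin d) × ℤˣ) : EuclideanSpace ℝ (Fin d) :=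
  ∑ i, (((S i).2 : ℤ) : ℝ) • (S i).1

/-- The sum of `y (‖x‖² - d)` over a labelled sample. -/
def chowBias (S : Fin m → EuclideanSpace ℝ (Fin d) × ℤˣ) : ℝ :=
  ∑ i, (((S i).2 : ℤ) : ℝ) * (‖(S i).1‖ ^ 2 - d)

/-- The strip of points whose label may change when the parameters of the halfspace `(w, θ)` are
perturbed by the sampling error. -/
def strip (m : ℕ) (w : EuclideanSpace ℝ (Fin d)) (θ : ℝ) : Set (EuclideanSpace ℝ (Fin d)) :=
  {x | (inner ℝ w x - θ) ^ 2 ≤ 2000000 * (d * d * m) * (‖x‖ ^ 2 + 1)}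

open Classical in
/-- The number of points in the strip. -/
def stripCount (w : EuclideanSpace ℝ (Fin d)) (θ : ℝ) (T : Fin m → EuclideanSpace ℝ (Fin d)) : ℝ :=
  ∑ i, if T i ∈ strip m w θ then 1 else 0

/-- `m ^ 2` times the squared distance of the empirical moment tensors of two samples. -/
def discrepancy (k : ℕ) (U T : Fin m → EuclideanSpace ℝ (Fin d)) : ℝ :=
  ∑ i, ∑ l, (momentKernel k (U i) (U l) + momentKernel k (T i) (T l) -
    2 * momentKernel k (U i) (T l))

/-- The label of the first example. -/
def firstLabel (S : Fin m → EuclideanSpace ℝ (Fin d) × ℤˣ) : ℝ :=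
  padded (fun i => (((S i).2 : ℤ) : ℝ)) 0

open Classical in
/-- The function that the learner computes. -/
def learner (ε : ℝ) (S : Fin m → EuclideanSpace ℝ (Fin d) × ℤˣ)
    (T : Fin m → EuclideanSpace ℝ (Fin d)) : Option (EuclideanSpace ℝ (Fin d) → ℤˣ) :=
  if (1 / 2) ^ (128 * order ε) * (m : ℝ) ^ 2 ≤ ‖chowVector S‖ ^ 2 then
    if 2 * stripCount (chowVector S) (chowBias S) T ≤ ε * m then
      some (halfspace (chowVector S) (chowBias S))
    else none
  else if discrepancy (order ε) (fun i => (S i).1) T ≤ (m : ℝ) ^ 2 then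
    some (halfspace 0 (-firstLabel S))
  else none

theorem concatPoints_apply (T : Fin m → EuclideanSpace ℝ (Fin d)) (i : Fin m) (j : Fin d) :
    concatPoints T (i * d + j) = T i j := by
  have h : (i : ℕ) * d + j < m * d := by
    have := Nat.mul_le_mul_right d (Nat.succ_le_of_lt i.2)
    have := j.2
    rw [Nat.succ_mul] at *
    omega
  rw [concatPoints, padded, dif_pos h]
  have hd : 0 < d := j.pos
  have h₁ : (⟨i * d + j, h⟩ : Fin (m * d)).divNat = i := by
    ext
    simp [Fin.divNat, Nat.mul_comm (i : ℕ) d, Nat.mul_add_div hd]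
  have h₂ : (⟨i * d + j, h⟩ : Fin (m * d)).modNat = j := by
    ext
    simp [Fin.modNat, Nat.mul_comm (i : ℕ) d, Nat.mod_eq_of_lt j.2]
  rw [h₁, h₂]

theorem sum_concatPoints_mul (T U : Fin m → EuclideanSpace ℝ (Fin d)) (i l : Fin m) :
    ∑ j ∈ Finset.range d, concatPoints T (i * d + j) * concatPoints U (l * d + j) =
      inner ℝ (T i) (U l) := by
  rw [Finset.sum_range, PiLp.inner_apply]
  exact Finset.sum_congr rfl fun j _ => by
    rw [concatPoints_apply, concatPoints_apply]; exact mul_comm _ _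

theorem sum_concatPoints_mul_self (T : Fin m → EuclideanSpace ℝ (Fin d)) (i : Fin m) :
    ∑ j ∈ Finset.range d, concatPoints T (i * d + j) * concatPoints T (i * d + j) =
      ‖T i‖ ^ 2 := by
  rw [sum_concatPoints_mul, real_inner_self_eq_norm_sq]

theorem padded_apply {n : ℕ} (u : Fin n → ℝ) (i : Fin n) : padded u i = u i := by
  simp [padded]

end TDS

/-! ### Correctness and running time of the program -/

namespace RealRAM

open TDS

/-- The learner. -/
def learnerProg : Prog :=
  .seq orderProg (.seq chowProg (.seq biasProg (.seq (dotProg 4 8 4 8)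
    (.ite (.realLe (.mul (rvar 5) (.mul (.ofNat (.get 0 (.const 1))) (.ofNat (.get 0 (.const 1)))))
        (rvar 7))
      (.seq countProg (.ite (.realLe (.mul (.const 2) (rvar 9))
          (.mul (rvar 0) (.ofNat (.get 0 (.const 1)))))
        (.setNat 1 (.const 0) (.const 1)) .skip))
      (.seq mmdProg (.ite (.realLe (rvar 9)
          (.mul (.ofNat (.get 0 (.const 1))) (.ofNat (.get 0 (.const 1)))))
        constProg .skip))))))

theorem runs_learnerProg {d m : ℕ} {ε : ℝ} (hε : 0 < ε)
    (S : Fin m → EuclideanSpace ℝ (Fin d) × ℤˣ) (T : Fin m → EuclideanSpace ℝ (Fin d)) :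
    Runs learnerProg (inputState ε S T) (5000 * ((m + 1) * ((m + 1) * (d + order ε + 1))))
      fun s' => output d s' = learner ε S T := by
  set s := inputState ε S T with hs
  have hd : s.nat 0 0 = d := by simp [hs, inputState]
  have hm : s.nat 0 1 = m := by simp [hs, inputState]
  have h8 : s.nat 8 0 = 0 := by simp [hs, inputState]
  have h1 : s.nat 1 0 = 0 := by simp [hs, inputState]
  have r0 : s.real 0 0 = ε := by simp [hs, inputState, padded]
  have r1 : s.real 1 = concatPoints fun i => (S i).1 := by simp [hs, inputState]
  have r2 : s.real 2 = padded fun i => (((S i).2 : ℤ) : ℝ) := by simp [hs, inputState]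
  have r3 : s.real 3 = concatPoints T := by simp [hs, inputState]
  set k := order ε with hk
  set W := chowVector S with hW
  set Θ := chowBias S with hΘ
  have hWj : ∀ j (hj : j < d), ∑ i ∈ Finset.range m, s.real 2 i * s.real 1 (i * d + j) =
      W ⟨j, hj⟩ := by
    intro j hj
    rw [Finset.sum_range, r1, r2, hW, chowVector]
    simp only [padded_apply]
    rw [WithLp.ofLp_sum, Finset.sum_apply]
    refine Finset.sum_congr rfl fun i _ => ?_
    rw [show (i : ℕ) * d + j = i * d + ((⟨j, hj⟩ : Fin d) : ℕ) from rfl, concatPoints_apply]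
    simp
  have hΘ' : ∑ i ∈ Finset.range m, s.real 2 i *
      (∑ j ∈ Finset.range d, s.real 1 (i * d + j) * s.real 1 (i * d + j) - d) = Θ := by
    rw [Finset.sum_range, r1, r2]
    simp only [padded_apply, sum_concatPoints_mul_self]
    rfl
  have hWT : ∀ (u : ℕ → ℝ), (∀ j (hj : j < d), u j = W ⟨j, hj⟩) → ∀ i : Fin m,
      ∑ j ∈ Finset.range d, u j * concatPoints T (i * d + j) = inner ℝ W (T i) := by
    intro u hu i
    rw [Finset.sum_range, PiLp.inner_apply]
    exact Finset.sum_congr rfl fun j _ => by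
      rw [concatPoints_apply, hu j j.2]; exact mul_comm _ _
  -- The complements of `N` and `R` contain the inputs, the acceptance flag (array `1`) and the zero
  -- pointer (array `8`), so all of these keep their initial values up to the final decision.
  let N : Finset ℕ := {2, 3, 4, 5, 6, 7}
  let R : Finset ℕ := {4, 5, 6, 7, 8, 9, 10}
  let G : State → Prop := fun s' => Frame N R s s' ∧ s'.nat 2 0 = k ∧
    s'.real 5 0 = (1 / 2) ^ (128 * k)
  let G' : State → Prop := fun s' => G s' ∧ (∀ j (hj : j < d), s'.real 4 j = W ⟨j, hj⟩) ∧
    s'.real 4 d = Θ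
  have hout : ∀ s' : State, G' s' → WithLp.toLp 2 (fun j : Fin d => s'.real 4 j) = W := by
    intro s' h
    ext j
    simp [h.2.1 j j.2]
  have hB : (d + 1) * (m + 1) ≤ (m + 1) * ((m + 1) * (d + k + 1)) := by
    calc (d + 1) * (m + 1) ≤ (d + k + 1) * (m + 1) := Nat.mul_le_mul_right _ (by omega)
      _ = 1 * ((m + 1) * (d + k + 1)) := by ring
      _ ≤ _ := Nat.mul_le_mul_right _ (by omega)
  have hdk : d + k + 1 ≤ (m + 1) * ((m + 1) * (d + k + 1)) := by
    calc d + k + 1 = 1 * (1 * (d + k + 1)) := by ring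
      _ ≤ _ := Nat.mul_le_mul (by omega) (Nat.mul_le_mul_right _ (by omega))
  -- With the products replaced by atoms, the remaining cost comparisons are linear.
  generalize hA' : (m + 1) * ((m + 1) * (d + k + 1)) = A at hB hdk ⊢
  generalize hB' : (d + 1) * (m + 1) = B at hB
  refine (Runs.seq (Q := G) ((runs_orderProg (by rwa [r0])).mono le_rfl fun s' h =>
    ⟨h.1.mono (by simp [N]) (by simp [R, Finset.insert_subset_iff]), by rw [h.2.1, r0],
      by rw [h.2.2, r0]⟩) fun s₁ h₁ =>
    Runs.seq (Q := fun s' => G s' ∧ ∀ j (hj : j < d), s'.real 4 j = W ⟨j, hj⟩)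
      ((runs_chowProg (d := d) (m := m) (by rw [h₁.1.1 0 (by simp [N]), hd])
        (by rw [h₁.1.1 0 (by simp [N]), hm])).mono le_rfl fun s' h =>
          ⟨⟨h₁.1.trans h.1 (by simp [N, Finset.insert_subset_iff]) (by simp [R]),
            by rw [h.1.1 2 (by simp), h₁.2.1],
            by rw [h.1.2 5 (by simp), h₁.2.2]⟩, fun j hj => by
            rw [h.2 j hj, h₁.1.2 1 (by simp [R]), h₁.1.2 2 (by simp [R]), hWj j hj]⟩)
      fun s₂ h₂ => Runs.seq (Q := G')
      ((runs_biasProg (d := d) (m := m) (by rw [h₂.1.1.1 0 (by simp [N]), hd])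
        (by rw [h₂.1.1.1 0 (by simp [N]), hm])).mono le_rfl fun s' h =>
          ⟨⟨h₂.1.1.trans h.1 (by simp [N, Finset.insert_subset_iff])
            (by simp [R, Finset.insert_subset_iff]), by rw [h.1.1 2 (by simp), h₂.1.2.1],
            by rw [h.1.2 5 (by simp), h₂.1.2.2]⟩, fun j hj => by
            rw [h.2.1 j hj, h₂.2 j hj],
            by rw [h.2.2, h₂.1.1.2 1 (by simp [R]), h₂.1.1.2 2 (by simp [R]), hΘ']⟩)
      fun s₃ h₃ => Runs.seq (Q := fun s' => G' s' ∧ s'.real 7 0 = ‖W‖ ^ 2)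
      ((runs_dotProg (d := d) (by rw [h₃.1.1.1 0 (by simp [N]), hd]) (by simp) (by simp) (by simp)
        (by simp)).mono le_rfl fun s' h => ⟨⟨⟨h₃.1.1.trans h.1 (by simp [N]) (by simp [R]),
          by rw [h.1.1 2 (by simp), h₃.1.2.1], by rw [h.1.2 5 (by simp), h₃.1.2.2]⟩,
          fun j hj => by rw [h.1.2 4 (by simp), h₃.2.1 j hj],
          by rw [h.1.2 4 (by simp), h₃.2.2]⟩, by
          rw [h.2, h₃.1.1.1 8 (by simp [N]), h8, EuclideanSpace.real_norm_sq_eq, Finset.sum_range]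
          exact Finset.sum_congr rfl fun j _ => by rw [zero_add, h₃.2.1 j j.2, sq]⟩)
      fun s₄ h₄ => Runs.ite (t := 2000 * A)
        (fun hb => ?_) fun hb => ?_).mono ?_ fun _ h => h
  · have hm4 : s₄.nat 0 1 = m := by rw [h₄.1.1.1.1 0 (by simp [N]), hm]
    simp only [Test.holds, RealExpr.eval, NatExpr.eval, hm4, h₄.1.1.2.2, h₄.2, ← sq] at hb
    refine (Runs.seq (runs_countProg (d := d) (m := m) (by rw [h₄.1.1.1.1 0 (by simp [N]), hd]) hm4
      (by rw [h₄.1.1.1.1 8 (by simp [N]), h8])) fun s₅ h₅ => Runs.ite (t := 3) (fun hb' => ?_)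
        fun hb' => ?_).mono ?_ fun _ h => h
    rotate_left 2
    · simp only [Test.cost, RealExpr.cost, NatExpr.cost]
      omega
    all_goals
      have hG' : G' s₅ := ⟨⟨h₄.1.1.1.trans h₅.1
        (by simp [N, Finset.insert_subset_iff]) (by simp [R, Finset.insert_subset_iff]),
          by rw [h₅.1.1 2 (by simp), h₄.1.1.2.1], by rw [h₅.1.2 5 (by simp), h₄.1.1.2.2]⟩,
          fun j hj => by rw [h₅.1.2 4 (by simp), h₄.1.2.1 j hj],
          by rw [h₅.1.2 4 (by simp), h₄.1.2.2]⟩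
      have hcount : s₅.real 9 0 = stripCount W Θ T := by
        rw [h₅.2, Finset.sum_range, stripCount]
        simp only [h₄.1.1.1.2 3 (by simp [R]), r3, sum_concatPoints_mul_self, h₄.1.2.2,
          hWT _ h₄.1.2.1, strip, Set.mem_ofPred_eq]
        exact Finset.sum_congr rfl fun i _ => by congr
      simp only [Test.holds, RealExpr.eval, NatExpr.eval, hcount, hG'.1.1.1 0 (by simp [N]), hm,
        hG'.1.1.2 0 (by simp [R]), r0, Rat.cast_ofNat] at hb'
    · refine Runs.setNat ?_
      rw [output, learner, if_pos hb, if_pos hb']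
      simp only [NatExpr.eval, State.setNat_nat_same, State.setNat_real, one_ne_zero, if_false]
      rw [hout s₅ hG', hG'.2.2]
    · refine (Runs.skip ?_).mono (by simp) fun _ h => h
      rw [output, learner, if_pos hb, if_neg hb', hG'.1.1.1 1 (by simp [N]), h1]
      simp
  · have hm4 : s₄.nat 0 1 = m := by rw [h₄.1.1.1.1 0 (by simp [N]), hm]
    simp only [Test.holds, RealExpr.eval, NatExpr.eval, hm4, h₄.1.1.2.2, h₄.2, ← sq] at hb
    refine (Runs.seq (runs_mmdProg (d := d) (m := m) (k := k)
      (by rw [h₄.1.1.1.1 0 (by simp [N]), hd]) hm4 h₄.1.1.2.1)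
      fun s₅ h₅ => Runs.ite (t := 40 * (d + 1)) (fun hb' => ?_)
        fun hb' => ?_).mono ?_ fun _ h => h
    rotate_left 2
    · simp only [Test.cost, RealExpr.cost, NatExpr.cost]
      omega
    all_goals
      have hF : Frame N R s s₅ := h₄.1.1.1.trans h₅.1
        (by simp [N]) (by simp [R, Finset.insert_subset_iff])
      have hdisc : s₅.real 9 0 = discrepancy k (fun i => (S i).1) T := by
        rw [h₅.2]
        simp only [h₄.1.1.1.2 1 (by simp [R]), h₄.1.1.1.2 3 (by simp [R]), r1, r3]
        rw [Finset.sum_range, discrepancy]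
        refine Finset.sum_congr rfl fun i _ => ?_
        rw [Finset.sum_range]
        refine Finset.sum_congr rfl fun l _ => ?_
        simp only [sum_concatPoints_mul]
        rfl
      simp only [Test.holds, RealExpr.eval, NatExpr.eval, hdisc, hF.1 0 (by simp [N]), hm,
        ← sq] at hb'
    · refine (runs_constProg (d := d) (by rw [hF.1 0 (by simp [N]), hd])).mono le_rfl
        fun s' h => ?_
      rw [output, learner, if_neg hb, if_pos hb', h.1, h.2.2, hF.2 2 (by simp [R]), r2]
      simp only [one_ne_zero, if_false]
      congr 2
      ext j
      simp [h.2.1 j j.2]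
    · refine (Runs.skip ?_).mono (by omega) fun _ h => h
      rw [output, learner, if_neg hb, if_neg hb', hF.1 1 (by simp [N]), h1]
      simp
  · simp only [Test.cost, RealExpr.cost, NatExpr.cost]
    rw [r0]
    omega

end RealRAM

namespace TDS

/-! ### Gaussian integrals -/

section Real

theorem integrable_pow_gaussianReal (n : ℕ) :
    Integrable (fun x : ℝ => x ^ n) (gaussianReal 0 1) := by
  have h := ((memLp_id_gaussianReal' (μ := 0) (v := 1) n (by simp)).integrable_norm_pow')
  refine h.mono (by fun_prop) (ae_of_all _ fun x => by simp)

theorem integrable_pow_mul_gaussianPDFReal (n : ℕ) :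
    Integrable fun x : ℝ => x ^ n * gaussianPDFReal 0 1 x := by
  have h := integrable_pow_gaussianReal n
  rw [gaussianReal_of_var_ne_zero _ one_ne_zero, integrable_withDensity_iff_integrable_smul'
    (measurable_gaussianPDF _ _) (ae_of_all _ fun _ => gaussianPDF_lt_top)] at h
  refine h.congr (ae_of_all _ fun x => ?_)
  simp [toReal_gaussianPDF, mul_comm]

theorem hasDerivAt_gaussianPDFReal (x : ℝ) :
    HasDerivAt (gaussianPDFReal 0 1) (-(x * gaussianPDFReal 0 1 x)) x := by
  have h : HasDerivAt (fun x : ℝ => -(x ^ 2) / 2) (-x) x := by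
    exact ((hasDerivAt_pow 2 x).fun_neg.div_const 2).congr_deriv (by simp; ring)
  have h' := (h.exp).const_mul ((√(2 * Real.pi))⁻¹)
  have e : gaussianPDFReal 0 1 = fun x => (√(2 * Real.pi))⁻¹ * Real.exp (-(x ^ 2) / 2) := by
    ext y
    simp [gaussianPDFReal]
  rw [e]
  exact h'.congr_deriv (by ring)

/-- A function that is integrable together with its derivative tends to zero at infinity. -/
theorem tendsto_pow_mul_gaussianPDFReal (n : ℕ) :
    Filter.Tendsto (fun x : ℝ => x ^ n * gaussianPDFReal 0 1 x) Filter.atTop (nhds 0) := by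
  refine tendsto_zero_of_hasDerivAt_of_integrableOn_Ioi (a := 0)
    (f' := fun x => n * (x ^ (n - 1) * gaussianPDFReal 0 1 x) -
      x ^ (n + 1) * gaussianPDFReal 0 1 x) (fun x _ => ?_) ?_ ?_
  · exact ((hasDerivAt_pow n x).fun_mul (hasDerivAt_gaussianPDFReal x)).congr_deriv (by ring)
  · exact (((integrable_pow_mul_gaussianPDFReal (n - 1)).const_mul _).sub
      (integrable_pow_mul_gaussianPDFReal (n + 1))).integrableOn
  · exact (integrable_pow_mul_gaussianPDFReal n).integrableOn

/-- Since `φ' = -xφ`, an antiderivative is `-φ`. In the next lemma it is `-xφ`. -/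
theorem setIntegral_Ioi_mul_gaussianPDFReal (τ : ℝ) :
    ∫ x in Set.Ioi τ, x * gaussianPDFReal 0 1 x = gaussianPDFReal 0 1 τ := by
  have h := integral_Ioi_of_hasDerivAt_of_tendsto' (a := τ)
    (f := fun x => -gaussianPDFReal 0 1 x) (f' := fun x => x * gaussianPDFReal 0 1 x) (m := 0)
    (fun x _ => by simpa using (hasDerivAt_gaussianPDFReal x).fun_neg)
    (by simpa using (integrable_pow_mul_gaussianPDFReal 1).integrableOn)
    (by simpa using (tendsto_pow_mul_gaussianPDFReal 0).neg)
  simpa using h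

theorem setIntegral_Ioi_sq_sub_one_mul_gaussianPDFReal (τ : ℝ) :
    ∫ x in Set.Ioi τ, (x ^ 2 - 1) * gaussianPDFReal 0 1 x = τ * gaussianPDFReal 0 1 τ := by
  have h := integral_Ioi_of_hasDerivAt_of_tendsto' (a := τ)
    (f := fun x => -(x * gaussianPDFReal 0 1 x))
    (f' := fun x => (x ^ 2 - 1) * gaussianPDFReal 0 1 x) (m := 0)
    (fun x _ => ((hasDerivAt_id' x).fun_mul (hasDerivAt_gaussianPDFReal x)).fun_neg.congr_deriv
      (by ring))
    (by
      have h : Integrable fun x : ℝ =>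
          x ^ 2 * gaussianPDFReal 0 1 x - x ^ 0 * gaussianPDFReal 0 1 x :=
        (integrable_pow_mul_gaussianPDFReal 2).sub (integrable_pow_mul_gaussianPDFReal 0)
      simpa [sub_mul] using h.integrableOn)
    (by simpa using (tendsto_pow_mul_gaussianPDFReal 1).neg)
  simpa using h

/-- The label `sign (t - τ)` as a real number. -/
def realSign (τ t : ℝ) : ℝ := ((signLabel (t - τ) : ℤ) : ℝ)

theorem realSign_eq (τ t : ℝ) : realSign τ t = 2 * (Set.Ici τ).indicator 1 t - 1 := by
  by_cases h : τ ≤ t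
  · simp [realSign, signLabel, h]; norm_num
  · simp [realSign, signLabel, h]

theorem measurable_realSign (τ : ℝ) : Measurable (realSign τ) := by
  rw [funext (realSign_eq τ)]
  exact ((measurable_one.indicator measurableSet_Ici).const_mul _).sub_const _

theorem abs_realSign (τ t : ℝ) : |realSign τ t| = 1 := by
  rcases Int.units_eq_one_or (signLabel (t - τ)) with h | h <;> simp [realSign, h]

/-- The sign is `2 · 1_[τ,∞) - 1`, and the constant part integrates to zero against a centred `g`.
It is applied to the Hermite polynomials `x` and `x² - 1`. -/
theorem integral_realSign_mul {g : ℝ → ℝ} (hg : Integrable g (gaussianReal 0 1))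
    (h0 : ∫ x, g x ∂gaussianReal 0 1 = 0) (τ : ℝ) :
    ∫ x, realSign τ x * g x ∂gaussianReal 0 1 =
      2 * ∫ x in Set.Ioi τ, g x * gaussianPDFReal 0 1 x := by
  have h1 : ∀ x, realSign τ x * g x = 2 * (Set.Ici τ).indicator g x - g x := by
    intro x
    by_cases h : x ∈ Set.Ici τ
    · simp [realSign_eq, h]; ring
    · simp [realSign_eq, h]
  simp_rw [h1]
  rw [integral_sub ((hg.indicator measurableSet_Ici).const_mul 2) hg, h0, sub_zero,
    integral_const_mul, integral_gaussianReal_eq_integral_smul one_ne_zero,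
    ← integral_Ici_eq_integral_Ioi, ← integral_indicator measurableSet_Ici]
  congr 2
  ext x
  by_cases h : x ∈ Set.Ici τ
  · simp [h, mul_comm]
  · simp [h]

theorem integral_sq_gaussianReal : ∫ x : ℝ, x ^ 2 ∂gaussianReal 0 1 = 1 := by
  have h := variance_fun_id_gaussianReal (μ := 0) (v := 1)
  rw [variance_of_integral_eq_zero (by fun_prop) (by simp)] at h
  simpa using h

theorem integral_realSign_mul_id (τ : ℝ) :
    ∫ x, realSign τ x * x ∂gaussianReal 0 1 = 2 * gaussianPDFReal 0 1 τ := by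
  rw [integral_realSign_mul (by simpa using integrable_pow_gaussianReal 1) (by simp),
    setIntegral_Ioi_mul_gaussianPDFReal]

theorem integral_realSign_mul_sq_sub_one (τ : ℝ) :
    ∫ x, realSign τ x * (x ^ 2 - 1) ∂gaussianReal 0 1 = 2 * gaussianPDFReal 0 1 τ * τ := by
  rw [integral_realSign_mul (g := fun x => x ^ 2 - 1)
    ((integrable_pow_gaussianReal 2).sub (integrable_const 1)),
    setIntegral_Ioi_sq_sub_one_mul_gaussianPDFReal]
  · ring
  · rw [integral_sub (integrable_pow_gaussianReal 2) (integrable_const 1),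
      integral_sq_gaussianReal]
    simp

/-- One term of the exponential series gives `(tx)^(2n) ≤ (2n)! e^|tx|`. With `t² = 2n` and `(2n)! ≤
(2n)^(2n)`, the moment generating function yields `2 (2n)^n e^n`, and `e ≤ 3`. The constant `6` only
has to be well below the `64` in the tail condition `τ² ≥ 64k`. -/
theorem integral_pow_gaussianReal_le (n : ℕ) (hn : 0 < n) :
    ∫ x : ℝ, x ^ (2 * n) ∂gaussianReal 0 1 ≤ 2 * (6 * n) ^ n := by
  set t : ℝ := √(2 * n) with ht
  have ht2 : t ^ 2 = 2 * n := Real.sq_sqrt (by positivity)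
  have hn' : (0 : ℝ) < n := by exact_mod_cast hn
  have hpt : ∀ x : ℝ, x ^ (2 * n) ≤ (2 * n) ^ n * (Real.exp (t * x) + Real.exp (-t * x)) := by
    intro x
    have h1 := Real.pow_div_factorial_le_exp (x := |t * x|) (abs_nonneg _) (2 * n)
    have h2 : Real.exp |t * x| ≤ Real.exp (t * x) + Real.exp (-t * x) := by
      rcases abs_cases (t * x) with h | h
      · rw [h.1]; linarith [Real.exp_pos (-t * x)]
      · rw [h.1, neg_mul]; linarith [Real.exp_pos (t * x)]
    have h3 : |t * x| ^ (2 * n) = (2 * n) ^ n * x ^ (2 * n) := by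
      rw [pow_mul, sq_abs, mul_pow, ht2, mul_pow, ← pow_mul]
    have h4 : ((2 * n).factorial : ℝ) ≤ ((2 * n : ℕ) : ℝ) ^ (2 * n) := by
      exact_mod_cast Nat.factorial_le_pow (2 * n)
    rw [div_le_iff₀ (by positivity), h3] at h1
    have h5 : (2 * n : ℝ) ^ n * x ^ (2 * n) ≤
        (2 * n) ^ n * ((2 * n) ^ n * (Real.exp (t * x) + Real.exp (-t * x))) := by
      calc _ ≤ Real.exp |t * x| * (2 * n).factorial := h1
        _ ≤ (Real.exp (t * x) + Real.exp (-t * x)) * ((2 * n : ℕ) : ℝ) ^ (2 * n) := by gcongr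
        _ = _ := by push_cast; ring
    exact le_of_mul_le_mul_left h5 (by positivity)
  have hmgf : ∀ s : ℝ, ∫ x, Real.exp (s * x) ∂gaussianReal 0 1 = Real.exp (s ^ 2 / 2) := by
    intro s
    have := congrFun (mgf_fun_id_gaussianReal (μ := 0) (v := 1)) s
    simpa [mgf] using this
  have hint : ∀ s : ℝ, Integrable (fun x => Real.exp (s * x)) (gaussianReal 0 1) :=
    fun s => integrable_exp_mul_gaussianReal s
  calc ∫ x : ℝ, x ^ (2 * n) ∂gaussianReal 0 1
      ≤ ∫ x, (2 * n) ^ n * (Real.exp (t * x) + Real.exp (-t * x)) ∂gaussianReal 0 1 :=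
        integral_mono (integrable_pow_gaussianReal _) (((hint t).add (hint (-t))).const_mul _) hpt
    _ = (2 * n) ^ n * (2 * Real.exp (t ^ 2 / 2)) := by
        rw [integral_const_mul, integral_add (hint t) (hint (-t)), hmgf, hmgf, neg_sq]
        ring
    _ = 2 * ((2 * n) ^ n * Real.exp 1 ^ n) := by
        rw [ht2, ← Real.exp_nat_mul]
        ring_nf
    _ ≤ 2 * ((2 * n) ^ n * 3 ^ n) := by
        have := Real.exp_one_lt_three.le
        gcongr
    _ = _ := by rw [← mul_pow]; ring

theorem gaussianPDFReal_le_half (x : ℝ) : gaussianPDFReal 0 1 x ≤ 1 / 2 := by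
  have h1 : (2 : ℝ) ≤ √(2 * Real.pi) :=
    Real.le_sqrt_of_sq_le (by nlinarith [Real.pi_gt_three])
  have h2 : Real.exp (-(x - 0) ^ 2 / (2 * 1)) ≤ 1 :=
    Real.exp_le_one_iff.2 (by nlinarith [sq_nonneg x])
  simp only [gaussianPDFReal, NNReal.coe_one, mul_one] at h2 ⊢
  calc _ ≤ (2 : ℝ)⁻¹ * 1 := by gcongr
    _ = _ := by norm_num

theorem gaussianReal_Icc_le (a r : ℝ) :
    gaussianReal 0 1 (Set.Icc (a - r) (a + r)) ≤ ENNReal.ofReal r := by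
  rw [gaussianReal_apply _ one_ne_zero]
  calc ∫⁻ x in Set.Icc (a - r) (a + r), gaussianPDF 0 1 x
      ≤ ∫⁻ _ in Set.Icc (a - r) (a + r), ENNReal.ofReal (1 / 2) := by
        gcongr with x
        exact ENNReal.ofReal_le_ofReal (gaussianPDFReal_le_half x)
    _ = ENNReal.ofReal r := by
        rw [setLIntegral_const, Real.volume_Icc, ← ENNReal.ofReal_mul (by norm_num)]
        congr 1
        ring

end Real

section Euclidean

variable {d : ℕ}

theorem integral_pi_mul {F g : ℝ → ℝ} (hF : Measurable F) (hg : Measurable g)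
    (i₀ i : Fin d) (hi : i ≠ i₀) (h0 : ∫ x, g x ∂gaussianReal 0 1 = 0) :
    ∫ z : Fin d → ℝ, F (z i₀) * g (z i) ∂Measure.pi (fun _ => gaussianReal 0 1) = 0 := by
  have hind := (iIndepFun_pi (μ := fun _ : Fin d => gaussianReal 0 1) (X := fun _ x => x)
    fun _ => by fun_prop).indepFun hi.symm
  rw [hind.integral_fun_comp_mul_comp (measurable_pi_apply i₀).aemeasurable
    (measurable_pi_apply i).aemeasurable hF.aestronglyMeasurable
    hg.aestronglyMeasurable, integral_comp_eval (i := i) hg.aestronglyMeasurable, h0, mul_zero]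

/-- By rotation invariance, the Gaussian has independent standard coordinates in a basis that
contains `v`; functions of `⟨v, x⟩` then depend on a single coordinate. -/
theorem exists_orthonormalBasis_apply_eq {v : EuclideanSpace ℝ (Fin d)} (hv : ‖v‖ = 1) :
    ∃ (b : OrthonormalBasis (Fin d) ℝ (EuclideanSpace ℝ (Fin d))) (i₀ : Fin d), b i₀ = v := by
  have hd : d ≠ 0 := by
    rintro rfl
    rw [Subsingleton.elim v 0] at hv
    simp at hv
  have : NeZero d := ⟨hd⟩
  obtain ⟨b, hb⟩ := Orthonormal.exists_orthonormalBasis_extension_of_card_eq (ι := Fin d)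
    (𝕜 := ℝ) (E := EuclideanSpace ℝ (Fin d)) (by simp) (v := fun _ => v) (s := {0}) (by
      constructor
      · intro i; simpa using hv
      · intro i j hij
        exact absurd (Subsingleton.elim i j) hij)
  exact ⟨b, 0, hb 0 rfl⟩

theorem integral_stdGaussian_eq_pi (b : OrthonormalBasis (Fin d) ℝ (EuclideanSpace ℝ (Fin d)))
    {f : EuclideanSpace ℝ (Fin d) → ℝ} (hf : Measurable f) :
    ∫ x, f x ∂stdGaussian (EuclideanSpace ℝ (Fin d)) =
      ∫ z, f (∑ i, z i • b i) ∂Measure.pi (fun _ : Fin d => gaussianReal 0 1) := by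
  rw [stdGaussian_eq_map_pi_orthonormalBasis b, integral_map
    (Measurable.aemeasurable (by fun_prop)) hf.aestronglyMeasurable]

theorem inner_basis_sum (b : OrthonormalBasis (Fin d) ℝ (EuclideanSpace ℝ (Fin d)))
    (z : Fin d → ℝ) (i₀ : Fin d) : inner ℝ (b i₀) (∑ i, z i • b i) = z i₀ := by
  simp [inner_sum, inner_smul_right, b.inner_eq_ite]

theorem norm_sq_basis_sum (b : OrthonormalBasis (Fin d) ℝ (EuclideanSpace ℝ (Fin d)))
    (z : Fin d → ℝ) : ‖∑ i, z i • b i‖ ^ 2 = ∑ i, z i ^ 2 := by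
  rw [← b.sum_sq_inner_right]
  simp_rw [inner_basis_sum]

theorem integrable_bounded_mul_pi {F g : ℝ → ℝ} (hF : Measurable F) (hF1 : ∀ t, |F t| ≤ 1)
    (hg : Integrable g (gaussianReal 0 1)) (i₀ i : Fin d) :
    Integrable (fun z : Fin d → ℝ => F (z i₀) * g (z i))
      (Measure.pi (fun _ => gaussianReal 0 1)) := by
  refine Integrable.bdd_mul (c := 1) ?_
    (hF.comp (measurable_pi_apply i₀)).aestronglyMeasurable (ae_of_all _ fun z => hF1 _)
  exact (measurePreserving_eval
    (fun _ : Fin d => gaussianReal 0 1) i).integrable_comp_of_integrable hg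

/-- The first Chow parameters of a function of `⟨v, x⟩`. -/
theorem integral_mul_inner_stdGaussian {F : ℝ → ℝ} (hF : Measurable F) (hF1 : ∀ t, |F t| ≤ 1)
    {v : EuclideanSpace ℝ (Fin d)} (hv : ‖v‖ = 1) (u : EuclideanSpace ℝ (Fin d)) :
    ∫ x, F (inner ℝ v x) * inner ℝ u x ∂stdGaussian (EuclideanSpace ℝ (Fin d)) =
      inner ℝ u v * ∫ t, F t * t ∂gaussianReal 0 1 := by
  obtain ⟨b, i₀, rfl⟩ := exists_orthonormalBasis_apply_eq hv
  rw [integral_stdGaussian_eq_pi b (by fun_prop)]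
  simp_rw [inner_basis_sum, inner_sum, inner_smul_right, Finset.mul_sum]
  have hint : ∀ i : Fin d, Integrable (fun z : Fin d → ℝ => F (z i₀) * (z i * inner ℝ u (b i)))
      (Measure.pi (fun _ => gaussianReal 0 1)) := fun i =>
    integrable_bounded_mul_pi hF hF1
      (g := fun t => t * inner ℝ u (b i)) ((by simpa using integrable_pow_gaussianReal 1 :
        Integrable (fun t : ℝ => t) (gaussianReal 0 1)).mul_const _) i₀ i
  -- The coordinates other than `i₀` are independent of `⟨v, x⟩` and centred, so they contribute
  -- nothing.
  rw [integral_finsetSum _ fun i _ => hint i, Finset.sum_eq_single i₀]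
  · rw [integral_comp_eval (X := fun _ : Fin d => ℝ) (i := i₀)
      (f := fun t : ℝ => F t * (t * inner ℝ u (b i₀)))
      (Measurable.aestronglyMeasurable (by fun_prop))]
    simp_rw [← mul_assoc]
    rw [integral_mul_const, mul_comm]
  · intro i _ hi
    exact integral_pi_mul hF (g := fun t => t * inner ℝ u (b i)) (by fun_prop) i₀ i hi
      (by rw [integral_mul_const]; simp)
  · simp

theorem integral_mul_norm_sq_sub_stdGaussian {F : ℝ → ℝ} (hF : Measurable F)
    (hF1 : ∀ t, |F t| ≤ 1) {v : EuclideanSpace ℝ (Fin d)} (hv : ‖v‖ = 1) :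
    ∫ x, F (inner ℝ v x) * (‖x‖ ^ 2 - d) ∂stdGaussian (EuclideanSpace ℝ (Fin d)) =
      ∫ t, F t * (t ^ 2 - 1) ∂gaussianReal 0 1 := by
  obtain ⟨b, i₀, rfl⟩ := exists_orthonormalBasis_apply_eq hv
  rw [integral_stdGaussian_eq_pi b (by fun_prop)]
  -- Subtracting `d` centres every squared coordinate, so again only coordinate `i₀` survives.
  have e : ∀ z : Fin d → ℝ, F (inner ℝ (b i₀) (∑ i, z i • b i)) * (‖∑ i, z i • b i‖ ^ 2 - d) =
      ∑ i, F (z i₀) * (z i ^ 2 - 1) := by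
    intro z
    rw [inner_basis_sum, norm_sq_basis_sum, ← Finset.mul_sum, Finset.sum_sub_distrib]
    simp
  simp_rw [e]
  have hg : Integrable (fun t : ℝ => t ^ 2 - 1) (gaussianReal 0 1) :=
    (integrable_pow_gaussianReal 2).sub (integrable_const 1)
  rw [integral_finsetSum _ fun i _ => integrable_bounded_mul_pi hF hF1 hg i₀ i,
    Finset.sum_eq_single i₀]
  · rw [integral_comp_eval (X := fun _ : Fin d => ℝ) (i := i₀)
      (f := fun t : ℝ => F t * (t ^ 2 - 1)) (Measurable.aestronglyMeasurable (by fun_prop))]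
  · intro i _ hi
    refine integral_pi_mul hF (g := fun t => t ^ 2 - 1) (by fun_prop) i₀ i hi ?_
    rw [integral_sub (integrable_pow_gaussianReal 2) (integrable_const 1),
      integral_sq_gaussianReal]
    simp
  · simp

theorem map_inner_stdGaussian {v : EuclideanSpace ℝ (Fin d)} (hv : ‖v‖ = 1) :
    (stdGaussian (EuclideanSpace ℝ (Fin d))).map (fun x => inner ℝ v x) = gaussianReal 0 1 := by
  have h := IsGaussian.map_eq_gaussianReal (μ := stdGaussian (EuclideanSpace ℝ (Fin d)))
    (innerSL ℝ v)
  rw [integral_strongDual_stdGaussian, variance_dual_stdGaussian, innerSL_apply_norm, hv] at h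
  simpa using h

theorem integrable_norm_pow_stdGaussian (n : ℕ) :
    Integrable (fun x : EuclideanSpace ℝ (Fin d) => ‖x‖ ^ n)
      (stdGaussian (EuclideanSpace ℝ (Fin d))) :=
  (IsGaussian.memLp_id (stdGaussian (EuclideanSpace ℝ (Fin d))) n (by simp)).integrable_norm_pow'

theorem integral_inner_pow_stdGaussian_le {v : EuclideanSpace ℝ (Fin d)} (hv : ‖v‖ = 1) (n : ℕ)
    (hn : 0 < n) :
    ∫ x, (inner ℝ v x) ^ (2 * n) ∂stdGaussian (EuclideanSpace ℝ (Fin d)) ≤ 2 * (6 * n) ^ n := by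
  refine le_trans (le_of_eq ?_) (integral_pow_gaussianReal_le n hn)
  rw [← map_inner_stdGaussian hv, integral_map (by fun_prop) (by fun_prop)]

theorem integrable_inner_pow_stdGaussian (v : EuclideanSpace ℝ (Fin d)) (n : ℕ) :
    Integrable (fun x => (inner ℝ v x) ^ n) (stdGaussian (EuclideanSpace ℝ (Fin d))) := by
  refine ((integrable_norm_pow_stdGaussian n).const_mul (‖v‖ ^ n)).mono (by fun_prop)
    (ae_of_all _ fun x => ?_)
  simp only [norm_pow, Real.norm_eq_abs, abs_mul, abs_norm, ← mul_pow]
  gcongr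
  exact abs_real_inner_le_norm v x

/-- The power mean inequality `(∑ x_i²)^n ≤ d^(n-1) ∑ x_i^(2n)` reduces this to one-dimensional
moments. -/
theorem integral_norm_pow_stdGaussian_le (n : ℕ) (hn : 0 < n) :
    ∫ x : EuclideanSpace ℝ (Fin d), ‖x‖ ^ (2 * n) ∂stdGaussian (EuclideanSpace ℝ (Fin d)) ≤
      d ^ n * (2 * (6 * n) ^ n) := by
  obtain ⟨n, rfl⟩ : ∃ k, n = k + 1 := ⟨n - 1, by omega⟩
  let e := EuclideanSpace.basisFun (Fin d) ℝ
  have hpt : ∀ x : EuclideanSpace ℝ (Fin d),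
      ‖x‖ ^ (2 * (n + 1)) ≤ d ^ n * ∑ i, (inner ℝ (e i) x) ^ (2 * (n + 1)) := by
    intro x
    rw [pow_mul, ← e.sum_sq_inner_right]
    simp_rw [pow_mul]
    simpa using pow_sum_le_card_mul_sum_pow (s := Finset.univ)
      (f := fun i => (inner ℝ (e i) x : ℝ) ^ 2) (fun i _ => sq_nonneg _) n
  have hint := fun i => integrable_inner_pow_stdGaussian (e i) (2 * (n + 1))
  calc _ ≤ ∫ x, d ^ n * ∑ i, (inner ℝ (e i) x) ^ (2 * (n + 1))
        ∂stdGaussian (EuclideanSpace ℝ (Fin d)) :=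
        integral_mono (integrable_norm_pow_stdGaussian _)
          ((integrable_finsetSum _ fun i _ => hint i).const_mul _) hpt
    _ = d ^ n * ∑ i, ∫ x, (inner ℝ (e i) x) ^ (2 * (n + 1))
        ∂stdGaussian (EuclideanSpace ℝ (Fin d)) := by
        rw [integral_const_mul, integral_finsetSum _ fun i _ => hint i]
    _ ≤ d ^ n * ∑ _i : Fin d, 2 * (6 * (n + 1 : ℕ) : ℝ) ^ (n + 1) := by
        gcongr with i
        exact integral_inner_pow_stdGaussian_le (e.norm_eq_one i) _ hn
    _ = _ := by
        simp only [Finset.sum_const, Finset.card_univ, Fintype.card_fin, nsmul_eq_mul]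
        ring

end Euclidean

end TDS

namespace TDS

/-! ### Sampling -/

section Sampling

theorem measure_le_of_integral_le {Ω : Type*} [MeasurableSpace Ω] {μ : Measure Ω}
    [IsFiniteMeasure μ] {f : Ω → ℝ} (h0 : ∀ x, 0 ≤ f x) (hf : Integrable f μ) {c δ : ℝ}
    (hc : 0 < c) (h : ∫ x, f x ∂μ ≤ δ * c) : μ {x | c ≤ f x} ≤ ENNReal.ofReal δ := by
  have h1 := mul_meas_ge_le_integral_of_nonneg (ae_of_all _ h0) hf c
  rw [← ofReal_measureReal]
  refine ENNReal.ofReal_le_ofReal ?_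
  have h2 : μ.real {x | c ≤ f x} * c ≤ δ * c := by linarith
  exact le_of_mul_le_mul_right h2 hc

/-- Conditioning on the first factor: a bound that is uniform in the training sample holds for the
product. -/
theorem prod_measure_le {Ω Y : Type*} [MeasurableSpace Ω] [MeasurableSpace Y] {P : Measure Ω}
    [IsProbabilityMeasure P] {Q : Measure Y} [IsProbabilityMeasure Q] {B : Set (Ω × Y)}
    (hB : MeasurableSet B) {δ : ENNReal} (h : ∀ s, Q (Prod.mk s ⁻¹' B) ≤ δ) :
    (P.prod Q) B ≤ δ := by
  rw [Measure.prod_apply hB]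
  calc _ ≤ ∫⁻ _, δ ∂P := lintegral_mono h
    _ = δ := by simp

open Classical in
/-- The number of sample points in `D`. -/
def hits {X : Type*} {m : ℕ} (D : Set X) (T : Fin m → X) : ℝ := ∑ i, if T i ∈ D then 1 else 0

theorem hits_eq {X : Type*} {m : ℕ} (D : Set X) (T : Fin m → X) :
    hits D T = ∑ i, D.indicator (fun _ => (1 : ℝ)) (T i) := by
  refine Finset.sum_congr rfl fun i _ => ?_
  by_cases h : T i ∈ D <;> simp [h]

theorem hits_mono {X : Type*} {m : ℕ} {D D' : Set X} (T : Fin m → X) (h : ∀ i, T i ∈ D → T i ∈ D') :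
    hits D T ≤ hits D' T := by
  rw [hits, hits]
  refine Finset.sum_le_sum fun i _ => ?_
  by_cases hi : T i ∈ D
  · simp [hi, h i hi]
  · simp only [hi, if_false]
    split_ifs <;> norm_num

theorem integral_indicator_one_eq {X : Type*} [MeasurableSpace X] {μ : Measure X} {D : Set X}
    (hD : MeasurableSet D) :
    ∫ x, D.indicator (fun _ => (1 : ℝ)) x ∂μ = μ.real D := by
  rw [integral_indicator_const _ hD]; simp

variable {X : Type*} [MeasurableSpace X] {μ : Measure X} [IsProbabilityMeasure μ] {m : ℕ}

theorem memLp_sum_pi {h : X → ℝ} (hh : MemLp h 2 μ) :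
    MemLp (fun S : Fin m → X => ∑ i, h (S i) - m * ∫ x, h x ∂μ) 2 (Measure.pi fun _ => μ) :=
  (memLp_finsetSum (Finset.univ : Finset (Fin m)) fun i _ =>
    hh.comp_measurePreserving (measurePreserving_eval (fun _ : Fin m => μ) i)).sub (memLp_const _)

theorem integral_sum_pi {h : X → ℝ} (hh : Integrable h μ) :
    ∫ S : Fin m → X, ∑ i, h (S i) ∂Measure.pi (fun _ => μ) = m * ∫ x, h x ∂μ := by
  have hi : ∀ i : Fin m, Integrable (fun S : Fin m → X => h (S i)) (Measure.pi fun _ => μ) :=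
    fun i => (measurePreserving_eval (fun _ : Fin m => μ) i).integrable_comp_of_integrable hh
  rw [integral_finsetSum _ fun i _ => hi i]
  simp_rw [integral_comp_eval (X := fun _ : Fin m => X) (μ := fun _ => μ)
    hh.aestronglyMeasurable]
  simp

/-- Variances of independent summands add, and a variance is at most the second moment. -/
theorem integral_sum_sub_sq_le {h : X → ℝ} (hh : MemLp h 2 μ) :
    ∫ S : Fin m → X, (∑ i, h (S i) - m * ∫ x, h x ∂μ) ^ 2 ∂Measure.pi (fun _ => μ) ≤
      m * ∫ x, h x ^ 2 ∂μ := by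
  have h1 := variance_sum_pi (ι := Fin m) (μ := fun _ => μ) (X := fun _ => h) fun _ => hh
  have h2 : Var[h; μ] ≤ ∫ x, h x ^ 2 ∂μ := variance_le_expectation_sq hh.aestronglyMeasurable
  rw [variance_eq_integral] at h1
  · have e : ∀ S : Fin m → X, (∑ i, fun ω : Fin m → X => h (ω i)) S = ∑ i, h (S i) := by
      intro S; simp
    simp_rw [e, integral_sum_pi (hh.integrable (by simp))] at h1
    rw [h1]
    simp only [Finset.sum_const, Finset.card_univ, Fintype.card_fin, nsmul_eq_mul]
    gcongr
  · refine Finset.aemeasurable_sum _ fun i _ => ?_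
    exact (hh.comp_measurePreserving
      (measurePreserving_eval (fun _ : Fin m => μ) i)).aestronglyMeasurable.aemeasurable

theorem measure_sum_sub_le {h : X → ℝ} (hh : MemLp h 2 μ) {c δ : ℝ} (hc : 0 < c)
    (hδ : m * ∫ x, h x ^ 2 ∂μ ≤ δ * c) :
    (Measure.pi fun _ : Fin m => μ) {S | c ≤ (∑ i, h (S i) - m * ∫ x, h x ∂μ) ^ 2} ≤
      ENNReal.ofReal δ :=
  measure_le_of_integral_le (fun _ => sq_nonneg _) (memLp_sum_pi hh).integrable_sq hc
    ((integral_sum_sub_sq_le hh).trans hδ)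

theorem memLp_indicator_one {D : Set X} (hD : MeasurableSet D) :
    MemLp (D.indicator fun _ => (1 : ℝ)) 2 μ :=
  (memLp_const (1 : ℝ)).indicator hD

theorem measure_hits_sub_le {D : Set X} (hD : MeasurableSet D) {c δ : ℝ} (hc : 0 < c)
    (hδ : m ≤ δ * c) :
    (Measure.pi fun _ : Fin m => μ) {T | c ≤ (hits D T - m * μ.real D) ^ 2} ≤
      ENNReal.ofReal δ := by
  have h := measure_sum_sub_le (m := m) (memLp_indicator_one (μ := μ) hD) hc (δ := δ) ?_
  · rw [integral_indicator_one_eq hD] at h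
    simpa only [hits_eq] using h
  · refine le_trans ?_ hδ
    have e : ∀ x, (D.indicator (fun _ => (1 : ℝ)) x) ^ 2 = D.indicator (fun _ => (1 : ℝ)) x := by
      intro x
      by_cases hx : x ∈ D <;> simp [hx]
    simp_rw [e]
    rw [integral_indicator_one_eq hD]
    exact mul_le_of_le_one_right (Nat.cast_nonneg _) measureReal_le_one

theorem measure_hits_le {D : Set X} (hD : MeasurableSet D) {c δ : ℝ} (hc : 0 < c)
    (hδ : m * μ.real D ≤ δ * c) :
    (Measure.pi fun _ : Fin m => μ) {T | c ≤ hits D T} ≤ ENNReal.ofReal δ := by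
  have hint := (memLp_indicator_one (μ := μ) hD).integrable (by simp)
  refine measure_le_of_integral_le (fun T => ?_) ?_ hc ?_
  · exact Finset.sum_nonneg fun i _ => by split_ifs <;> norm_num
  · rw [show (hits D : (Fin m → X) → ℝ) = _ from funext (hits_eq D)]
    exact integrable_finsetSum _ fun i _ =>
      (measurePreserving_eval (fun _ : Fin m => μ) i).integrable_comp_of_integrable hint
  · simp only [hits_eq]
    rwa [integral_sum_pi hint, integral_indicator_one_eq hD]

variable {Ω : Type*} [MeasurableSpace Ω] {P : Measure Ω} [IsProbabilityMeasure P]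

theorem measurable_hits_section {D : Set (Ω × X)} (hD : MeasurableSet D) :
    Measurable fun p : Ω × (Fin m → X) => hits (Prod.mk p.1 ⁻¹' D) p.2 := by
  simp only [hits]
  refine Finset.measurable_sum _ fun i _ => ?_
  refine Measurable.ite ?_ measurable_const measurable_const
  have : Measurable fun p : Ω × (Fin m → X) => (p.1, p.2 i) := by fun_prop
  exact this hD

/-- Given the training sample, the section of `D` is a fixed set for the independent test sample, so
Chebyshev's inequality applies to it even though the set is chosen from data. -/
theorem measure_prod_hits_sub_le {D : Set (Ω × X)} (hD : MeasurableSet D) {c δ : ℝ} (hc : 0 < c)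
    (hδ : m ≤ δ * c) :
    (P.prod (Measure.pi fun _ : Fin m => μ))
      {p | c ≤ (hits (Prod.mk p.1 ⁻¹' D) p.2 - m * μ.real (Prod.mk p.1 ⁻¹' D)) ^ 2} ≤
      ENNReal.ofReal δ := by
  have h1 : Measurable fun p : Ω × (Fin m → X) => μ.real (Prod.mk p.1 ⁻¹' D) :=
    (measurable_measure_prodMk_left hD).ennreal_toReal.comp measurable_fst
  refine prod_measure_le (measurableSet_le measurable_const
    (((measurable_hits_section hD).sub (h1.const_mul _)).pow_const 2)) fun s => ?_
  exact measure_hits_sub_le (measurable_prodMk_left hD) hc hδ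

theorem measure_prod_hits_le {D : Set (Ω × X)} (hD : MeasurableSet D) {c δ : ℝ} (hc : 0 < c)
    (hδ : ∀ s, m * μ.real (Prod.mk s ⁻¹' D) ≤ δ * c) :
    (P.prod (Measure.pi fun _ : Fin m => μ)) {p | c ≤ hits (Prod.mk p.1 ⁻¹' D) p.2} ≤
      ENNReal.ofReal δ := by
  refine prod_measure_le (measurableSet_le measurable_const (measurable_hits_section hD))
    fun s => ?_
  exact measure_hits_le (measurable_prodMk_left hD) hc (hδ s)

end Sampling

end TDS

namespace TDS

/-! ### The moment kernel -/

section Kernel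

variable {d m : ℕ}

theorem inner_pow_eq_sum (n : ℕ) (x y : EuclideanSpace ℝ (Fin d)) :
    (inner ℝ x y) ^ n = ∑ I : Fin n → Fin d, (∏ l, x (I l)) * ∏ l, y (I l) := by
  rw [PiLp.inner_apply, Fintype.sum_pow]
  refine Finset.sum_congr rfl fun I _ => ?_
  rw [← Finset.prod_mul_distrib]
  exact Finset.prod_congr rfl fun l _ => mul_comm _ _

/-- Cauchy-Schwarz in the feature space of the kernel `⟨x, y⟩ ^ n`. -/
theorem sq_sum_mul_inner_pow_le {ι : Type*} (s : Finset ι) (c : ι → ℝ)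
    (z : ι → EuclideanSpace ℝ (Fin d)) {v : EuclideanSpace ℝ (Fin d)} (hv : ‖v‖ = 1) (n : ℕ) :
    (∑ i ∈ s, c i * (inner ℝ v (z i)) ^ n) ^ 2 ≤
      ∑ i ∈ s, ∑ j ∈ s, c i * c j * (inner ℝ (z i) (z j)) ^ n := by
  -- `Φ x` is the tensor power of `x`: the kernel is the inner product of these features, and `‖Φ v‖
  -- = 1`.
  set Φ : EuclideanSpace ℝ (Fin d) → (Fin n → Fin d) → ℝ := fun x I => ∏ l, x (I l) with hΦ
  have e : ∀ x y : EuclideanSpace ℝ (Fin d), (inner ℝ x y) ^ n = ∑ I, Φ x I * Φ y I :=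
    inner_pow_eq_sum n
  have h1 : ∑ i ∈ s, c i * (inner ℝ v (z i)) ^ n = ∑ I, Φ v I * ∑ i ∈ s, c i * Φ (z i) I := by
    simp_rw [e, Finset.mul_sum]
    rw [Finset.sum_comm]
    exact Finset.sum_congr rfl fun I _ => Finset.sum_congr rfl fun i _ => by ring
  have h2 : ∑ i ∈ s, ∑ j ∈ s, c i * c j * (inner ℝ (z i) (z j)) ^ n =
      ∑ I, (∑ i ∈ s, c i * Φ (z i) I) ^ 2 := by
    simp_rw [e, sq, Finset.sum_mul_sum, Finset.mul_sum]
    rw [Finset.sum_comm (s := (Finset.univ : Finset (Fin n → Fin d)))]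
    refine Finset.sum_congr rfl fun i _ => ?_
    rw [Finset.sum_comm (s := (Finset.univ : Finset (Fin n → Fin d)))]
    exact Finset.sum_congr rfl fun j _ => Finset.sum_congr rfl fun I _ => by ring
  have h3 : ∑ I, Φ v I ^ 2 = 1 := by
    have := e v v
    rw [real_inner_self_eq_norm_sq, hv] at this
    simp only [one_pow] at this
    rw [this]
    exact Finset.sum_congr rfl fun I _ => sq _
  rw [h1, h2]
  calc _ ≤ (∑ I, Φ v I ^ 2) * ∑ I, (∑ i ∈ s, c i * Φ (z i) I) ^ 2 :=
        Finset.sum_mul_sq_le_sq_mul_sq _ _ _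
    _ = _ := by rw [h3, one_mul]

theorem momentKernel_eq (k : ℕ) (x y : EuclideanSpace ℝ (Fin d)) :
    momentKernel k x y = (inner ℝ x y) ^ (2 * k) / (k : ℝ) ^ (2 * k) := by
  rw [momentKernel, div_pow]

/-- Cauchy-Schwarz for the joint sample with weights `-1` on `U` and `1` on `T`. The right side does
not involve `v`, so one computable number controls every direction, including the unknown one. -/
theorem sq_sum_sub_sum_inner_pow_le {k : ℕ} (hk : 0 < k)
    (U T : Fin m → EuclideanSpace ℝ (Fin d)) {v : EuclideanSpace ℝ (Fin d)} (hv : ‖v‖ = 1) :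
    (∑ i, (inner ℝ v (T i)) ^ (2 * k) - ∑ i, (inner ℝ v (U i)) ^ (2 * k)) ^ 2 ≤
      (k : ℝ) ^ (2 * k) * discrepancy k U T := by
  have h := sq_sum_mul_inner_pow_le (Finset.univ : Finset (Fin m ⊕ Fin m))
    (Sum.elim (fun _ => -1) fun _ => 1) (Sum.elim U T) hv (2 * k)
  simp only [Fintype.sum_sum_type, Sum.elim_inl, Sum.elim_inr] at h
  have hk' : (k : ℝ) ^ (2 * k) ≠ 0 := by positivity
  refine le_trans (le_of_eq ?_) (h.trans (le_of_eq ?_))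
  · congr 1
    simp only [neg_mul, one_mul, Finset.sum_neg_distrib]
    ring
  · simp only [discrepancy, momentKernel_eq, Finset.sum_add_distrib, Finset.sum_sub_distrib,
      ← Finset.mul_sum, ← Finset.sum_div, mul_sub, mul_add]
    have hc : ∑ i, ∑ j, (inner ℝ (T i) (U j) : ℝ) ^ (2 * k) =
        ∑ i, ∑ j, (inner ℝ (U i) (T j)) ^ (2 * k) := by
      rw [Finset.sum_comm]
      simp_rw [real_inner_comm]
    simp only [neg_mul, one_mul, mul_one, neg_neg, mul_neg, hc]
    field_simp
    ring

end Kernel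

/-! ### The discrepancy of two Gaussian samples -/

section Discrepancy

variable {d m : ℕ}

local notation "E" => EuclideanSpace ℝ (Fin d)

theorem momentKernel_nonneg (k : ℕ) (x y : E) : 0 ≤ momentKernel k x y := by
  rw [momentKernel, pow_mul]; positivity

theorem momentKernel_self (k : ℕ) (x : E) :
    momentKernel k x x = ‖x‖ ^ (2 * (2 * k)) / (k : ℝ) ^ (2 * k) := by
  rw [momentKernel_eq, real_inner_self_eq_norm_sq, ← pow_mul]

theorem measurable_momentKernel (k : ℕ) :
    Measurable fun p : E × E => momentKernel k p.1 p.2 := by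
  unfold momentKernel
  fun_prop

theorem integrable_momentKernel (k : ℕ) :
    Integrable (fun p : E × E => momentKernel k p.1 p.2)
      ((stdGaussian E).prod (stdGaussian E)) := by
  have h := (integrable_norm_pow_stdGaussian (d := d) (2 * k)).mul_prod
    (integrable_norm_pow_stdGaussian (d := d) (2 * k))
  refine (h.div_const ((k : ℝ) ^ (2 * k))).mono (measurable_momentKernel k).aestronglyMeasurable
    (ae_of_all _ fun p => ?_)
  simp only [momentKernel_eq, norm_div, norm_mul, norm_pow, Real.norm_eq_abs, abs_norm, ← mul_pow]
  gcongr
  exact abs_real_inner_le_norm _ _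

theorem measurePreserving_eval_pair {X : Type*} [MeasurableSpace X] (μ : Measure X)
    [IsProbabilityMeasure μ] {i l : Fin m} (h : i ≠ l) :
    MeasurePreserving (fun U : Fin m → X => (U i, U l)) (Measure.pi fun _ => μ) (μ.prod μ) := by
  refine ⟨by fun_prop, ?_⟩
  have hind := (iIndepFun_pi (μ := fun _ : Fin m => μ) (X := fun _ x => x)
    fun _ => aemeasurable_id').indepFun h
  rw [indepFun_iff_map_prod_eq_prod_map_map (measurable_pi_apply i).aemeasurable
    (measurable_pi_apply l).aemeasurable] at hind
  rw [hind]
  exact congrArg₂ _ (measurePreserving_eval (fun _ : Fin m => μ) i).map_eq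
    (measurePreserving_eval (fun _ : Fin m => μ) l).map_eq

theorem measurable_discrepancy (k : ℕ) :
    Measurable fun p : (Fin m → E) × (Fin m → E) => discrepancy k p.1 p.2 := by
  unfold discrepancy momentKernel
  fun_prop

/-- For `i ≠ l` the expectations of the three kernel terms cancel, `κ + κ - 2κ = 0`, as all the
points involved are independent with the same law. Only the `m` diagonal terms remain, each equal to
`2ρ - 2κ ≤ 2ρ`. -/
theorem integral_discrepancy_le {k : ℕ} (hk : 0 < k) :
    Integrable (fun p : (Fin m → E) × (Fin m → E) => discrepancy k p.1 p.2)
      ((Measure.pi fun _ => stdGaussian E).prod (Measure.pi fun _ => stdGaussian E)) ∧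
    ∫ p : (Fin m → E) × (Fin m → E), discrepancy k p.1 p.2
      ∂(Measure.pi fun _ => stdGaussian E).prod (Measure.pi fun _ => stdGaussian E) ≤
      m * (4 * (12 * d) ^ (2 * k)) := by
  set γ := stdGaussian E with hγ
  set π := Measure.pi fun _ : Fin m => γ with hπ
  set κ := ∫ p : E × E, momentKernel k p.1 p.2 ∂γ.prod γ with hκ
  set ρ := ∫ x : E, momentKernel k x x ∂γ with hρ
  have hκ0 : 0 ≤ κ := integral_nonneg fun p => momentKernel_nonneg k _ _
  have hself : Integrable (fun x : E => momentKernel k x x) γ := by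
    simp only [momentKernel_self]
    exact (integrable_norm_pow_stdGaussian _).div_const _
  have hK : Measurable fun p : E × E => momentKernel k p.1 p.2 := measurable_momentKernel k
  -- Here the division by `k` in the kernel cancels the growth `(12k)^(2k)` of the Gaussian moments.
  have hρle : ρ ≤ 2 * (12 * d) ^ (2 * k) := by
    have h := integral_norm_pow_stdGaussian_le (d := d) (2 * k) (by omega)
    have hk' : (0 : ℝ) < (k : ℝ) ^ (2 * k) := by positivity
    rw [hρ]
    simp only [momentKernel_self]
    rw [integral_div, div_le_iff₀ hk']
    refine h.trans (le_of_eq ?_)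
    push_cast
    rw [mul_pow, mul_pow, mul_pow, show (12 : ℝ) = 6 * 2 by norm_num, mul_pow]
    ring
  -- the same-sample terms
  have hsame : ∀ i l, Integrable (fun U : Fin m → E => momentKernel k (U i) (U l)) π ∧
      ∫ U, momentKernel k (U i) (U l) ∂π = if i = l then ρ else κ := by
    intro i l
    by_cases h : i = l
    · subst h
      have hmp := measurePreserving_eval (fun _ : Fin m => γ) i
      refine ⟨hmp.integrable_comp_of_integrable hself, ?_⟩
      rw [if_pos rfl]
      exact integral_comp_eval (X := fun _ : Fin m => E) (μ := fun _ => γ)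
        (f := fun x => momentKernel k x x) hself.aestronglyMeasurable
    · have hmp := measurePreserving_eval_pair (m := m) γ h
      refine ⟨hmp.integrable_comp_of_integrable (integrable_momentKernel k), ?_⟩
      rw [if_neg h, hκ, ← hmp.map_eq, integral_map hmp.measurable.aemeasurable
        hK.aestronglyMeasurable]
  have hcross : ∀ i l, Integrable (fun p : (Fin m → E) × (Fin m → E) =>
      momentKernel k (p.1 i) (p.2 l)) (π.prod π) ∧
      ∫ p : (Fin m → E) × (Fin m → E), momentKernel k (p.1 i) (p.2 l) ∂π.prod π = κ := by
    intro i l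
    have hmp := (measurePreserving_eval (fun _ : Fin m => γ) i).prod
      (measurePreserving_eval (fun _ : Fin m => γ) l)
    refine ⟨hmp.integrable_comp_of_integrable (integrable_momentKernel k), ?_⟩
    rw [hκ, ← hmp.map_eq, integral_map hmp.measurable.aemeasurable hK.aestronglyMeasurable]
    rfl
  have h1 : ∀ i l, Integrable (fun p : (Fin m → E) × (Fin m → E) =>
      momentKernel k (p.1 i) (p.1 l)) (π.prod π) ∧
      ∫ p : (Fin m → E) × (Fin m → E), momentKernel k (p.1 i) (p.1 l) ∂π.prod π =
        if i = l then ρ else κ := fun i l =>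
    ⟨(hsame i l).1.comp_fst π, by
      rw [integral_fun_fst (fun U : Fin m → E => momentKernel k (U i) (U l)), (hsame i l).2]; simp⟩
  have h2 : ∀ i l, Integrable (fun p : (Fin m → E) × (Fin m → E) =>
      momentKernel k (p.2 i) (p.2 l)) (π.prod π) ∧
      ∫ p : (Fin m → E) × (Fin m → E), momentKernel k (p.2 i) (p.2 l) ∂π.prod π =
        if i = l then ρ else κ := fun i l =>
    ⟨(hsame i l).1.comp_snd π, by
      rw [integral_fun_snd (fun U : Fin m → E => momentKernel k (U i) (U l)), (hsame i l).2]; simp⟩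
  have hterm : ∀ i l, Integrable (fun p : (Fin m → E) × (Fin m → E) =>
      momentKernel k (p.1 i) (p.1 l) + momentKernel k (p.2 i) (p.2 l) -
        2 * momentKernel k (p.1 i) (p.2 l)) (π.prod π) := fun i l =>
    ((h1 i l).1.add (h2 i l).1).sub ((hcross i l).1.const_mul 2)
  refine ⟨integrable_finsetSum _ fun i _ => integrable_finsetSum _ fun l _ => hterm i l, ?_⟩
  simp only [discrepancy]
  rw [integral_finsetSum _ fun i _ => integrable_finsetSum _ fun l _ => hterm i l]
  have hval : ∀ i l, ∫ p : (Fin m → E) × (Fin m → E), (momentKernel k (p.1 i) (p.1 l) +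
      momentKernel k (p.2 i) (p.2 l) - 2 * momentKernel k (p.1 i) (p.2 l)) ∂π.prod π =
      if i = l then 2 * ρ - 2 * κ else 0 := by
    intro i l
    have hadd : Integrable (fun p : (Fin m → E) × (Fin m → E) => momentKernel k (p.1 i) (p.1 l) +
      momentKernel k (p.2 i) (p.2 l)) (π.prod π) := (h1 i l).1.add (h2 i l).1
    rw [integral_sub hadd ((hcross i l).1.const_mul 2),
      integral_add (h1 i l).1 (h2 i l).1, integral_const_mul, (h1 i l).2, (h2 i l).2,
      (hcross i l).2]
    split_ifs <;> ring
  have hrow : ∀ i : Fin m, ∫ p : (Fin m → E) × (Fin m → E), ∑ l, (momentKernel k (p.1 i) (p.1 l) +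
      momentKernel k (p.2 i) (p.2 l) - 2 * momentKernel k (p.1 i) (p.2 l)) ∂π.prod π =
      2 * ρ - 2 * κ := by
    intro i
    rw [integral_finsetSum _ fun l _ => hterm i l]
    simp_rw [hval]
    simp
  simp_rw [hrow]
  simp only [Finset.sum_const, Finset.card_univ, Fintype.card_fin, nsmul_eq_mul]
  gcongr
  linarith

end Discrepancy

end TDS

namespace TDS

/-! ### Labels and halfspaces -/

instance : MeasurableSingletonClass ℤˣ where
  measurableSet_singleton u :=
    ⟨{(u : ℤ)}, MeasurableSet.singleton _, by ext w; simp [Units.ext_iff]⟩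

theorem measurable_label : Measurable fun u : ℤˣ => ((u : ℤ) : ℝ) := measurable_of_finite _

theorem label_sq (u : ℤˣ) : ((u : ℤ) : ℝ) ^ 2 = 1 := by
  rcases Int.units_eq_one_or u with h | h <;> simp [h]

theorem measurable_signLabel : Measurable signLabel :=
  Measurable.ite measurableSet_Ici measurable_const measurable_const

theorem signLabel_mul {c : ℝ} (hc : 0 < c) (t : ℝ) : signLabel (c * t) = signLabel t := by
  simp [signLabel, mul_nonneg_iff_of_pos_left hc]

theorem signLabel_label (u : ℤˣ) : signLabel ((u : ℤ) : ℝ) = u := by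
  rcases Int.units_eq_one_or u with h | h <;> simp [h, signLabel]

/-- Both differences have the sign of `-τ`. Points outside the tail `|v·x| ≥ |τ|` therefore share
one label. -/
theorem signLabel_sub_eq_of_sq_lt {s t τ : ℝ} (hs : s ^ 2 < τ ^ 2) (ht : t ^ 2 < τ ^ 2) :
    signLabel (s - τ) = signLabel (t - τ) := by
  rw [sq_lt_sq] at hs ht
  have hs' := abs_lt.1 hs
  have ht' := abs_lt.1 ht
  rcases le_total 0 τ with h | h
  · rw [abs_of_nonneg h] at hs' ht'
    rw [signLabel, signLabel, if_neg (by linarith), if_neg (by linarith)]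
  · rw [abs_of_nonpos h] at hs' ht'
    rw [signLabel, signLabel, if_pos (by linarith), if_pos (by linarith)]

/-- Zero lies between `a` and `b`, so `|b|` is at most their distance. -/
theorem sq_le_sq_sub_of_signLabel_ne {a b : ℝ} (h : signLabel a ≠ signLabel b) :
    b ^ 2 ≤ (b - a) ^ 2 := by
  unfold signLabel at h
  split_ifs at h with ha hb hb
  · exact absurd rfl h
  · nlinarith
  · nlinarith
  · exact absurd rfl h

variable {d m : ℕ}

local notation "E" => EuclideanSpace ℝ (Fin d)

theorem measurable_halfspace (v : E) (τ : ℝ) : Measurable (halfspace v τ) :=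
  measurable_signLabel.comp (by fun_prop)

theorem halfspace_smul {c : ℝ} (hc : 0 < c) (v : E) (τ : ℝ) :
    halfspace (c • v) (c * τ) = halfspace v τ := by
  ext x
  rw [halfspace, halfspace, inner_smul_left, RCLike.conj_to_real, ← mul_sub, signLabel_mul hc]

theorem halfspace_zero (τ : ℝ) (x : E) : halfspace (0 : E) τ x = signLabel (-τ) := by
  simp [halfspace]

/-- Every halfspace is constant or has a unit normal vector. -/
theorem generalHalfspaces_cases {f : E → ℤˣ} (hf : f ∈ generalHalfspaces d) :
    (∃ c, f = fun _ => c) ∨ ∃ (v : E) (τ : ℝ), ‖v‖ = 1 ∧ f = halfspace v τ := by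
  obtain ⟨v, τ, rfl⟩ := hf
  by_cases hv : v = 0
  · subst hv
    exact Or.inl ⟨signLabel (-τ), funext fun x => halfspace_zero τ x⟩
  · have hn : 0 < ‖v‖ := norm_pos_iff.2 hv
    refine Or.inr ⟨‖v‖⁻¹ • v, ‖v‖⁻¹ * τ, by rw [norm_smul, norm_inv, norm_norm,
      inv_mul_cancel₀ hn.ne'], (halfspace_smul (inv_pos.2 hn) v τ).symm⟩

/-- The disagreement of two hypotheses lies in the strip around the approximate one. -/
theorem mem_strip_of_ne {w w' x : E} {θ θ' : ℝ} (hw : ‖w' - w‖ ^ 2 ≤ 1000000 * (d * d * m))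
    (hθ : (θ' - θ) ^ 2 ≤ 1000000 * (d * d * m)) (h : halfspace w θ x ≠ halfspace w' θ' x) :
    x ∈ strip m w' θ' := by
  have h1 := sq_le_sq_sub_of_signLabel_ne h
  have e : (inner ℝ w' x - θ') - (inner ℝ w x - θ) = inner ℝ (w' - w) x - (θ' - θ) := by
    rw [inner_sub_left]; ring
  rw [e] at h1
  have h2 : (inner ℝ (w' - w) x) ^ 2 ≤ ‖w' - w‖ ^ 2 * ‖x‖ ^ 2 := by
    rw [← mul_pow, sq_le_sq, abs_of_nonneg (by positivity : 0 ≤ ‖w' - w‖ * ‖x‖)]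
    exact abs_real_inner_le_norm _ _
  have h3 : ‖w' - w‖ ^ 2 * ‖x‖ ^ 2 ≤ 1000000 * (d * d * m) * ‖x‖ ^ 2 := by gcongr
  show (inner ℝ w' x - θ') ^ 2 ≤ 2000000 * (d * d * m) * (‖x‖ ^ 2 + 1)
  -- `(a - b)² ≤ 2a² + 2b²` turns the two errors `10^6` into the `2·10^6` of the strip.
  nlinarith [sq_nonneg (inner ℝ (w' - w) x + (θ' - θ))]

/-! ### Statistics of the training sample -/

section Train

variable {train : Measure (EuclideanSpace ℝ (Fin d) × ℤˣ)}

/-- The expectation of `y x`. -/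
def chowMean (train : Measure (E × ℤˣ)) : E :=
  WithLp.toLp 2 fun j => ∫ p, ((p.2 : ℤ) : ℝ) * p.1 j ∂train

/-- The expectation of `y (‖x‖² - d)`. -/
def biasMean (train : Measure (E × ℤˣ)) : ℝ :=
  ∫ p, ((p.2 : ℤ) : ℝ) * (‖p.1‖ ^ 2 - d) ∂train

theorem integrable_comp_fst (hfst : train.fst = stdGaussian E) {g : E → ℝ}
    (hg : Integrable g (stdGaussian E)) : Integrable (fun p => g p.1) train := by
  rw [← hfst] at hg
  exact hg.comp_measurable measurable_fst

theorem integral_comp_fst (hfst : train.fst = stdGaussian E) {g : E → ℝ} (hg : Measurable g) :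
    ∫ p, g p.1 ∂train = ∫ x, g x ∂stdGaussian E := by
  rw [← hfst, Measure.fst, integral_map measurable_fst.aemeasurable hg.aestronglyMeasurable]

theorem memLp_label_mul (hfst : train.fst = stdGaussian E) {g : E → ℝ} (hgm : Measurable g)
    (hg : Integrable (fun x => g x ^ 2) (stdGaussian E)) :
    MemLp (fun p : E × ℤˣ => ((p.2 : ℤ) : ℝ) * g p.1) 2 train := by
  have hm : Measurable fun p : E × ℤˣ => ((p.2 : ℤ) : ℝ) * g p.1 :=
    (measurable_label.comp measurable_snd).mul (hgm.comp measurable_fst)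
  rw [memLp_two_iff_integrable_sq hm.aestronglyMeasurable]
  simp only [mul_pow, label_sq, one_mul]
  exact integrable_comp_fst hfst hg

theorem integral_label_mul_sq (hfst : train.fst = stdGaussian E) {g : E → ℝ} (hgm : Measurable g) :
    ∫ p : E × ℤˣ, (((p.2 : ℤ) : ℝ) * g p.1) ^ 2 ∂train = ∫ x, g x ^ 2 ∂stdGaussian E := by
  simp only [mul_pow, label_sq, one_mul]
  exact integral_comp_fst hfst (hgm.pow_const 2)

theorem measurable_chowVector :
    Measurable (chowVector : (Fin m → E × ℤˣ) → E) := by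
  unfold chowVector
  refine Finset.measurable_sum _ fun i _ => ?_
  have h₁ : Measurable fun S : Fin m → E × ℤˣ => (((S i).2 : ℤ) : ℝ) :=
    measurable_label.comp (measurable_snd.comp (measurable_pi_apply i))
  have h₂ : Measurable fun S : Fin m → E × ℤˣ => (S i).1 :=
    measurable_fst.comp (measurable_pi_apply i)
  exact h₁.smul h₂

theorem measurable_chowBias :
    Measurable (chowBias : (Fin m → E × ℤˣ) → ℝ) := by
  unfold chowBias
  refine Finset.measurable_sum _ fun i _ => Measurable.mul ?_ ?_
  · exact measurable_label.comp (measurable_snd.comp (measurable_pi_apply i))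
  · exact ((measurable_fst.comp (measurable_pi_apply i)).norm.pow_const 2).sub_const _

theorem chowVector_apply (S : Fin m → E × ℤˣ) (j : Fin d) :
    chowVector S j = ∑ i, (((S i).2 : ℤ) : ℝ) * (S i).1 j := by
  rw [chowVector, WithLp.ofLp_sum, Finset.sum_apply]
  rfl

theorem integrable_coord_sq (j : Fin d) :
    Integrable (fun x : E => x j ^ 2) (stdGaussian E) := by
  refine (integrable_norm_pow_stdGaussian 2).mono (by fun_prop) (ae_of_all _ fun x => ?_)
  simp only [norm_pow, Real.norm_eq_abs, abs_norm, sq_abs]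
  rw [EuclideanSpace.real_norm_sq_eq]
  exact Finset.single_le_sum (f := fun i => x i ^ 2) (fun i _ => sq_nonneg _) (Finset.mem_univ j)

/-- Labels square to one, so only Gaussian moments enter: the summed coordinate variances are at
most `m E‖x‖² ≤ 12dm`, and Markov's inequality applies. -/
theorem measure_chowVector_le [IsProbabilityMeasure train]
    (hfst : train.fst = stdGaussian E) (hd : 0 < d) (hm : 0 < m) :
    (Measure.pi fun _ : Fin m => train) {S | 1000000 * (d * d * m : ℝ) ≤
      ‖chowVector S - (m : ℝ) • chowMean train‖ ^ 2} ≤ ENNReal.ofReal (1 / 1000) := by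
  have hd' : (1 : ℝ) ≤ d := by exact_mod_cast hd
  have hm' : (0 : ℝ) < m := by exact_mod_cast hm
  have hmem : ∀ j : Fin d, MemLp (fun p : E × ℤˣ => ((p.2 : ℤ) : ℝ) * p.1 j) 2 train :=
    fun j => memLp_label_mul hfst (g := fun x => x j) (by fun_prop) (integrable_coord_sq j)
  have hexp : ∀ S : Fin m → E × ℤˣ, ‖chowVector S - (m : ℝ) • chowMean train‖ ^ 2 =
      ∑ j, (∑ i, (((S i).2 : ℤ) : ℝ) * (S i).1 j -
        m * ∫ p, ((p.2 : ℤ) : ℝ) * p.1 j ∂train) ^ 2 := by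
    intro S
    rw [EuclideanSpace.real_norm_sq_eq]
    refine Finset.sum_congr rfl fun j _ => ?_
    rw [PiLp.sub_apply, chowVector_apply]
    rfl
  have hint : ∀ j : Fin d, Integrable (fun S : Fin m → E × ℤˣ =>
      (∑ i, (((S i).2 : ℤ) : ℝ) * (S i).1 j - m * ∫ p, ((p.2 : ℤ) : ℝ) * p.1 j ∂train) ^ 2)
      (Measure.pi fun _ => train) := fun j => (memLp_sum_pi (hmem j)).integrable_sq
  refine measure_le_of_integral_le (fun _ => sq_nonneg _) ?_ (by positivity) ?_
  · simp_rw [hexp]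
    exact integrable_finsetSum _ fun j _ => hint j
  · simp_rw [hexp]
    rw [integral_finsetSum _ fun j _ => hint j]
    calc _ ≤ ∑ j : Fin d, m * ∫ x : E, x j ^ 2 ∂stdGaussian E := by
          refine Finset.sum_le_sum fun j _ => (integral_sum_sub_sq_le (hmem j)).trans (le_of_eq ?_)
          rw [integral_label_mul_sq hfst (g := fun x => x j) (by fun_prop)]
      _ = m * ∫ x : E, ‖x‖ ^ (2 * 1) ∂stdGaussian E := by
          rw [← Finset.mul_sum, ← integral_finsetSum _ fun j _ => integrable_coord_sq j]
          simp_rw [mul_one, EuclideanSpace.real_norm_sq_eq]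
      _ ≤ m * (d ^ 1 * (2 * (6 * (1 : ℕ)) ^ 1)) := by
          gcongr
          exact integral_norm_pow_stdGaussian_le 1 one_pos
      _ ≤ _ := by
          push_cast
          nlinarith [mul_le_mul_of_nonneg_left hd' (by positivity : (0 : ℝ) ≤ m * d)]

/-- Chebyshev with `E(‖x‖² - d)² ≤ 289 d²`. This is where a threshold quadratic in `d` is needed;
the bound for the vector uses the same threshold for uniformity. -/
theorem measure_chowBias_le [IsProbabilityMeasure train]
    (hfst : train.fst = stdGaussian E) (hd : 0 < d) (hm : 0 < m) :
    (Measure.pi fun _ : Fin m => train) {S | 1000000 * (d * d * m : ℝ) ≤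
      (chowBias S - m * biasMean train) ^ 2} ≤ ENNReal.ofReal (1 / 1000) := by
  have hd' : (0 : ℝ) < d := by exact_mod_cast hd
  have hm' : (0 : ℝ) < m := by exact_mod_cast hm
  have h4 := integrable_norm_pow_stdGaussian (d := d) 4
  have hle : ∀ x : E, (‖x‖ ^ 2 - d) ^ 2 ≤ ‖x‖ ^ (2 * 2) + d ^ 2 := by
    intro x
    rw [pow_mul]
    nlinarith [mul_nonneg (sq_nonneg ‖x‖) hd'.le]
  have hi : Integrable (fun x : E => (‖x‖ ^ 2 - d) ^ 2) (stdGaussian E) := by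
    refine (h4.add (integrable_const ((d : ℝ) ^ 2))).mono
      (Measurable.aestronglyMeasurable (by fun_prop)) (ae_of_all _ fun x => ?_)
    rw [Real.norm_of_nonneg (sq_nonneg _)]
    exact (hle x).trans (le_abs_self _)
  have hmem : MemLp (fun p : E × ℤˣ => ((p.2 : ℤ) : ℝ) * (‖p.1‖ ^ 2 - d)) 2 train :=
    memLp_label_mul hfst (g := fun x => ‖x‖ ^ 2 - d) (by fun_prop) hi
  refine measure_sum_sub_le hmem (by positivity) ?_
  rw [integral_label_mul_sq hfst (g := fun x => ‖x‖ ^ 2 - d) (by fun_prop)]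
  have hadd : Integrable (fun x : E => ‖x‖ ^ (2 * 2) + (d : ℝ) ^ 2) (stdGaussian E) :=
    h4.add (integrable_const _)
  calc _ ≤ m * ∫ x : E, (‖x‖ ^ (2 * 2) + (d : ℝ) ^ 2) ∂stdGaussian E :=
        mul_le_mul_of_nonneg_left (integral_mono hi hadd hle) hm'.le
    _ = m * (∫ x : E, ‖x‖ ^ (2 * 2) ∂stdGaussian E + (d : ℝ) ^ 2) := by
        rw [integral_add h4 (integrable_const _)]
        simp
    _ ≤ m * (d ^ 2 * (2 * (6 * (2 : ℕ)) ^ 2) + (d : ℝ) ^ 2) := by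
        gcongr
        exact integral_norm_pow_stdGaussian_le 2 two_pos
    _ ≤ _ := by
        push_cast
        nlinarith [mul_pos (mul_pos hd' hd') hm']

theorem measure_inner_pow_le [IsProbabilityMeasure train]
    (hfst : train.fst = stdGaussian E) (hm : 0 < m) {v : E}
    (hv : ‖v‖ = 1) {k : ℕ} (hk : 0 < k) :
    (Measure.pi fun _ : Fin m => train) {S | 2000 * (m * (6 * k : ℝ) ^ k) ≤
      ∑ i, (inner ℝ v (S i).1) ^ (2 * k)} ≤ ENNReal.ofReal (1 / 1000) := by
  have hm' : (0 : ℝ) < m := by exact_mod_cast hm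
  have hi := integrable_comp_fst hfst (integrable_inner_pow_stdGaussian v (2 * k))
  refine measure_le_of_integral_le (fun S => Finset.sum_nonneg fun i _ => ?_) ?_
    (by positivity) ?_
  · rw [pow_mul]; positivity
  · exact integrable_finsetSum _ fun i _ => (measurePreserving_eval
      (fun _ : Fin m => train) i).integrable_comp_of_integrable hi
  · rw [integral_sum_pi (h := fun p : E × ℤˣ => (inner ℝ v p.1 : ℝ) ^ (2 * k)) hi,
      integral_comp_fst hfst (g := fun x => (inner ℝ v x : ℝ) ^ (2 * k)) (by fun_prop)]
    have := mul_le_mul_of_nonneg_left (integral_inner_pow_stdGaussian_le hv k hk) hm'.le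
    linarith

theorem measure_inner_sq_le [IsProbabilityMeasure train] (hfst : train.fst = stdGaussian E) {v : E}
    (hv : ‖v‖ = 1) {c : ℝ} (hc : 384 ≤ c) (i : Fin m) :
    (Measure.pi fun _ : Fin m => train) {S | c ≤ (inner ℝ v (S i).1) ^ 2} ≤
      ENNReal.ofReal (1 / 384) := by
  have hi := integrable_comp_fst hfst (integrable_inner_pow_stdGaussian v 2)
  refine measure_le_of_integral_le (fun S => sq_nonneg _) ((measurePreserving_eval
      (fun _ : Fin m => train) i).integrable_comp_of_integrable hi) (by linarith) ?_
  rw [integral_comp_eval (X := fun _ : Fin m => E × ℤˣ) (μ := fun _ => train)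
    (f := fun p : E × ℤˣ => (inner ℝ v p.1 : ℝ) ^ 2) hi.aestronglyMeasurable,
    integral_comp_fst hfst (g := fun x => (inner ℝ v x : ℝ) ^ 2) (by fun_prop)]
  have : ∫ x : E, (inner ℝ v x) ^ 2 ∂stdGaussian E = 1 := by
    rw [← integral_sq_gaussianReal, ← map_inner_stdGaussian hv,
      integral_map (by fun_prop) (by fun_prop)]
  rw [this]
  linarith

theorem ae_label_eq {f : E → ℤˣ} (h : err f train = 0) :
    ∀ᵐ p ∂train, p.2 = f p.1 := by
  rw [ae_iff]
  exact h

theorem integral_label_mul {f : E → ℤˣ} (hf : Measurable f) (hfst : train.fst = stdGaussian E)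
    (h : err f train = 0) {g : E → ℝ} (hg : Measurable g) :
    ∫ p : E × ℤˣ, ((p.2 : ℤ) : ℝ) * g p.1 ∂train =
      ∫ x, ((f x : ℤ) : ℝ) * g x ∂stdGaussian E := by
  rw [← integral_comp_fst hfst (g := fun x => ((f x : ℤ) : ℝ) * g x)
    ((measurable_label.comp hf).mul hg)]
  refine integral_congr_ae ((ae_label_eq h).mono fun p hp => ?_)
  simp only [hp]

theorem inner_single_eq (x : E) (j : Fin d) :
    inner ℝ (EuclideanSpace.single j (1 : ℝ)) x = x j := by
  simp [EuclideanSpace.inner_single_left]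

/-- Coordinate `j` is the Gaussian integral of the sign against `⟨e_j, x⟩`, namely `⟨e_j, v⟩ ·
2φ(τ)`. -/
theorem chowMean_eq (hfst : train.fst = stdGaussian E) {v : E} (hv : ‖v‖ = 1) {τ : ℝ}
    (h : err (halfspace v τ) train = 0) :
    chowMean train = (2 * gaussianPDFReal 0 1 τ) • v := by
  ext j
  have h1 := integral_label_mul (measurable_halfspace v τ) hfst h (g := fun x => x j)
    (by fun_prop)
  have h2 := integral_mul_inner_stdGaussian (measurable_realSign τ)
    (fun t => (abs_realSign τ t).le) hv (EuclideanSpace.single j (1 : ℝ))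
  simp only [inner_single_eq] at h2
  rw [integral_realSign_mul_id] at h2
  have h3 : chowMean train j = ∫ p, ((p.2 : ℤ) : ℝ) * p.1 j ∂train := rfl
  rw [h3, h1, PiLp.smul_apply, smul_eq_mul, mul_comm, ← h2]
  rfl

theorem biasMean_eq (hfst : train.fst = stdGaussian E) {v : E} (hv : ‖v‖ = 1) {τ : ℝ}
    (h : err (halfspace v τ) train = 0) :
    biasMean train = 2 * gaussianPDFReal 0 1 τ * τ := by
  rw [biasMean, integral_label_mul (measurable_halfspace v τ) hfst h
    (g := fun x => ‖x‖ ^ 2 - d) (by fun_prop), ← integral_realSign_mul_sq_sub_one,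
    ← integral_mul_norm_sq_sub_stdGaussian (measurable_realSign τ)
    (fun t => (abs_realSign τ t).le) hv]
  rfl

theorem chowMean_eq_zero (hfst : train.fst = stdGaussian E) {c : ℤˣ}
    (h : err (fun _ => c) train = 0) : chowMean train = 0 := by
  ext j
  have h1 := integral_label_mul (f := fun _ => c) measurable_const hfst h (g := fun x => x j)
    (by fun_prop)
  have h2 : ∫ x : E, x j ∂stdGaussian E = 0 := by
    have := integral_strongDual_stdGaussian
      (innerSL ℝ (EuclideanSpace.single j (1 : ℝ)))
    simpa [inner_single_eq] using this
  have h3 : chowMean train j = ∫ p, ((p.2 : ℤ) : ℝ) * p.1 j ∂train := rfl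
  rw [h3, h1, integral_const_mul, h2, mul_zero]
  rfl

end Train

end TDS

/-! ### Thresholds and sample size conditions -/

namespace TDS

theorem six_le_order (ε : ℝ) : 6 ≤ order ε := Nat.le_add_right _ _

theorem lt_two_pow_order_mul {ε : ℝ} (hε : 0 < ε) : 64 < (2 : ℝ) ^ order ε * ε := by
  have := one_lt_two_pow_sInf_mul hε
  rw [order, pow_add]
  linarith

/-- Minimality of the exponent: one doubling earlier the product was at most `64`. -/
theorem two_pow_order_mul_le {ε : ℝ} (hε1 : ε < 1) : (2 : ℝ) ^ order ε * ε ≤ 128 := by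
  rcases Nat.eq_zero_or_eq_succ_pred (sInf {j : ℕ | 1 < (2 : ℝ) ^ j * ε}) with h | h
  · rw [order, h]
    norm_num
    linarith
  · have h1 : ¬ 1 < (2 : ℝ) ^ (sInf {j : ℕ | 1 < (2 : ℝ) ^ j * ε}).pred * ε :=
      Nat.notMem_of_lt_sInf (s := {j : ℕ | 1 < (2 : ℝ) ^ j * ε}) (by omega)
    rw [order, h, pow_add, Nat.succ_eq_add_one, pow_succ _ (Nat.pred _)]
    linarith

/-- If `τ² < 64k`, then `φ(τ) ≥ e^(-32k)/3 ≥ 3^(-32k)/3`, which exceeds `2^(-64k) = 4^(-32k)`. -/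
theorem le_sq_of_gaussianPDFReal_le {k : ℕ} (hk : 0 < k) {τ : ℝ}
    (h : gaussianPDFReal 0 1 τ ≤ (1 / 2) ^ (64 * k)) : 64 * k ≤ τ ^ 2 := by
  by_contra! hlt
  have hπ : √(2 * Real.pi * (1 : NNReal)) ≤ 3 := by
    rw [Real.sqrt_le_left (by norm_num)]
    have := Real.pi_lt_d2
    push_cast
    linarith
  have hπ0 : 0 < √(2 * Real.pi * (1 : NNReal)) := by
    have := Real.pi_pos
    apply Real.sqrt_pos.2
    push_cast
    linarith
  have h1 : (1 / 3 : ℝ) ^ (32 * k) ≤ Real.exp (-(τ - 0) ^ 2 / (2 * (1 : NNReal))) := by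
    have e3 : Real.exp 1 ≤ 3 := Real.exp_one_lt_d9.le.trans (by norm_num)
    calc (1 / 3 : ℝ) ^ (32 * k) ≤ (Real.exp (-1)) ^ (32 * k) := by
          gcongr
          rw [Real.exp_neg, one_div]
          exact inv_anti₀ (Real.exp_pos _) e3
      _ = Real.exp (-(32 * k)) := by rw [← Real.exp_nat_mul]; push_cast; ring_nf
      _ ≤ _ := by
          apply Real.exp_le_exp.2
          push_cast
          linarith
  have h2 : (1 / 3 : ℝ) * (1 / 3) ^ (32 * k) ≤ (1 / 4) ^ (32 * k) := by
    calc _ ≤ gaussianPDFReal 0 1 τ := by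
          rw [gaussianPDFReal]
          gcongr
          rw [one_div]
          exact inv_anti₀ hπ0 hπ
      _ ≤ (1 / 2) ^ (64 * k) := h
      _ = _ := by rw [show 64 * k = 2 * (32 * k) by ring, pow_mul]; norm_num
  have h3 : (1 / 4 : ℝ) ^ (32 * k) = (3 / 4) ^ (32 * k) * (1 / 3) ^ (32 * k) := by
    rw [← mul_pow]; norm_num
  rw [h3] at h2
  have h4 := le_of_mul_le_mul_right h2 (by positivity)
  -- `(3/4)^4 = 81/256` is already below `1/3`.
  have h5 : (3 / 4 : ℝ) ^ (32 * k) ≤ (3 / 4) ^ 4 :=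
    pow_le_pow_of_le_one (by norm_num) (by norm_num) (by omega)
  norm_num at h5
  linarith

theorem measure_le_of_hits_le {X : Type*} [MeasurableSpace X] {ν : Measure X}
    [IsProbabilityMeasure ν] {m : ℕ} (hm : 0 < m) {D : Set X} {T : Fin m → X} {ε : ℝ}
    (hε : 0 < ε) (h1 : hits D T ≤ ε * m / 2)
    (h2 : (hits D T - m * ν.real D) ^ 2 < (ε * m / 2) ^ 2) : ν D ≤ ENNReal.ofReal ε := by
  have hm' : (0 : ℝ) < m := by exact_mod_cast hm
  have h3 := (abs_lt.1 (sq_lt_sq.1 h2)).1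
  rw [abs_of_pos (by positivity)] at h3
  rw [← ofReal_measureReal]
  refine ENNReal.ofReal_le_ofReal (le_of_mul_le_mul_left ?_ hm')
  linarith

theorem prod_fst_preimage {Ω Y : Type*} [MeasurableSpace Ω] [MeasurableSpace Y] (P : Measure Ω)
    (Q : Measure Y) [IsProbabilityMeasure Q] [SFinite P] (B : Set Ω) :
    (P.prod Q) (Prod.fst ⁻¹' B) = P B := by
  rw [← Set.prod_univ, Measure.prod_prod, measure_univ, mul_one]

/-- Test labels equal `f` almost surely, so errors of `h` are disagreements with `f`, an event about
unlabelled points. -/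
theorem err_le_of_err_eq_zero {X : Type*} [MeasurableSpace X] {test : Measure (X × ℤˣ)}
    {f h : X → ℤˣ} (hf : Measurable f) (hh : Measurable h) (h0 : err f test = 0) :
    err h test ≤ test.fst {x | f x ≠ h x} := by
  have hm : MeasurableSet {x | f x ≠ h x} := (measurableSet_eq_fun hf hh).compl
  rw [Measure.fst_apply hm]
  refine (measure_mono (t := {p | p.2 ≠ f p.1} ∪ Prod.fst ⁻¹' {x | f x ≠ h x})
    fun p hp => ?_).trans ((measure_union_le _ _).trans ?_)
  · by_cases h1 : p.2 = f p.1
    · exact Or.inr fun h2 => hp (h1.trans h2)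
    · exact Or.inl h1
  · rw [show test {p | p.2 ≠ f p.1} = 0 from h0, zero_add]

section Learner

variable {d m : ℕ}

local notation "E" => EuclideanSpace ℝ (Fin d)

theorem stripCount_eq_hits (w : E) (θ : ℝ) (T : Fin m → E) :
    stripCount w θ T = hits (strip m w θ) T := rfl

theorem halfspace_firstLabel (S : Fin m → E × ℤˣ) (hm : 0 < m) (x : E) :
    halfspace 0 (-firstLabel S) x = (S ⟨0, hm⟩).2 := by
  rw [halfspace_zero, neg_neg, firstLabel, padded, dif_pos hm, signLabel_label]

theorem learner_eq_some {ε : ℝ} {S : Fin m → E × ℤˣ} {T : Fin m → E} {h : E → ℤˣ}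
    (hl : learner ε S T = some h) :
    (2 * stripCount (chowVector S) (chowBias S) T ≤ ε * m ∧
      h = halfspace (chowVector S) (chowBias S) ∧
      (1 / 2) ^ (128 * order ε) * (m : ℝ) ^ 2 ≤ ‖chowVector S‖ ^ 2) ∨
    (‖chowVector S‖ ^ 2 < (1 / 2) ^ (128 * order ε) * (m : ℝ) ^ 2 ∧
      discrepancy (order ε) (fun i => (S i).1) T ≤ (m : ℝ) ^ 2 ∧
      h = halfspace 0 (-firstLabel S)) := by
  unfold learner at hl
  split_ifs at hl with h1 h2 h2
  · exact Or.inl ⟨h2, (Option.some.inj hl).symm, h1⟩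
  · exact Or.inr ⟨not_le.1 h1, h2, (Option.some.inj hl).symm⟩

theorem measurable_halfspace_chow : Measurable fun p : (Fin m → E × ℤˣ) × E =>
    halfspace (chowVector p.1) (chowBias p.1) p.2 := by
  refine measurable_signLabel.comp (Measurable.sub ?_ (measurable_chowBias.comp measurable_fst))
  exact (measurable_chowVector.comp measurable_fst).inner measurable_snd

theorem label_ne_null {train : Measure (E × ℤˣ)} [IsProbabilityMeasure train] {f : E → ℤˣ}
    (h : err f train = 0) (i : Fin m) :
    (Measure.pi fun _ : Fin m => train) {S | (S i).2 ≠ f (S i).1} = 0 :=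
  (measurePreserving_eval (fun _ : Fin m => train) i).quasiMeasurePreserving.preimage_null h

/-- The conditions on the sample size. -/
structure LargeSample (d m : ℕ) (ε : ℝ) : Prop where
  dim_pos : 0 < d
  eps_pos : 0 < ε
  eps_lt : ε < 1
  strip_le : 2 * 10 ^ 18 * (d : ℝ) ^ 3 ≤ m * (1 / 2) ^ (128 * order ε) * ε ^ 3
  moment_le : 4000 * (12 * d : ℝ) ^ (2 * order ε) ≤ m

namespace LargeSample

variable {ε : ℝ} (hL : LargeSample d m ε)

include hL

theorem one_le_dim : (1 : ℝ) ≤ d := by exact_mod_cast hL.dim_pos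

theorem pos : 0 < m := by
  have := hL.one_le_dim
  have h : (0 : ℝ) < m := lt_of_lt_of_le (by positivity) hL.moment_le
  exact_mod_cast h

theorem le_sq_mul : 4000 ≤ ε ^ 2 * m := by
  have h1 := hL.one_le_dim
  have h2 := hL.eps_pos
  have h3 : (1 / 2 : ℝ) ^ (128 * order ε) ≤ 1 := pow_le_one₀ (by norm_num) (by norm_num)
  have h4 : ε ^ 3 ≤ ε ^ 2 := pow_le_pow_of_le_one h2.le hL.eps_lt.le (by norm_num)
  have h5 : (1 : ℝ) ≤ (d : ℝ) ^ 3 := one_le_pow₀ h1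
  calc (4000 : ℝ) ≤ 2 * 10 ^ 18 * (d : ℝ) ^ 3 := by linarith
    _ ≤ m * (1 / 2) ^ (128 * order ε) * ε ^ 3 := hL.strip_le
    _ ≤ m * 1 * ε ^ 2 := by gcongr
    _ = _ := by ring

theorem sq_dim_le : 1000000 * (d * d : ℝ) ≤ m * (1 / 2) ^ (128 * order ε) := by
  have h1 := hL.one_le_dim
  have h2 := hL.eps_pos
  have h4 : ε ^ 3 ≤ 1 := pow_le_one₀ h2.le hL.eps_lt.le
  calc 1000000 * (d * d : ℝ) = 1000000 * (d * d * 1 : ℝ) := by ring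
    _ ≤ 2 * 10 ^ 18 * (d * d * d : ℝ) := by
        gcongr
        norm_num
    _ = 2 * 10 ^ 18 * (d : ℝ) ^ 3 := by ring
    _ ≤ m * (1 / 2) ^ (128 * order ε) * ε ^ 3 := hL.strip_le
    _ ≤ m * (1 / 2) ^ (128 * order ε) * 1 := by gcongr
    _ = _ := by ring

/-- The sampling error of `W` stays below the branching threshold, so the branch reflects the true
size of `φ(τ)` up to a constant. -/
theorem sampling_error_le :
    1000000 * (d * d * m : ℝ) ≤ (1 / 2) ^ (128 * order ε) * (m : ℝ) ^ 2 := by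
  have := mul_le_mul_of_nonneg_right hL.sq_dim_le (Nat.cast_nonneg (α := ℝ) m)
  linarith

theorem hits_condition : (m : ℝ) ≤ 1 / 1000 * (ε * m / 2) ^ 2 := by
  have := mul_le_mul_of_nonneg_right hL.le_sq_mul (Nat.cast_nonneg (α := ℝ) m)
  linarith

theorem hits_pos : 0 < ε * m / 2 := by
  have h1 : (0 : ℝ) < m := by exact_mod_cast hL.pos
  have h2 := hL.eps_pos
  positivity

end LargeSample

end Learner

end TDS

namespace TDS

/-! ### Soundness -/

section Soundness

variable {d m : ℕ} {ε : ℝ}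

local notation "E" => EuclideanSpace ℝ (Fin d)

theorem union_measure_le {Ω : Type*} [MeasurableSpace Ω] {P : Measure Ω} {A B : Set Ω} {a b : ℝ}
    (ha : 0 ≤ a) (hb : 0 ≤ b) (hA : P A ≤ ENNReal.ofReal a) (hB : P B ≤ ENNReal.ofReal b) :
    P (A ∪ B) ≤ ENNReal.ofReal (a + b) := by
  rw [ENNReal.ofReal_add ha hb]
  exact (measure_union_le _ _).trans (add_le_add hA hB)

/-- For a constant target `E[y x] = 0`, so `W` is pure sampling error and misses the threshold with
high probability. The other branch outputs the first label, which is almost surely the right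
constant. -/
theorem soundness_const (hL : LargeSample d m ε) {train test : Measure (E × ℤˣ)}
    [IsProbabilityMeasure train] [IsProbabilityMeasure test] (hfst : train.fst = stdGaussian E)
    {c : ℤˣ} (h₁ : err (fun _ => c) train = 0) (h₂ : err (fun _ => c) test = 0) :
    ((Measure.pi fun _ : Fin m => train).prod (Measure.pi fun _ : Fin m => test.fst))
        {S | ¬ ∀ h, learner ε S.1 S.2 = some h → err h test ≤ ENNReal.ofReal ε} ≤
      ENNReal.ofReal (1 / 100) := by
  have hm := hL.pos
  refine (measure_mono (t := Prod.fst ⁻¹' {S | (S ⟨0, hm⟩).2 ≠ c} ∪ Prod.fst ⁻¹'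
    {S | 1000000 * (d * d * m : ℝ) ≤ ‖chowVector S - (m : ℝ) • chowMean train‖ ^ 2})
    fun p hp => ?_).trans ((union_measure_le (a := 0) (b := 1 / 1000) le_rfl (by norm_num)
      ?_ ?_).trans (ENNReal.ofReal_le_ofReal (by norm_num)))
  · by_contra hn
    simp only [Set.mem_union, Set.mem_preimage, Set.mem_ofPred_eq, not_or, not_not, not_le] at hn
    refine hp fun h hl => ?_
    rcases learner_eq_some hl with ⟨-, -, h3⟩ | ⟨-, -, rfl⟩
    · have := hL.sampling_error_le
      rw [chowMean_eq_zero hfst h₁, smul_zero, sub_zero] at hn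
      linarith [hn.2]
    · rw [show halfspace (0 : E) (-firstLabel p.1) = fun _ => c from
        funext fun x => (halfspace_firstLabel p.1 hm x).trans hn.1, h₂]
      exact zero_le
  · rw [prod_fst_preimage, label_ne_null (f := fun _ => c) h₁]
    exact zero_le
  · rw [prod_fst_preimage]
    exact measure_chowVector_le hfst hL.dim_pos hm

/-- If the empirical correlations are accurate and the strip is rarely hit, then the hypothesis
with the empirical parameters rarely errs on the test sample. -/
theorem hits_chow_le (hL : LargeSample d m ε) {train : Measure (E × ℤˣ)}
    (hfst : train.fst = stdGaussian E) {v : E} (hv : ‖v‖ = 1) {τ : ℝ}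
    (h₁ : err (halfspace v τ) train = 0) {S : Fin m → E × ℤˣ} {T : Fin m → E}
    (hW : ‖chowVector S - (m : ℝ) • chowMean train‖ ^ 2 < 1000000 * (d * d * m : ℝ))
    (hΘ : (chowBias S - m * biasMean train) ^ 2 < 1000000 * (d * d * m : ℝ))
    (hc : 2 * stripCount (chowVector S) (chowBias S) T ≤ ε * m) :
    hits {x | halfspace v τ x ≠ halfspace (chowVector S) (chowBias S) x} T ≤ ε * m / 2 := by
  have hm' : (0 : ℝ) < m := by exact_mod_cast hL.pos
  have hα : 0 < 2 * gaussianPDFReal 0 1 τ :=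
    mul_pos two_pos (gaussianPDFReal_pos 0 1 τ one_ne_zero)
  -- The expected sums are `(v, τ)` times the positive factor `2mφ(τ)`, so they define the same
  -- halfspace.
  have hw : halfspace v τ = halfspace ((m : ℝ) • chowMean train) (m * biasMean train) := by
    rw [halfspace_smul hm', chowMean_eq hfst hv h₁, biasMean_eq hfst hv h₁, halfspace_smul hα]
  refine (hits_mono (D' := strip m (chowVector S) (chowBias S)) T fun i hi => ?_).trans ?_
  · rw [hw] at hi
    exact mem_strip_of_ne hW.le hΘ.le hi
  · rw [← stripCount_eq_hits]
    linarith

/-- By the triangle inequality `2mφ(τ) ≤ ‖W‖ + error ≤ 2 · 2^(-64k) m`, and a tiny density forces a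
large `|τ|`. -/
theorem order_le_sq_bias (hL : LargeSample d m ε) {train : Measure (E × ℤˣ)}
    (hfst : train.fst = stdGaussian E) {v : E} (hv : ‖v‖ = 1) {τ : ℝ}
    (h₁ : err (halfspace v τ) train = 0) {S : Fin m → E × ℤˣ}
    (hW : ‖chowVector S - (m : ℝ) • chowMean train‖ ^ 2 < 1000000 * (d * d * m : ℝ))
    (hs : ‖chowVector S‖ ^ 2 < (1 / 2) ^ (128 * order ε) * (m : ℝ) ^ 2) :
    64 * (order ε : ℝ) ≤ τ ^ 2 := by
  have hm' : (0 : ℝ) < m := by exact_mod_cast hL.pos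
  have hα := gaussianPDFReal_pos 0 1 τ one_ne_zero
  refine le_sq_of_gaussianPDFReal_le (by have := six_le_order ε; omega) ?_
  have e : (1 / 2 : ℝ) ^ (128 * order ε) * (m : ℝ) ^ 2 = ((1 / 2) ^ (64 * order ε) * m) ^ 2 := by
    rw [mul_pow, ← pow_mul]
    congr 2
    ring
  have hp : 0 ≤ (1 / 2 : ℝ) ^ (64 * order ε) * m := by positivity
  have h2 := hW.trans_le hL.sampling_error_le
  rw [e] at h2 hs
  have h3 := lt_of_pow_lt_pow_left₀ 2 hp h2
  have h4 := lt_of_pow_lt_pow_left₀ 2 hp hs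
  have h5 : ‖(m : ℝ) • chowMean train‖ = m * (2 * gaussianPDFReal 0 1 τ) := by
    rw [chowMean_eq hfst hv h₁, norm_smul, norm_smul, hv, mul_one, Real.norm_of_nonneg hm'.le,
      Real.norm_of_nonneg (by positivity)]
  have h6 := norm_sub_norm_le ((m : ℝ) • chowMean train) (chowVector S)
  rw [norm_sub_rev, h5] at h6
  refine le_of_mul_le_mul_left ?_ hm'
  linarith

/-- The training moment along `v` is at most `2000 m (6k)^k`, and the passed test transfers this to
the test sample with an extra `k^k m`. Each tail point contributes at least `(64k)^k`, so Markov's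
inequality counts them. -/
theorem hits_tail_le (hL : LargeSample d m ε) {v : E} (hv : ‖v‖ = 1) {τ : ℝ}
    (hτ : 64 * (order ε : ℝ) ≤ τ ^ 2) {U T : Fin m → E}
    (hU : ∑ i, (inner ℝ v (U i)) ^ (2 * order ε) < 2000 * (m * (6 * order ε : ℝ) ^ order ε))
    (hD : discrepancy (order ε) U T ≤ (m : ℝ) ^ 2) :
    hits {x | τ ^ 2 ≤ (inner ℝ v x) ^ 2} T ≤ ε * m / 2 := by
  have hk6 := six_le_order ε
  have hε := lt_two_pow_order_mul hL.eps_pos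
  have hε0 := hL.eps_pos
  set k := order ε with hk
  have hm' : (0 : ℝ) < m := by exact_mod_cast hL.pos
  have hk' : (0 : ℝ) < k := by
    have : 0 < k := by omega
    exact_mod_cast this
  have h1 := sq_sum_sub_sum_inner_pow_le (by omega : 0 < k) U T hv
  have h2 : (k : ℝ) ^ (2 * k) * discrepancy k U T ≤ ((k : ℝ) ^ k * m) ^ 2 := by
    rw [mul_pow, ← pow_mul, mul_comm k 2]
    gcongr
  have h3 := abs_le_of_sq_le_sq' (h1.trans h2) (by positivity)
  have h4 : (k : ℝ) ^ k ≤ (6 * k : ℝ) ^ k := by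
    gcongr
    linarith
  have h5 : ∑ i, (inner ℝ v (T i)) ^ (2 * k) ≤ 2001 * (m * (6 * k : ℝ) ^ k) := by
    have := mul_le_mul_of_nonneg_right h4 hm'.le
    linarith [h3.2]
  have h6 : hits {x | τ ^ 2 ≤ (inner ℝ v x) ^ 2} T * (64 * k : ℝ) ^ k ≤
      ∑ i, (inner ℝ v (T i)) ^ (2 * k) := by
    rw [hits, Finset.sum_mul]
    refine Finset.sum_le_sum fun i _ => ?_
    split_ifs with h
    · rw [one_mul, pow_mul]
      exact pow_le_pow_left₀ (by positivity) (hτ.trans h) k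
    · rw [zero_mul, pow_mul]
      positivity
  have h7 : 2001 * (m * (6 * k : ℝ) ^ k) ≤ ε * m / 2 * (64 * k : ℝ) ^ k := by
    have e1 : (64 * k : ℝ) ^ k = (64 / 6) ^ k * (6 * k : ℝ) ^ k := by
      rw [← mul_pow]
      ring_nf
    -- Of `64/6 ≥ 2 · 5`, the factor `2^k` absorbs `1/ε` and `5^k ≥ 5^6` absorbs the constant; this
    -- is one reason for the summand `6` in `order`.
    have e2 : (4002 : ℝ) ≤ ε * (64 / 6) ^ k := by
      calc (4002 : ℝ) ≤ 64 * 5 ^ 6 := by norm_num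
        _ ≤ (2 ^ k * ε) * 5 ^ k := by
          gcongr
          norm_num
        _ = ε * (2 * 5) ^ k := by rw [mul_pow]; ring
        _ ≤ _ := by
          gcongr
          norm_num
    rw [e1]
    have := mul_le_mul_of_nonneg_right e2 (by positivity : 0 ≤ (m * (6 * k : ℝ) ^ k))
    linarith
  exact le_of_mul_le_mul_right (h6.trans (h5.trans h7)) (by positivity)

theorem soundness_unit (hL : LargeSample d m ε) {train test : Measure (E × ℤˣ)}
    [IsProbabilityMeasure train] [IsProbabilityMeasure test] (hfst : train.fst = stdGaussian E)
    {v : E} (hv : ‖v‖ = 1) {τ : ℝ} (h₁ : err (halfspace v τ) train = 0)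
    (h₂ : err (halfspace v τ) test = 0) :
    ((Measure.pi fun _ : Fin m => train).prod (Measure.pi fun _ : Fin m => test.fst))
        {S | ¬ ∀ h, learner ε S.1 S.2 = some h → err h test ≤ ENNReal.ofReal ε} ≤
      ENNReal.ofReal (1 / 100) := by
  have hm := hL.pos
  have hk6 := six_le_order ε
  have hf := measurable_halfspace v τ
  set D₁ : Set ((Fin m → E × ℤˣ) × E) :=
    {p | halfspace v τ p.2 ≠ halfspace (chowVector p.1) (chowBias p.1) p.2} with hD₁
  set D₂ : Set ((Fin m → E × ℤˣ) × E) := {p | τ ^ 2 ≤ (inner ℝ v p.2) ^ 2} with hD₂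
  have hD₁m : MeasurableSet D₁ :=
    (measurableSet_eq_fun (hf.comp measurable_snd) measurable_halfspace_chow).compl
  have hD₂m : MeasurableSet D₂ := measurableSet_le measurable_const (by fun_prop)
  have hc : 0 < (ε * m / 2) ^ 2 := pow_pos hL.hits_pos 2
  refine (measure_mono (t := Prod.fst ⁻¹' {S | (S ⟨0, hm⟩).2 ≠ halfspace v τ (S ⟨0, hm⟩).1} ∪
    (Prod.fst ⁻¹' {S | 1000000 * (d * d * m : ℝ) ≤
      ‖chowVector S - (m : ℝ) • chowMean train‖ ^ 2} ∪
    (Prod.fst ⁻¹' {S | 1000000 * (d * d * m : ℝ) ≤ (chowBias S - m * biasMean train) ^ 2} ∪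
    (Prod.fst ⁻¹' {S | 2000 * (m * (6 * order ε : ℝ) ^ order ε) ≤
      ∑ i, (inner ℝ v (S i).1) ^ (2 * order ε)} ∪
    -- The maximum makes this event unlikely for every `τ`. In the branch that uses it, `τ² ≥ 64 · 6
    -- = 384`, so the maximum is `τ²`.
    (Prod.fst ⁻¹' {S | max (τ ^ 2) 384 ≤ (inner ℝ v (S ⟨0, hm⟩).1) ^ 2} ∪
    ({p | (ε * m / 2) ^ 2 ≤
      (hits (Prod.mk p.1 ⁻¹' D₁) p.2 - m * test.fst.real (Prod.mk p.1 ⁻¹' D₁)) ^ 2} ∪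
    {p | (ε * m / 2) ^ 2 ≤
      (hits (Prod.mk p.1 ⁻¹' D₂) p.2 - m * test.fst.real (Prod.mk p.1 ⁻¹' D₂)) ^ 2}))))))
    fun p hp => ?_).trans ((union_measure_le (a := 0) le_rfl ?_ ?_
      (union_measure_le (a := 1 / 1000) ?_ ?_ ?_
      (union_measure_le (a := 1 / 1000) ?_ ?_ ?_
      (union_measure_le (a := 1 / 1000) ?_ ?_ ?_
      (union_measure_le (a := 1 / 384) ?_ ?_ ?_
      (union_measure_le (a := 1 / 1000) (b := 1 / 1000) ?_ ?_ ?_ ?_)))))).trans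
        (ENNReal.ofReal_le_ofReal (by norm_num)))
  · by_contra hn
    simp only [Set.mem_union, Set.mem_preimage, Set.mem_ofPred_eq, not_or, not_not, not_le] at hn
    obtain ⟨n0, n1, n2, n3, n4, n5, n6⟩ := hn
    refine hp fun h hl => ?_
    rcases learner_eq_some hl with ⟨hc, rfl, -⟩ | ⟨hs, hc, rfl⟩
    · exact (err_le_of_err_eq_zero hf (measurable_halfspace _ _) h₂).trans
        (measure_le_of_hits_le hm hL.eps_pos (hits_chow_le hL hfst hv h₁ n1 n2 hc) n5)
    · have hτ := order_le_sq_bias hL hfst hv h₁ n1 hs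
      have hτ' : 384 ≤ τ ^ 2 := by
        have : (6 : ℝ) ≤ order ε := by exact_mod_cast hk6
        linarith
      rw [max_eq_left hτ'] at n4
      refine (err_le_of_err_eq_zero hf (measurable_halfspace _ _) h₂).trans
        ((measure_mono fun x hx => ?_).trans
          (measure_le_of_hits_le hm hL.eps_pos (hits_tail_le hL hv hτ n3 hc) n6))
      by_contra hx'
      refine hx ?_
      -- The first training point and `x` both lie outside the tail, so the target agrees on them.
      rw [halfspace_firstLabel p.1 hm, n0]
      exact signLabel_sub_eq_of_sq_lt (not_le.1 hx') n4
  · norm_num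
  · rw [prod_fst_preimage, label_ne_null h₁]
    exact zero_le
  · norm_num
  · norm_num
  · rw [prod_fst_preimage]
    exact measure_chowVector_le hfst hL.dim_pos hm
  · norm_num
  · norm_num
  · rw [prod_fst_preimage]
    exact measure_chowBias_le hfst hL.dim_pos hm
  · norm_num
  · norm_num
  · rw [prod_fst_preimage]
    exact measure_inner_pow_le hfst hm hv (by omega)
  · norm_num
  · norm_num
  · rw [prod_fst_preimage]
    exact measure_inner_sq_le hfst hv (le_max_right _ _) _
  · norm_num
  · norm_num
  · exact measure_prod_hits_sub_le hD₁m hc hL.hits_condition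
  · exact measure_prod_hits_sub_le hD₂m hc hL.hits_condition

end Soundness

end TDS

namespace TDS

/-! ### Completeness -/

section Completeness

variable {d m : ℕ} {ε : ℝ}

local notation "E" => EuclideanSpace ℝ (Fin d)

theorem discrepancy_nonneg (hd : 0 < d) {k : ℕ} (hk : 0 < k) (U T : Fin m → E) :
    0 ≤ discrepancy k U T := by
  have h := sq_sum_sub_sum_inner_pow_le hk U T
    (v := EuclideanSpace.single (⟨0, hd⟩ : Fin d) (1 : ℝ)) (by simp)
  exact nonneg_of_mul_nonneg_right ((sq_nonneg _).trans h) (by positivity)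

theorem measure_discrepancy_le (hL : LargeSample d m ε) :
    ((Measure.pi fun _ : Fin m => stdGaussian E).prod (Measure.pi fun _ => stdGaussian E))
      {p | (m : ℝ) ^ 2 ≤ discrepancy (order ε) p.1 p.2} ≤ ENNReal.ofReal (1 / 1000) := by
  have hk : 0 < order ε := by have := six_le_order ε; omega
  have hm' : (0 : ℝ) < m := by exact_mod_cast hL.pos
  obtain ⟨hi, h⟩ := integral_discrepancy_le (d := d) (m := m) hk
  have hM := hL.moment_le
  generalize order ε = k at hk hi h hM
  refine measure_le_of_integral_le
    (f := fun p : (Fin m → E) × (Fin m → E) => discrepancy k p.1 p.2)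
    (fun p => discrepancy_nonneg hL.dim_pos hk p.1 p.2) hi (pow_pos hm' 2) (h.trans ?_)
  have := mul_le_mul_of_nonneg_left hM hm'.le
  linarith

/-- Except with probability `ε/4000`, `‖x‖² < 48000 d/ε` by Markov's inequality. On that event the
strip is contained in a slab of half-width `ε/4000` in direction `w/‖w‖`, of mass at most `ε/4000`
because the density is at most `1/2`. -/
theorem stdGaussian_strip_le (hL : LargeSample d m ε) {w : E}
    (hw : (1 / 2) ^ (128 * order ε) * (m : ℝ) ^ 2 ≤ ‖w‖ ^ 2) (θ : ℝ) :
    (stdGaussian E).real (strip m w θ) ≤ ε / 2000 := by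
  have hm' : (0 : ℝ) < m := by exact_mod_cast hL.pos
  have hε := hL.eps_pos
  have hd := hL.one_le_dim
  have hw0 : 0 < ‖w‖ := by
    have : 0 < ‖w‖ ^ 2 := lt_of_lt_of_le (by positivity) hw
    exact (norm_nonneg w).lt_of_ne fun h => by simp [← h] at this
  have hu : ‖‖w‖⁻¹ • w‖ = 1 := by
    rw [norm_smul, norm_inv, norm_norm, inv_mul_cancel₀ hw0.ne']
  set t := θ / ‖w‖ with ht
  have hsub : strip m w θ ⊆ {x | 48000 * d / ε ≤ ‖x‖ ^ (2 * 1)} ∪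
      (fun x => inner ℝ (‖w‖⁻¹ • w) x) ⁻¹' Set.Icc (t - ε / 4000) (t + ε / 4000) := by
    intro x hx
    by_contra hn
    simp only [Set.mem_union, Set.mem_ofPred_eq, not_or, not_le, mul_one] at hn
    obtain ⟨h1, h2⟩ := hn
    refine h2 ?_
    have h3 : (inner ℝ w x - θ) ^ 2 ≤ (‖w‖ * (ε / 4000)) ^ 2 := by
      have h5 : ‖x‖ ^ 2 + 1 ≤ 49000 * d / ε := by
        have : 1 ≤ 1000 * d / ε := by
          rw [le_div_iff₀ hε]
          linarith [hL.eps_lt]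
        calc ‖x‖ ^ 2 + 1 ≤ 48000 * d / ε + 1000 * d / ε := by linarith
          _ = _ := by ring
      -- The constants multiply to `1.568 · 10^18`, which explains the `2 · 10^18` in `strip_le`.
      have hq : 2000000 * (d * d * m) * (49000 * d / ε) * (16000000 / ε ^ 2) ≤
          (1 / 2) ^ (128 * order ε) * (m : ℝ) ^ 2 := by
        have h6 := mul_le_mul_of_nonneg_right hL.strip_le hm'.le
        have h7 : 2000000 * (d * d * m) * (49000 * d / ε) * (16000000 / ε ^ 2) =
          1568 * 10 ^ 15 * d ^ 3 * m / ε ^ 3 := by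
          field_simp
          norm_num
        rw [h7, div_le_iff₀ (by positivity)]
        have h8 : 0 ≤ (d : ℝ) ^ 3 * m := by positivity
        linarith
      calc (inner ℝ w x - θ) ^ 2 ≤ 2000000 * (d * d * m) * (‖x‖ ^ 2 + 1) := hx
        _ ≤ 2000000 * (d * d * m) * (49000 * d / ε) := by gcongr
        _ = 2000000 * (d * d * m) * (49000 * d / ε) * (16000000 / ε ^ 2) *
            (ε ^ 2 / 16000000) := by field_simp
        _ ≤ ‖w‖ ^ 2 * (ε ^ 2 / 16000000) := by
          gcongr
          exact hq.trans hw
        _ = _ := by ring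
    have h4 := abs_le_of_sq_le_sq' h3 (by positivity)
    simp only [Set.mem_preimage, inner_smul_left, RCLike.conj_to_real, Set.mem_Icc]
    rw [inv_mul_eq_div, ht]
    constructor
    · rw [sub_le_iff_le_add, div_le_iff₀ hw0, add_mul, div_mul_cancel₀ _ hw0.ne']
      linarith
    · rw [div_le_iff₀ hw0, add_mul, div_mul_cancel₀ _ hw0.ne']
      linarith
  have hA : stdGaussian E {x | 48000 * d / ε ≤ ‖x‖ ^ (2 * 1)} ≤ ENNReal.ofReal (ε / 4000) := by
    refine measure_le_of_integral_le (fun x => by positivity)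
      (integrable_norm_pow_stdGaussian (2 * 1)) (by positivity)
      ((integral_norm_pow_stdGaussian_le 1 one_pos).trans (le_of_eq ?_))
    field_simp
    norm_num
  have hB : stdGaussian E ((fun x => inner ℝ (‖w‖⁻¹ • w) x) ⁻¹'
      Set.Icc (t - ε / 4000) (t + ε / 4000)) ≤ ENNReal.ofReal (ε / 4000) := by
    rw [← Measure.map_apply (by fun_prop) measurableSet_Icc, map_inner_stdGaussian hu]
    exact gaussianReal_Icc_le _ _
  have h := (measure_mono hsub).trans
    (union_measure_le (a := ε / 4000) (b := ε / 4000) (by positivity) (by positivity) hA hB)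
  refine ENNReal.toReal_le_of_le_ofReal (by positivity) (h.trans (le_of_eq ?_))
  congr 1
  ring

theorem completeness (hL : LargeSample d m ε) {train test : Measure (E × ℤˣ)}
    [IsProbabilityMeasure train] [IsProbabilityMeasure test] (hfst : train.fst = stdGaussian E)
    (htest : test.fst = train.fst) :
    ((Measure.pi fun _ : Fin m => train).prod (Measure.pi fun _ : Fin m => test.fst))
        {S | ¬ ∃ h, learner ε S.1 S.2 = some h} ≤ ENNReal.ofReal (1 / 100) := by
  rw [htest, hfst]
  have hm' : (0 : ℝ) < m := by exact_mod_cast hL.pos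
  -- The threshold condition is part of `D`, so its section is small for every training sample: it
  -- is empty when `W` is short.
  set D : Set ((Fin m → E × ℤˣ) × E) :=
    {p | (1 / 2) ^ (128 * order ε) * (m : ℝ) ^ 2 ≤ ‖chowVector p.1‖ ^ 2 ∧
      p.2 ∈ strip m (chowVector p.1) (chowBias p.1)} with hD
  have hDm : MeasurableSet D := by
    have h1 : Measurable fun p : (Fin m → E × ℤˣ) × E => chowVector p.1 :=
      measurable_chowVector.comp measurable_fst
    have h2 : Measurable fun p : (Fin m → E × ℤˣ) × E => chowBias p.1 :=
      measurable_chowBias.comp measurable_fst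
    refine (measurableSet_le measurable_const (h1.norm.pow_const 2)).inter
      (measurableSet_le (((h1.inner measurable_snd).sub h2).pow_const 2) ?_)
    exact ((measurable_snd.norm.pow_const 2).add_const 1).const_mul _
  -- Forgetting the training labels leaves two independent Gaussian samples.
  have hpres : MeasurePreserving (Prod.map (fun (S : Fin m → E × ℤˣ) i => (S i).1)
      (id : (Fin m → E) → Fin m → E))
      ((Measure.pi fun _ => train).prod (Measure.pi fun _ => stdGaussian E))
      ((Measure.pi fun _ => stdGaussian E).prod (Measure.pi fun _ => stdGaussian E)) := by
    refine MeasurePreserving.prod (measurePreserving_pi _ _ fun _ => ⟨measurable_fst, hfst⟩)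
      (MeasurePreserving.id _)
  refine (measure_mono (t := Prod.map (fun (S : Fin m → E × ℤˣ) i => (S i).1) id ⁻¹'
    {p | (m : ℝ) ^ 2 ≤ discrepancy (order ε) p.1 p.2} ∪
    {p | ε * m / 2 ≤ hits (Prod.mk p.1 ⁻¹' D) p.2}) fun p hp => ?_).trans
    ((union_measure_le (a := 1 / 1000) (b := 1 / 1000) (by norm_num) (by norm_num) ?_ ?_).trans
      (ENNReal.ofReal_le_ofReal (by norm_num)))
  · by_contra hn
    simp only [Set.mem_union, Set.mem_preimage, Set.mem_ofPred_eq, not_or, not_le] at hn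
    obtain ⟨n1, n2⟩ := hn
    refine hp ?_
    unfold learner
    split_ifs with h1 h2 h2
    · exact ⟨_, rfl⟩
    · refine absurd ?_ h2
      have : stripCount (chowVector p.1) (chowBias p.1) p.2 ≤ hits (Prod.mk p.1 ⁻¹' D) p.2 :=
        hits_mono p.2 fun i hi => ⟨h1, hi⟩
      linarith
    · exact ⟨_, rfl⟩
    · exact absurd n1.le h2
  · rw [hpres.measure_preimage
      (measurableSet_le measurable_const (measurable_discrepancy _)).nullMeasurableSet]
    exact measure_discrepancy_le hL
  · refine measure_prod_hits_le hDm hL.hits_pos fun S => ?_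
    have h1 : (stdGaussian E).real (Prod.mk S ⁻¹' D) ≤ ε / 2000 := by
      by_cases hS : (1 / 2) ^ (128 * order ε) * (m : ℝ) ^ 2 ≤ ‖chowVector S‖ ^ 2
      · refine (measureReal_mono fun x hx => ?_).trans (stdGaussian_strip_le hL hS (chowBias S))
        exact hx.2
      · rw [show Prod.mk S ⁻¹' D = ∅ from Set.eq_empty_of_forall_notMem fun x hx => hS hx.1,
          measureReal_empty]
        have := hL.eps_pos
        positivity
    have := mul_le_mul_of_nonneg_left h1 hm'.le
    linarith

end Completeness

theorem isTDSLearner_learner {d m : ℕ} {ε : ℝ} (hL : LargeSample d m ε) :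
    IsTDSLearner (generalHalfspaces d) (stdGaussian (EuclideanSpace ℝ (Fin d))) ε (1 / 100)
      (learner ε : (Fin m → EuclideanSpace ℝ (Fin d) × ℤˣ) → _) := by
  intro train test _ _ hfst ⟨f, hf, h⟩
  obtain ⟨h₁, h₂⟩ := add_eq_zero.1 h
  refine ⟨?_, completeness hL hfst⟩
  rcases generalHalfspaces_cases hf with ⟨c, rfl⟩ | ⟨v, τ, hv, rfl⟩
  · exact soundness_const hL hfst h₁ h₂
  · exact soundness_unit hL hfst hv h₁ h₂

end TDS

namespace TDS

/-! ### The choice of the constants -/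

theorem log_two_le_log_max (t : ℝ) : Real.log 2 ≤ Real.log (max t 2) :=
  Real.log_le_log two_pos (le_max_right _ _)

/-- From `2^k ≤ 128/ε` one gets `k log 2 ≤ 7 log 2 + L ≤ 8L` with `L = log max(1/ε, 2)`, and `8 /
log 2 < 12`. -/
theorem order_le_mul_log {ε : ℝ} (hε : 0 < ε) (hε1 : ε < 1) :
    (order ε : ℝ) ≤ 12 * Real.log (max (1 / ε) 2) := by
  have hlog := Real.log_two_gt_d9
  have h1 : (2 : ℝ) ^ order ε ≤ 2 ^ 7 * max (1 / ε) 2 := by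
    have := two_pow_order_mul_le hε1
    calc (2 : ℝ) ^ order ε ≤ 128 * (1 / ε) := by
          rw [mul_one_div, le_div_iff₀ hε]
          exact this
      _ ≤ _ := by
          norm_num
  have h2 := Real.log_le_log (by positivity) h1
  rw [Real.log_pow, Real.log_mul (by positivity) (by positivity), Real.log_pow] at h2
  have h3 := log_two_le_log_max (1 / ε)
  push_cast at h2
  nlinarith [Nat.cast_nonneg (α := ℝ) (order ε)]

/-- The exponent is `143 = 11 + 1 + 128 + 3`: in multiples of `k ≥ 6`, these pay for `2 · 10^18 ≤
2^61`, for `d³`, for the threshold `2^(-128k)`, and for `ε^(-3) ≤ 2^(3k)`. The moment condition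
needs only `12k`. -/
theorem largeSample_of_pow_le {d m : ℕ} {ε : ℝ} (hd : 0 < d) (hε : 0 < ε) (hε1 : ε < 1)
    (hm : (max (d : ℝ) 2) ^ (143 * order ε) ≤ m) : LargeSample d m ε := by
  have hk6 := six_le_order ε
  have h64 := lt_two_pow_order_mul hε
  refine ⟨hd, hε, hε1, ?_, ?_⟩
  all_goals
    set k := order ε
    set D : ℝ := max (d : ℝ) 2 with hD
    have hdD : (d : ℝ) ≤ D := le_max_left _ _
    have h2D : (2 : ℝ) ≤ D := le_max_right _ _
    have h1D : (1 : ℝ) ≤ D := by linarith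
  · have h1 : (1 : ℝ) ≤ (2 ^ k * ε) ^ 3 := one_le_pow₀ (by linarith)
    have h2 : 2 * 10 ^ 18 * (d : ℝ) ^ 3 * 2 ^ (128 * k) * 2 ^ (3 * k) ≤ m := by
      calc 2 * 10 ^ 18 * (d : ℝ) ^ 3 * 2 ^ (128 * k) * 2 ^ (3 * k)
          ≤ 2 ^ 61 * D ^ 3 * D ^ (128 * k) * D ^ (3 * k) := by
            gcongr
            norm_num
        _ ≤ D ^ (11 * k) * D ^ k * D ^ (128 * k) * D ^ (3 * k) := by
            gcongr
            · exact (pow_le_pow_left₀ two_pos.le h2D 61).trans (pow_le_pow_right₀ h1D (by omega))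
            · omega
        _ = D ^ (143 * k) := by ring
        _ ≤ m := hm
    have e : (m : ℝ) * (1 / 2) ^ (128 * k) * ε ^ 3 =
        m / (2 ^ (128 * k) * 2 ^ (3 * k)) * (2 ^ k * ε) ^ 3 := by
      rw [mul_pow, ← pow_mul, mul_comm k 3, one_div, inv_pow]
      field_simp
    rw [e]
    refine le_trans ?_ (le_mul_of_one_le_right (by positivity) h1)
    rw [le_div_iff₀ (by positivity), ← mul_assoc]
    exact h2
  · calc 4000 * (12 * d : ℝ) ^ (2 * k) ≤ 2 ^ 12 * (2 ^ 4 * D) ^ (2 * k) := by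
          gcongr <;> norm_num
      _ ≤ D ^ (2 * k) * (D ^ 4 * D) ^ (2 * k) := by
          gcongr
          exact (pow_le_pow_left₀ two_pos.le h2D 12).trans (pow_le_pow_right₀ h1D (by omega))
      _ = D ^ (12 * k) := by ring
      _ ≤ D ^ (143 * k) := pow_le_pow_right₀ h1D (by omega)
      _ ≤ m := hm

theorem pow_order_le_quasiPoly {c : ℝ} {n d : ℕ} {ε : ℝ} (hc : 12 * n ≤ c) (hε : 0 < ε)
    (hε1 : ε < 1) : (max (d : ℝ) 2) ^ (n * order ε) ≤ quasiPoly c d ε := by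
  have h1 : (1 : ℝ) ≤ max (d : ℝ) 2 := one_le_two.trans (le_max_right _ _)
  have hL := (Real.log_pos one_lt_two).trans_le (log_two_le_log_max (1 / ε))
  rw [quasiPoly, ← Real.rpow_natCast]
  refine Real.rpow_le_rpow_of_exponent_le h1 ?_
  push_cast
  calc (n : ℝ) * order ε ≤ n * (12 * Real.log (max (1 / ε) 2)) := by
        gcongr
        exact order_le_mul_log hε hε1
    _ = (12 * n) * Real.log (max (1 / ε) 2) := by ring
    _ ≤ _ := by gcongr

/-- `2000` exceeds `12 · 143 = 1716`. -/
theorem le_sampleSize {C : ℝ} {d : ℕ} {ε : ℝ} (hC : 2000 ≤ C) (hε : 0 < ε) (hε1 : ε < 1) :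
    (max (d : ℝ) 2) ^ (143 * order ε) ≤ sampleSize C d ε := by
  have h := pow_order_le_quasiPoly (n := 143) (d := d) (c := C) (by push_cast; linarith) hε hε1
  refine (h.trans ?_).trans (Nat.le_ceil _)
  exact le_mul_of_one_le_left (Real.rpow_nonneg (by positivity) _) (by linarith)

/-- Base and logarithm are bounded below by `2` and `log 2`, so constant factors can be moved into
the exponent. -/
theorem const_le_quasiPoly {c : ℝ} (hc : 1 ≤ c) (d : ℕ) (ε : ℝ) :
    c ≤ quasiPoly (Real.log c / Real.log 2 ^ 2) d ε := by
  have h0 := Real.log_pos one_lt_two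
  have hD : Real.log 2 ≤ Real.log (max (d : ℝ) 2) := log_two_le_log_max _
  have hL := log_two_le_log_max (1 / ε)
  have hc' : 0 ≤ Real.log c := Real.log_nonneg hc
  rw [quasiPoly, Real.rpow_def_of_pos (by positivity)]
  refine (Real.exp_log (by linarith)).symm.le.trans (Real.exp_le_exp.2 ?_)
  calc Real.log c = Real.log 2 * (Real.log c / Real.log 2 ^ 2 * Real.log 2) := by field_simp
    _ ≤ _ := mul_le_mul hD (by gcongr) (by positivity) (h0.le.trans hD)

theorem quasiPoly_add (a b : ℝ) (d : ℕ) (ε : ℝ) :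
    quasiPoly (a + b) d ε = quasiPoly a d ε * quasiPoly b d ε := by
  rw [quasiPoly, quasiPoly, quasiPoly, add_mul, Real.rpow_add (by positivity)]

theorem time_le_quasiPoly {C : ℝ} (hC : 2000 ≤ C) {d : ℕ} {ε : ℝ} (hε : 0 < ε) (hε1 : ε < 1) :
    ((5000 * ((sampleSize C d ε + 1) * ((sampleSize C d ε + 1) * (d + order ε + 1))) : ℕ) : ℝ) ≤
      quasiPoly (Real.log (15000 * (C + 2) ^ 2) / Real.log 2 ^ 2 + (C + (C + C))) d ε := by
  have hk6 := six_le_order ε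
  have h2D : (2 : ℝ) ≤ max (d : ℝ) 2 := le_max_right _ _
  have hP := pow_order_le_quasiPoly (n := 1) (d := d) (c := C) (by push_cast; linarith) hε hε1
  rw [one_mul] at hP
  have hk : (order ε : ℝ) ≤ quasiPoly C d ε :=
    calc (order ε : ℝ) ≤ (2 : ℝ) ^ order ε := by exact_mod_cast Nat.lt_two_pow_self.le
      _ ≤ _ := pow_le_pow_left₀ two_pos.le h2D _
      _ ≤ _ := hP
  have hd : (d : ℝ) ≤ quasiPoly C d ε :=
    calc (d : ℝ) ≤ max (d : ℝ) 2 := le_max_left _ _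
      _ ≤ _ := le_self_pow₀ (by linarith) (by omega)
      _ ≤ _ := hP
  have h1 : 1 ≤ quasiPoly C d ε := (one_le_pow₀ (by linarith)).trans hP
  have hm : (sampleSize C d ε : ℝ) + 1 ≤ (C + 2) * quasiPoly C d ε := by
    have := (Nat.ceil_lt_add_one (a := C * quasiPoly C d ε) (by positivity)).le
    rw [sampleSize]
    linarith
  rw [quasiPoly_add, quasiPoly_add, quasiPoly_add]
  set P := quasiPoly C d ε
  calc _ = 5000 * (((sampleSize C d ε : ℝ) + 1) * (((sampleSize C d ε : ℝ) + 1) *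
        (d + order ε + 1))) := by push_cast; ring
    -- Each of `d`, `k` and `1` is at most `P`, whence `3 * P`.
    _ ≤ 5000 * (((C + 2) * P) * (((C + 2) * P) * (3 * P))) := by
        gcongr
        linarith
    _ = 15000 * (C + 2) ^ 2 * (P * (P * P)) := by ring
    _ ≤ _ := by
        gcongr
        exact const_le_quasiPoly (by nlinarith) d ε

end TDS

end

theorem mainTheorem1 :
    ∃ (M : RealRAM.Prog) (C₀ : ℝ), 0 < C₀ ∧ ∀ C : ℝ, C₀ ≤ C →
      ∃ K : ℝ, ∀ (d : ℕ) (ε : ℝ), 1 ≤ d → 0 < ε → ε < 1 →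
        ∃ A : (Fin (TDS.sampleSize C d ε) → EuclideanSpace ℝ (Fin d) × ℤˣ) →
            (Fin (TDS.sampleSize C d ε) → EuclideanSpace ℝ (Fin d)) →
            Option (EuclideanSpace ℝ (Fin d) → ℤˣ),
          TDS.ComputesWithin M ε (TDS.quasiPoly K d ε) A ∧
          TDS.IsTDSLearner (TDS.generalHalfspaces d)
            (ProbabilityTheory.stdGaussian (EuclideanSpace ℝ (Fin d))) ε (1 / 100) A := by
  refine ⟨RealRAM.learnerProg, 2000, by norm_num, fun C hC =>
    ⟨Real.log (15000 * (C + 2) ^ 2) / Real.log 2 ^ 2 + (C + (C + C)), fun d ε hd hε hε1 =>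
      ⟨TDS.learner ε, fun S T => ?_, ?_⟩⟩⟩
  · obtain ⟨s, n, he, hn, ho⟩ := RealRAM.runs_learnerProg hε S T
    exact ⟨s, n, he, (Nat.cast_le.2 hn).trans (TDS.time_le_quasiPoly hC hε hε1), ho⟩
  · exact TDS.isTDSLearner_learner
      (TDS.largeSample_of_pow_le hd hε hε1 (TDS.le_sampleSize hC hε hε1))
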